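/- Let $k\ge 3$ and $1\le s\le k-1$ be integers, and for $n\in\mathbb N=\{1,2,\dots\}$ let $$A_{k,s}(n)=\#\{(x_1,\dots,x_k)\in\mathbb N^k:\ x_1+\cdots+x_k=n,\ \gcd(x_1\cdots x_s,\,x_{s+1}\cdots x_k)=1\}.$$ Put $$F_{k,s}(x)=\frac1x\left(x^k+(x-1)^k-x^s(x-1)^{k-s}-x^{k-s}(x-1)^s+(-1)^{k-1}\right),$$ $$C_{k,s}=\prod_p\left(1-\frac{F_{k,s}(p)}{p^{k-1}}\right),\qquad f_{k,s}(n)=\prod_{p\mid n}\left(1+\frac{(-1)^{k-1}}{p^{k-1}-F_{k,s}(p)}\right),$$ where the first product is over all primes $p$ and the second over the primes $p$ dividing $n$. Then the Euler product $C_{k,s}$ converges unconditionally, $p^{k-1}-F_{k,s}(p)\neq 0$ for every prime $p$, and, as $n\to\infty$, $$A_{k,s}(n)=C_{k,s}\,f_{k,s}(n)\,\frac{n^{k-1}}{(k-1)!}+\begin{cases}O\left(n^{k-2}(\log n)^{\max(s,k-s)}\right), & k\ge 4,\\ O\left(n(\log n)^2\log\log n\right), & k=3,\end{cases}$$ where the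 implied constants may depend on $k$ and $s$. -/

import Mathlib

open Filter Asymptotics

/-- `A_{k,s}(n)`: the number of `k`-compositions `x_1 + ⋯ + x_k = n` into positive integers with
`gcd (x_1 ⋯ x_s, x_{s+1} ⋯ x_k) = 1`. The parts are indexed by `Fin k`, so that the first `s`
parts are those with index `i < s`. -/
def coprimeCompositions (k s n : ℕ) : ℕ :=
  ((Finset.univ.piAntidiag n : Finset (Fin k → ℕ)).filter fun x =>
    (∀ i, 1 ≤ x i) ∧
      Nat.gcd (∏ i : Fin k with i.val < s, x i) (∏ i : Fin k with s ≤ i.val, x i) = 1).card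

/-- The same count as the cardinality of a set of tuples. -/
theorem coprimeCompositions_eq_ncard (k s n : ℕ) :
    coprimeCompositions k s n =
      Set.ncard {x : Fin k → ℕ | (∀ i, 1 ≤ x i) ∧ ∑ i, x i = n ∧
        Nat.gcd (∏ i : Fin k with i.val < s, x i) (∏ i : Fin k with s ≤ i.val, x i) = 1} := by
  rw [coprimeCompositions, ← Set.ncard_coe_finset]
  congr 1
  ext x
  simp only [Finset.coe_filter, Finset.mem_piAntidiag, Set.mem_ofPred_eq]
  simp
  tauto

/-- `F_{k,s}(x) = (1/x) (x^k + (x-1)^k - x^s (x-1)^(k-s) - x^(k-s) (x-1)^s + (-1)^(k-1))`;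
for `1 ≤ s ≤ k - 1` the bracket vanishes at `0`, so this is a polynomial in `x ≠ 0`. -/
noncomputable def polyF (k s : ℕ) (x : ℝ) : ℝ :=
  1 / x * (x ^ k + (x - 1) ^ k - x ^ s * (x - 1) ^ (k - s) - x ^ (k - s) * (x - 1) ^ s
    + (-1) ^ (k - 1))

/-- The factor `1 - F_{k,s}(p) / p^(k-1)` of the Euler product at the prime `p`. -/
noncomputable def eulerFactor (k s : ℕ) (p : Nat.Primes) : ℝ :=
  1 - polyF k s (p : ℕ) / ((p : ℕ) : ℝ) ^ (k - 1)

/-- `C_{k,s}`, the product of the Euler factors over all primes. -/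
noncomputable def constC (k s : ℕ) : ℝ :=
  ∏' p : Nat.Primes, eulerFactor k s p

/-- `f_{k,s}(n)`, a product over the primes dividing `n`. -/
noncomputable def arithF (k s n : ℕ) : ℝ :=
  ∏ p ∈ n.primeFactors, (1 + (-1) ^ (k - 1) / ((p : ℝ) ^ (k - 1) - polyF k s p))

/-- `A_{k,s}(n) - C_{k,s} f_{k,s}(n) n^(k-1) / (k-1)!`, the difference between the count and its
main term. -/
noncomputable def errorTerm (k s n : ℕ) : ℝ :=
  (coprimeCompositions k s n : ℝ)
    - constC k s * arithF k s n * ((n : ℝ) ^ (k - 1) / ((k - 1).factorial : ℝ))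

/-! The count is sieved by Möbius inversion over the gcd. At a prime `p`, the event that `p` divides
the gcd is a signed sum, over index sets `V`, of the events that `p` divides every part in `V`; in
general the sets meeting both groups occur, with sign `(-1)^|V|`. Expanding the product over the
primes of a squarefree `d` assigns each prime to one `V`, that is, writes `d = ∏ U_V`. The count
becomes a signed sum of lattice counts of compositions with the `i`-th part divisible by `e_i = ∏_{V
∋ i} U_V` (`abs_coprimeCompositions_sub_le`). The main terms factor over primes and build a singular
series with Euler product `C_{k,s} f_{k,s}(n)` (`tsum_seriesTerm`); truncating it at `n^(4k)` costs
`O(1)`.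

The difficulty is the sum of the lattice errors. Removing the parts one at a time bounds each error
by `n^(k-2)` times the sum of `gcd(e_i : i > j) / ∏_{i ≠ j} e_i` over all positions `j` but the last
(`latticeErr_le`), for any chosen order of the parts. Each such term is a product of powers of the
`U_V`. Summed over a box, an exponent `-1` costs a logarithm and an exponent bounded away below `-1`
costs nothing (`sum_box_prod_rpow_le`), so at most `max(s, k-s)` sets may have weight near `1`, and
none less. The penultimate position is the bad one: there the gcd is a single modulus, which cancels
entirely.

By the symmetry `s ↔ k-s` one may take `s ≤ k-s`, leaving three cases. If `k-s ≥ 3`, the largest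
modulus of the second group is placed just before the last two positions; it survives in the
denominator of the penultimate term and saves a power of `d` (`gcdTerm_penultimate_le`). If `k = 3`,
the relation `x_0 + x_1 + x_2 = n` allows an inclusion–exclusion with only two pairs
(`sum_threeCoeff`), giving two logarithms. If `k = 4` and `s = 2`, the penultimate term is replaced
by a direct count of the first two parts (`latticeErr_four_le`), summed over nine variables after a
reduction by symmetry (`sum_roundedBound_le`). The bound obtained for `k = 3` has no `log log`
factor. -/

section Lattice

/-! ### Compositions with prescribed divisors of the parts. -/

open Finset

/-- The integral of `(j+1) t^j` over `[a, b]` lies between its endpoint estimates. It compares one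
block of a power sum with the increment of the main term. -/
theorem mul_pow_le_pow_succ_sub (j : ℕ) {a b : ℝ} (ha : 0 ≤ a) (hab : a ≤ b) :
    (j + 1) * (b - a) * a ^ j ≤ b ^ (j + 1) - a ^ (j + 1) ∧
      b ^ (j + 1) - a ^ (j + 1) ≤ (j + 1) * (b - a) * b ^ j := by
  induction j with
  | zero => simp
  | succ j ih =>
    have hb : 0 ≤ b := ha.trans hab
    have h1 : a ^ (j + 1) ≤ b ^ (j + 1) := pow_le_pow_left₀ ha hab _
    have h2 := sub_nonneg.2 hab
    obtain ⟨ih1, ih2⟩ := ih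
    have e : b ^ (j + 1 + 1) - a ^ (j + 1 + 1) =
        a * (b ^ (j + 1) - a ^ (j + 1)) + b ^ (j + 1) * (b - a) := by ring
    have e' : b ^ (j + 1 + 1) - a ^ (j + 1 + 1) =
        b * (b ^ (j + 1) - a ^ (j + 1)) + a ^ (j + 1) * (b - a) := by ring
    have h3 := mul_le_mul_of_nonneg_right h1 h2
    constructor
    · have h4 := mul_le_mul_of_nonneg_left ih1 ha
      rw [show a * ((j + 1) * (b - a) * a ^ j) = (j + 1) * (b - a) * a ^ (j + 1) by ring] at h4
      rw [e]
      push_cast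
      linarith
    · have h4 := mul_le_mul_of_nonneg_left ih2 hb
      rw [show b * ((j + 1) * (b - a) * b ^ j) = (j + 1) * (b - a) * b ^ (j + 1) by ring] at h4
      rw [e']
      push_cast
      linarith

theorem filter_modEq_Ico_add (n b : ℕ) {l : ℕ} (hl : 0 < l) :
    ∃ y ∈ Ico n (n + l), (Ico n (n + l)).filter (fun y => y ≡ b [MOD l]) = {y} := by
  have hcard : ((Ico n (n + l)).filter (fun y => y ≡ b [MOD l])).card = 1 := by
    have h := Nat.count_modEq_card_eq_ceil (n + l) hl b
    have h' := Nat.count_modEq_card_eq_ceil n hl b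
    rw [Nat.count_eq_card_filter_range] at h h'
    have hu : (range (n + l)).filter (fun y => y ≡ b [MOD l]) =
        (range n).filter (fun y => y ≡ b [MOD l]) ∪
          (Ico n (n + l)).filter (fun y => y ≡ b [MOD l]) := by
      rw [← filter_union]
      congr 1
      ext y
      simp only [mem_range, mem_union, mem_Ico]
      omega
    have hd : Disjoint ((range n).filter (fun y => y ≡ b [MOD l]))
        ((Ico n (n + l)).filter (fun y => y ≡ b [MOD l])) := by
      apply disjoint_filter_filter
      rw [disjoint_left]
      simp only [mem_range, mem_Ico]
      omega
    rw [hu, card_union_of_disjoint hd] at h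
    have hq : ((((n + l : ℕ) : ℚ) - ((b % l : ℕ) : ℚ)) / l) =
        ((n : ℚ) - ((b % l : ℕ) : ℚ)) / l + 1 := by
      have : (l : ℚ) ≠ 0 := by positivity
      field_simp
      push_cast
      ring
    rw [hq, Int.ceil_add_one] at h
    push_cast at h
    omega
  obtain ⟨y, hy⟩ := card_eq_one.1 hcard
  have : y ∈ (Ico n (n + l)).filter (fun y => y ≡ b [MOD l]) := by rw [hy]; simp
  exact ⟨y, (mem_filter.1 this).1, hy⟩

/-- Power sums over a residue class. -/
theorem abs_sum_pow_modEq_sub_le (j b n : ℕ) {l : ℕ} (hl : 0 < l) :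
    |∑ y ∈ (Ico 1 n).filter (fun y => y ≡ b [MOD l]), (y : ℝ) ^ j -
      (n : ℝ) ^ (j + 1) / ((j + 1) * l)| ≤ (n : ℝ) ^ j := by
  have hl' : (0 : ℝ) < l := by exact_mod_cast hl
  have hj : (0 : ℝ) < j + 1 := by positivity
  induction n using Nat.strong_induction_on with
  | _ n ih =>
  rcases le_or_gt n l with h | h
  · have hub : ∑ y ∈ (Ico 1 n).filter (fun y => y ≡ b [MOD l]), (y : ℝ) ^ j ≤ (n : ℝ) ^ j := by
      obtain ⟨y, hy, hy'⟩ := filter_modEq_Ico_add 0 b hl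
      have hsub : (Ico 1 n).filter (fun y => y ≡ b [MOD l]) ⊆ {y} := by
        rw [← hy']
        intro z hz
        simp only [mem_filter, mem_Ico] at hz ⊢
        exact ⟨⟨by omega, by omega⟩, hz.2⟩
      rcases subset_singleton_iff.1 hsub with h0 | h0
      · rw [h0]
        simp
      · rw [h0, sum_singleton]
        have : y ∈ (Ico 1 n).filter (fun y => y ≡ b [MOD l]) := by rw [h0]; simp
        have : y < n := (mem_Ico.1 (mem_filter.1 this).1).2
        gcongr
    have hnn : 0 ≤ ∑ y ∈ (Ico 1 n).filter (fun y => y ≡ b [MOD l]), (y : ℝ) ^ j := by positivity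
    have hm : (n : ℝ) ^ (j + 1) / ((j + 1) * l) ≤ (n : ℝ) ^ j := by
      rw [div_le_iff₀ (by positivity), pow_succ]
      have h1 : (n : ℝ) ≤ l := by exact_mod_cast h
      have : (n : ℝ) ≤ (j + 1) * l := by nlinarith [(Nat.cast_nonneg j : (0 : ℝ) ≤ j)]
      gcongr
    have hm0 : 0 ≤ (n : ℝ) ^ (j + 1) / ((j + 1) * l) := by positivity
    rw [abs_le]
    constructor <;> linarith
  -- A block of length `l` contains exactly one `y` of the class. Both `y^j` and the increment of
  -- the main term lie between `m^j` and `(m+l)^j`, so the error grows by at most `(m+l)^j - m^j`,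
  -- and these bounds telescope.
  · obtain ⟨m, rfl⟩ := Nat.exists_eq_add_of_le' h.le
    have hm := ih m (by omega)
    obtain ⟨y, hy, hy'⟩ := filter_modEq_Ico_add m b hl
    have hu : (Ico 1 (m + l)).filter (fun y => y ≡ b [MOD l]) =
        (Ico 1 m).filter (fun y => y ≡ b [MOD l]) ∪
          (Ico m (m + l)).filter (fun y => y ≡ b [MOD l]) := by
      rw [← filter_union]
      congr 1
      ext y
      simp only [mem_union, mem_Ico]
      omega
    have hd : Disjoint ((Ico 1 m).filter (fun y => y ≡ b [MOD l]))
        ((Ico m (m + l)).filter (fun y => y ≡ b [MOD l])) := by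
      apply disjoint_filter_filter
      rw [disjoint_left]
      simp only [mem_Ico]
      omega
    rw [hu, sum_union hd, hy', sum_singleton]
    rw [mem_Ico] at hy
    have hy1 : (m : ℝ) ^ j ≤ (y : ℝ) ^ j := by
      have : m ≤ y := hy.1
      gcongr
    have hy2 : (y : ℝ) ^ j ≤ ((m : ℝ) + l) ^ j := by
      have : (y : ℝ) ≤ (m : ℝ) + l := by exact_mod_cast hy.2.le
      gcongr
    obtain ⟨h1, h2⟩ := mul_pow_le_pow_succ_sub j (a := (m : ℝ)) (b := (m : ℝ) + l)
      (by positivity) (by linarith)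
    have e : ((m + l : ℕ) : ℝ) = m + l := by push_cast; ring
    rw [e]
    have h3 : (m : ℝ) ^ j ≤ ((m : ℝ) + l) ^ (j + 1) / ((j + 1) * l) -
        (m : ℝ) ^ (j + 1) / ((j + 1) * l) := by
      rw [← sub_div, le_div_iff₀ (by positivity)]
      linarith
    have h4 : ((m : ℝ) + l) ^ (j + 1) / ((j + 1) * l) -
        (m : ℝ) ^ (j + 1) / ((j + 1) * l) ≤ ((m : ℝ) + l) ^ j := by
      rw [← sub_div, div_le_iff₀ (by positivity)]
      linarith
    rw [abs_le] at hm ⊢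
    constructor <;> linarith

/-- The number of compositions of `n` into `k` positive parts with the `i`-th part divisible
by `e i`. -/
def latticeCount {k : ℕ} (e : Fin k → ℕ) (n : ℕ) : ℕ :=
  ((univ.piAntidiag n : Finset (Fin k → ℕ)).filter fun x => ∀ i, 1 ≤ x i ∧ e i ∣ x i).card

/-- The main term of `latticeCount`. -/
noncomputable def latticeMain {k : ℕ} (e : Fin k → ℕ) (n : ℕ) : ℝ :=
  if univ.gcd e ∣ n then
    ((univ.gcd e : ℕ) : ℝ) / (∏ i, (e i : ℝ)) * ((n : ℝ) ^ (k - 1) / ((k - 1).factorial : ℝ))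
  else 0

/-- The absolute error in `latticeCount`. -/
noncomputable def latticeErr {k : ℕ} (e : Fin k → ℕ) (n : ℕ) : ℝ :=
  |(latticeCount e n : ℝ) - latticeMain e n|

theorem latticeErr_nonneg {k : ℕ} (e : Fin k → ℕ) (n : ℕ) : 0 ≤ latticeErr e n := abs_nonneg _

theorem latticeCount_comp_perm {k : ℕ} (e : Fin k → ℕ) (n : ℕ) (σ : Equiv.Perm (Fin k)) :
    latticeCount (e ∘ σ) n = latticeCount e n := by
  unfold latticeCount
  refine card_nbij' (fun x => x ∘ σ.symm) (fun x => x ∘ σ) ?_ ?_ ?_ ?_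
  · intro x hx
    simp only [coe_filter, mem_piAntidiag, Set.mem_ofPred_eq, Function.comp] at hx ⊢
    refine ⟨⟨?_, by simp⟩, fun i => ?_⟩
    · rw [← hx.1.1]
      exact Equiv.sum_comp σ.symm x
    · have := hx.2 (σ.symm i)
      simpa using this
  · intro x hx
    simp only [coe_filter, mem_piAntidiag, Set.mem_ofPred_eq, Function.comp] at hx ⊢
    refine ⟨⟨?_, by simp⟩, fun i => hx.2 (σ i)⟩
    rw [← hx.1.1]
    exact Equiv.sum_comp σ x
  · intro x _
    ext i
    simp
  · intro x _
    ext i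
    simp

theorem gcd_comp_perm {k : ℕ} (e : Fin k → ℕ) (σ : Equiv.Perm (Fin k)) :
    univ.gcd (e ∘ σ) = univ.gcd e := by
  classical
  rw [← gcd_image, image_univ_equiv]

/-- The bound `latticeErr_le` depends on the order of the parts but the error does not, so the order
may be adapted to the moduli. -/
theorem latticeErr_comp_perm {k : ℕ} (e : Fin k → ℕ) (n : ℕ) (σ : Equiv.Perm (Fin k)) :
    latticeErr (e ∘ σ) n = latticeErr e n := by
  unfold latticeErr latticeMain
  rw [latticeCount_comp_perm, gcd_comp_perm]
  simp only [Function.comp]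
  rw [Equiv.prod_comp σ (fun i => (e i : ℝ))]

/-- The variable `y = n - x 0` is what remains for the other parts; `y < n` encodes `x 0 ≥ 1`. -/
theorem latticeCount_succ {k : ℕ} (e : Fin (k + 1) → ℕ) (n : ℕ) :
    latticeCount e n =
      ∑ y ∈ (range n).filter (fun y => e 0 ∣ n - y), latticeCount (Fin.tail e) y := by
  unfold latticeCount
  rw [card_eq_sum_card_fiberwise (f := fun x : Fin (k + 1) → ℕ => n - x 0)
    (t := (range n).filter (fun y => e 0 ∣ n - y))]
  · refine sum_congr rfl fun y hy => ?_
    simp only [mem_filter, mem_range] at hy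
    refine card_nbij' (fun x => Fin.tail x) (fun x => Fin.cons (n - y) x) ?_ ?_ ?_ ?_
    · intro x hx
      simp only [coe_filter, mem_filter, mem_piAntidiag, Set.mem_ofPred_eq] at hx ⊢
      obtain ⟨⟨⟨h1, -⟩, h2⟩, h3⟩ := hx
      rw [Fin.sum_univ_succ] at h1
      refine ⟨⟨?_, by simp⟩, fun i => h2 i.succ⟩
      change ∑ i : Fin k, x i.succ = y
      omega
    · intro x hx
      simp only [coe_filter, mem_filter, mem_piAntidiag, Set.mem_ofPred_eq] at hx ⊢
      obtain ⟨⟨h1, -⟩, h2⟩ := hx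
      refine ⟨⟨⟨?_, by simp⟩, fun i => ?_⟩, ?_⟩
      · rw [Fin.sum_univ_succ]
        simp only [Fin.cons_zero, Fin.cons_succ, h1]
        omega
      · refine Fin.cases ?_ (fun i => ?_) i
        · simp only [Fin.cons_zero]
          exact ⟨by omega, hy.2⟩
        · simpa only [Fin.cons_succ, Fin.tail] using h2 i
      · simp only [Fin.cons_zero]
        omega
    · intro x hx
      simp only [coe_filter, mem_filter, mem_piAntidiag, Set.mem_ofPred_eq] at hx
      obtain ⟨⟨⟨h1, -⟩, h2⟩, h3⟩ := hx
      rw [Fin.sum_univ_succ] at h1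
      have : n - y = x 0 := by omega
      rw [this]
      exact Fin.cons_self_tail x
    · intro x _
      simp
  · intro x hx
    simp only [coe_filter, mem_piAntidiag, Set.mem_ofPred_eq, mem_range] at hx ⊢
    obtain ⟨⟨h1, -⟩, h2⟩ := hx
    rw [Fin.sum_univ_succ] at h1
    have h0 := h2 0
    refine ⟨by omega, ?_⟩
    have : n - (n - x 0) = x 0 := by omega
    rw [this]
    exact h0.2

theorem univ_gcd_succ {k : ℕ} (e : Fin (k + 1) → ℕ) :
    univ.gcd e = Nat.gcd (e 0) (univ.gcd (Fin.tail e)) := by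
  classical
  rw [Fin.univ_succ, cons_eq_insert, gcd_insert]
  congr 1
  rw [map_eq_image, gcd_image]
  rfl

theorem dvd_sub_iff_modEq {a n y : ℕ} (h : y ≤ n) : a ∣ n - y ↔ y ≡ n [MOD a] :=
  (Nat.modEq_iff_dvd' h).symm

theorem modEq_lcm_iff {a b y z : ℕ} :
    y ≡ z [MOD Nat.lcm a b] ↔ y ≡ z [MOD a] ∧ y ≡ z [MOD b] := by
  simp only [Nat.modEq_iff_dvd]
  rw [← Int.coe_lcm_dvd_iff]
  rfl

/-- Splitting off the first part costs only the error of a one-dimensional sum. -/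
theorem latticeErr_succ_le {k : ℕ} (hk : 1 ≤ k) (e : Fin (k + 1) → ℕ) (he : ∀ i, 0 < e i)
    (n : ℕ) :
    latticeErr e n ≤
      ∑ y ∈ (Ico 1 n).filter (fun y => e 0 ∣ n - y), latticeErr (Fin.tail e) y +
        (n : ℝ) ^ (k - 1) * (((univ.gcd (Fin.tail e) : ℕ) : ℝ) / ∏ i, (Fin.tail e i : ℝ)) := by
  set G := univ.gcd (Fin.tail e) with hG
  set Q : ℝ := ∏ i, (Fin.tail e i : ℝ) with hQ
  have hQpos : 0 < Q := prod_pos fun i _ => by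
    have := he i.succ
    simp only [Fin.tail]
    exact_mod_cast this
  have hGpos : 0 < G := by
    rw [Nat.pos_iff_ne_zero]
    intro h0
    have := Finset.gcd_eq_zero_iff.1 h0 ⟨0, hk⟩ (mem_univ _)
    have h2 := he (Fin.succ ⟨0, hk⟩)
    simp only [Fin.tail] at this
    omega
  have hkey : |∑ y ∈ (Ico 1 n).filter (fun y => e 0 ∣ n - y), latticeMain (Fin.tail e) y -
      latticeMain e n| ≤ (n : ℝ) ^ (k - 1) * ((G : ℝ) / Q) := by
    have hsum : ∑ y ∈ (Ico 1 n).filter (fun y => e 0 ∣ n - y), latticeMain (Fin.tail e) y =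
        (G : ℝ) / Q / ((k - 1).factorial : ℝ) *
          ∑ y ∈ (Ico 1 n).filter (fun y => e 0 ∣ n - y ∧ G ∣ y), (y : ℝ) ^ (k - 1) := by
      rw [mul_sum, ← filter_filter, sum_filter (fun y => G ∣ y)]
      refine sum_congr rfl fun y _ => ?_
      unfold latticeMain
      rw [← hG]
      split_ifs
      · ring
      · rfl
    rw [hsum]
    by_cases hdiv : univ.gcd e ∣ n
    · have hdiv' : Nat.gcd (e 0) G ∣ n := by rwa [univ_gcd_succ] at hdiv
      obtain ⟨b, hb1, hb2⟩ := Nat.chineseRemainder' (n := e 0) (m := G) (a := n) (b := 0)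
        ((Nat.modEq_zero_iff_dvd).2 hdiv')
      have hl : 0 < Nat.lcm (e 0) G := Nat.lcm_pos (he 0) hGpos
      have hfil : (Ico 1 n).filter (fun y => e 0 ∣ n - y ∧ G ∣ y) =
          (Ico 1 n).filter (fun y => y ≡ b [MOD Nat.lcm (e 0) G]) := by
        refine filter_congr fun y hy => ?_
        rw [mem_Ico] at hy
        rw [dvd_sub_iff_modEq hy.2.le, ← Nat.modEq_zero_iff_dvd]
        constructor
        · rintro ⟨h1, h2⟩
          exact modEq_lcm_iff.2 ⟨h1.trans hb1.symm, h2.trans hb2.symm⟩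
        · intro h
          obtain ⟨h1, h2⟩ := modEq_lcm_iff.1 h
          exact ⟨h1.trans hb1, h2.trans hb2⟩
      rw [hfil]
      have hS := abs_sum_pow_modEq_sub_le (k - 1) b n hl
      obtain ⟨j, rfl⟩ : ∃ j, k = j + 1 := ⟨k - 1, by omega⟩
      simp only [Nat.add_sub_cancel] at hS ⊢
      have hmain : latticeMain e n = (G : ℝ) / Q / (j.factorial : ℝ) *
          ((n : ℝ) ^ (j + 1) / ((j + 1) * (Nat.lcm (e 0) G : ℕ))) := by
        unfold latticeMain
        rw [if_pos hdiv, univ_gcd_succ, Fin.prod_univ_succ]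
        have hlcm : ((Nat.gcd (e 0) G : ℕ) : ℝ) * ((Nat.lcm (e 0) G : ℕ) : ℝ) = e 0 * G := by
          exact_mod_cast Nat.gcd_mul_lcm (e 0) G
        have h1 : ((Nat.lcm (e 0) G : ℕ) : ℝ) ≠ 0 := by positivity
        have h2 : ((e 0 : ℕ) : ℝ) ≠ 0 := by
          have := he 0
          positivity
        have h3 : (j.factorial : ℝ) ≠ 0 := by positivity
        change ((Nat.gcd (e 0) G : ℕ) : ℝ) / (e 0 * Q) *
          ((n : ℝ) ^ (j + 1) / (((j + 1).factorial : ℕ) : ℝ)) = _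
        rw [Nat.factorial_succ]
        push_cast
        have h4 : (j + 1 : ℝ) ≠ 0 := by positivity
        field_simp
        linear_combination (n : ℝ) ^ (j + 1) * hlcm
      rw [hmain, ← mul_sub, abs_mul, abs_of_nonneg (by positivity)]
      have hf : (1 : ℝ) ≤ (j.factorial : ℝ) := by exact_mod_cast Nat.one_le_iff_ne_zero.2 (Nat.factorial_ne_zero j)
      calc (G : ℝ) / Q / (j.factorial : ℝ) * _ ≤ (G : ℝ) / Q / (j.factorial : ℝ) * (n : ℝ) ^ j := by
            gcongr
        _ ≤ (G : ℝ) / Q * (n : ℝ) ^ j := by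
            exact mul_le_mul_of_nonneg_right (div_le_self (by positivity) hf) (by positivity)
        _ = _ := by ring
    · have h0 : (Ico 1 n).filter (fun y => e 0 ∣ n - y ∧ G ∣ y) = ∅ := by
        rw [filter_eq_empty_iff]
        rintro y hy ⟨h1, h2⟩
        rw [mem_Ico] at hy
        apply hdiv
        rw [univ_gcd_succ]
        have h3 := (Nat.gcd_dvd_left (e 0) G).trans h1
        have h4 := (Nat.gcd_dvd_right (e 0) G).trans h2
        have := Nat.dvd_add h3 h4
        rwa [Nat.sub_add_cancel hy.2.le] at this
      rw [h0]
      unfold latticeMain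
      rw [if_neg hdiv]
      simp only [sum_empty, mul_zero, sub_zero, abs_zero]
      positivity
  have hcount : (latticeCount e n : ℝ) =
      ∑ y ∈ (Ico 1 n).filter (fun y => e 0 ∣ n - y), (latticeCount (Fin.tail e) y : ℝ) := by
    have h0 : latticeCount (Fin.tail e) 0 = 0 := by
      unfold latticeCount
      rw [card_eq_zero, filter_eq_empty_iff]
      intro x hx hx'
      have h1 := (mem_piAntidiag.1 hx).1
      have h2 := (hx' ⟨0, hk⟩).1
      have h3 := (sum_eq_zero_iff.1 h1) ⟨0, hk⟩ (mem_univ _)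
      omega
    rw [latticeCount_succ, sum_filter, sum_filter, range_eq_Ico]
    rcases Nat.eq_zero_or_pos n with rfl | hn
    · simp
    · rw [sum_eq_sum_Ico_succ_bot hn, h0]
      push_cast
      simp
  calc latticeErr e n
      = |∑ y ∈ (Ico 1 n).filter (fun y => e 0 ∣ n - y),
          ((latticeCount (Fin.tail e) y : ℝ) - latticeMain (Fin.tail e) y) +
        (∑ y ∈ (Ico 1 n).filter (fun y => e 0 ∣ n - y), latticeMain (Fin.tail e) y -
          latticeMain e n)| := by
        unfold latticeErr
        rw [sum_sub_distrib, hcount]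
        congr 1
        ring
    _ ≤ _ := (abs_add_le _ _).trans (add_le_add (abs_sum_le_sum_abs _ _) hkey)

/-- A single part is counted exactly, which is why the last position is absent from `latticeErr_le`.
Positivity of `n` matters: at `0` the count is `0` and the main term is `1`. -/
theorem latticeErr_one (e : Fin 1 → ℕ) (he : 0 < e 0) {n : ℕ} (hn : 0 < n) :
    latticeErr e n = 0 := by
  have hg : univ.gcd e = e 0 := by simp
  have hc : latticeCount e n = if e 0 ∣ n then 1 else 0 := by
    rw [latticeCount_succ]
    have h0 : ∀ y, latticeCount (Fin.tail e) y = if y = 0 then 1 else 0 := by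
      intro y
      unfold latticeCount
      rcases eq_or_ne y 0 with rfl | hy
      · simp
      · rw [if_neg hy, card_eq_zero, filter_eq_empty_iff]
        intro x hx
        rw [mem_piAntidiag] at hx
        exact absurd hx.1.symm (by simpa using hy)
    simp_rw [h0]
    rw [sum_filter]
    simp_rw [← ite_and]
    rw [Finset.sum_eq_single 0]
    · simp
    · intro y _ hy
      rw [if_neg (fun h => hy h.2)]
    · intro h
      exact absurd (mem_range.2 hn) h
  have h2 : (e 0 : ℝ) ≠ 0 := by positivity
  unfold latticeErr latticeMain
  rw [hg, hc]
  split_ifs <;> simp [h2]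

theorem card_filter_dvd_sub_le (n a : ℕ) :
    (((range n).filter (fun y => a ∣ n - y)).card : ℝ) ≤ n / a := by
  have : ((range n).filter (fun y => a ∣ n - y)).card = n / a := by
    rw [← Nat.Ioc_filter_dvd_card_eq_div]
    refine card_nbij' (fun y => n - y) (fun y => n - y) ?_ ?_ ?_ ?_ <;>
      intro y <;> simp only [coe_filter, mem_range, mem_Ioc, Set.mem_ofPred_eq]
    · rintro ⟨h1, h2⟩
      exact ⟨by omega, h2⟩
    · rintro ⟨h1, h2⟩
      refine ⟨by omega, ?_⟩
      have : n - (n - y) = y := by omega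
      rwa [this]
    · omega
    · omega
  rw [this]
  exact Nat.cast_div_le

/-- The ratio of the gcd of the `e i`, `i ∈ S`, to the product of all `e i` except `e v`. -/
noncomputable def gcdTerm {k : ℕ} (e : Fin k → ℕ) (v : Fin k) (S : Finset (Fin k)) : ℝ :=
  ((S.gcd e : ℕ) : ℝ) / ∏ i ∈ univ.erase v, (e i : ℝ)

theorem gcdTerm_nonneg {k : ℕ} (e : Fin k → ℕ) (v : Fin k) (S : Finset (Fin k)) :
    0 ≤ gcdTerm e v S := by
  unfold gcdTerm
  positivity

theorem gcdTerm_zero {k : ℕ} (e : Fin (k + 1) → ℕ) :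
    gcdTerm e 0 (Ioi 0) = ((univ.gcd (Fin.tail e) : ℕ) : ℝ) / ∏ i, (Fin.tail e i : ℝ) := by
  classical
  have h1 : (Ioi (0 : Fin (k + 1))).gcd e = univ.gcd (Fin.tail e) := by
    rw [Fin.Ioi_zero_eq_map, map_eq_image, gcd_image]
    rfl
  have h2 : ∏ i ∈ univ.erase (0 : Fin (k + 1)), (e i : ℝ) = ∏ i, (Fin.tail e i : ℝ) := by
    rw [Fin.univ_succ, erase_cons, prod_map]
    rfl
  rw [gcdTerm, h1, h2]

theorem gcdTerm_succ {k : ℕ} (e : Fin (k + 1) → ℕ) (j : Fin k) :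
    gcdTerm e j.succ (Ioi j.succ) = gcdTerm (Fin.tail e) j (Ioi j) / e 0 := by
  classical
  have h1 : (Ioi j.succ).gcd e = (Ioi j).gcd (Fin.tail e) := by
    rw [← Fin.map_succEmb_Ioi, map_eq_image, gcd_image]
    rfl
  have h2 : ∏ i ∈ univ.erase j.succ, (e i : ℝ) =
      e 0 * ∏ i ∈ univ.erase j, (Fin.tail e i : ℝ) := by
    have : univ.erase j.succ = cons 0 ((univ.erase j).map (Fin.succEmb k)) (by simp) := by
      ext i
      refine Fin.cases ?_ (fun i => ?_) i
      · simp [(Fin.succ_ne_zero j).symm]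
      · simp [Fin.succ_ne_zero]
    rw [this, prod_cons, prod_map]
    rfl
  rw [gcdTerm, gcdTerm, h1, h2, div_div, mul_comm (e 0 : ℝ)]

/-- Induction on the number of parts: splitting off the first part creates the term `j = 0`, and the
errors of the tail are summed over at most `n / e 0` remainders, which supplies the missing factor
`e 0` in the other denominators. -/
theorem latticeErr_le {k : ℕ} (e : Fin (k + 1) → ℕ) (he : ∀ i, 0 < e i) {n : ℕ} (hn : 0 < n) :
    latticeErr e n ≤ (n : ℝ) ^ (k - 1) *
      ∑ j ∈ (univ : Finset (Fin (k + 1))).filter (fun j => j.val < k), gcdTerm e j (Ioi j) := by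
  induction k generalizing n with
  | zero =>
    rw [latticeErr_one e (he 0) hn]
    simp
  | succ k ih =>
    refine (latticeErr_succ_le (by omega) e he n).trans ?_
    have htail : ∀ i, 0 < Fin.tail e i := fun i => he i.succ
    set E := ∑ j ∈ (univ : Finset (Fin (k + 1))).filter (fun j => j.val < k),
      gcdTerm (Fin.tail e) j (Ioi j) with hE
    have hE0 : 0 ≤ E := sum_nonneg fun _ _ => gcdTerm_nonneg _ _ _
    have h1 : ∑ j ∈ (univ : Finset (Fin (k + 2))).filter (fun j => j.val < k + 1),
        gcdTerm e j (Ioi j) = ((univ.gcd (Fin.tail e) : ℕ) : ℝ) / ∏ i, (Fin.tail e i : ℝ) +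
          E / e 0 := by
      rw [sum_filter, Fin.sum_univ_succ, if_pos (by simp), gcdTerm_zero, hE, sum_filter, sum_div]
      congr 1
      refine sum_congr rfl fun j _ => ?_
      simp only [Fin.val_succ, Nat.add_lt_add_iff_right]
      split_ifs
      · exact gcdTerm_succ e j
      · simp
    rw [h1, mul_add, add_comm]
    simp only [Nat.add_sub_cancel]
    gcongr
    -- Because of truncated subtraction `n * n^(k-1) = n^k` can fail at `k = 0`; there the tail has
    -- one part and no error.
    rcases Nat.eq_zero_or_pos k with rfl | hk
    · have hE' : E = 0 := by simp [hE]
      rw [hE']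
      simp only [zero_div, mul_zero]
      refine sum_nonpos fun y hy => ?_
      simp only [mem_filter, mem_Ico] at hy
      exact (latticeErr_one _ (htail 0) hy.1.1).le
    · calc ∑ y ∈ (Ico 1 n).filter (fun y => e 0 ∣ n - y), latticeErr (Fin.tail e) y
          ≤ ∑ y ∈ (Ico 1 n).filter (fun y => e 0 ∣ n - y), (n : ℝ) ^ (k - 1) * E := by
            refine sum_le_sum fun y hy => ?_
            simp only [mem_filter, mem_Ico] at hy
            refine (ih _ htail hy.1.1).trans ?_
            have : (y : ℝ) ≤ n := by exact_mod_cast hy.1.2.le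
            gcongr
        _ = (((Ico 1 n).filter (fun y => e 0 ∣ n - y)).card : ℝ) * ((n : ℝ) ^ (k - 1) * E) := by
            rw [sum_const, nsmul_eq_mul]
        _ ≤ (n / e 0 : ℝ) * ((n : ℝ) ^ (k - 1) * E) := by
            gcongr
            refine le_trans ?_ (card_filter_dvd_sub_le n (e 0))
            norm_cast
            apply card_le_card
            apply filter_subset_filter
            intro y
            simp only [mem_Ico, mem_range]
            omega
        _ = (n : ℝ) ^ k * (E / e 0) := by
            obtain ⟨j, rfl⟩ : ∃ j, k = j + 1 := ⟨k - 1, by omega⟩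
            simp only [Nat.add_sub_cancel]
            ring

end Lattice

/-! ### Möbius inversion and distribution of the primes over index sets. -/

section Patterns

open Finset

/-- Expanding a product of sums over the primes dividing a squarefree number into a sum over
factorisations. -/
theorem prod_primeFactors_sum {ι : Type*} [Fintype ι] [DecidableEq ι] {d : ℕ}
    (hd : Squarefree d) (f : ℕ → ι → ℝ) :
    ∏ p ∈ d.primeFactors, ∑ V, f p V =
      ∑ U ∈ (Fintype.piFinset fun _ : ι => d.divisors).filter (fun U => ∏ V, U V = d),
        ∏ V, ∏ p ∈ (U V).primeFactors, f p V := by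
  classical
  have hd0 : d ≠ 0 := hd.ne_zero
  -- A choice function `π` sends each prime of `d` to an index; `S π V` is the set of primes sent to
  -- `V`, and their product is the factor `U V`.
  set S : (d.primeFactors → ι) → ι → Finset ℕ := fun π V =>
    ((univ : Finset d.primeFactors).filter (fun p => π p = V)).map
      (Function.Embedding.subtype _) with hS
  have hSprime : ∀ π V, ∀ p ∈ S π V, p.Prime := by
    intro π V p hp
    simp only [hS, Finset.mem_map, mem_filter, mem_univ, true_and, Function.Embedding.subtype_apply] at hp
    obtain ⟨q, -, rfl⟩ := hp
    exact Nat.prime_of_mem_primeFactors q.2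
  have hmemS : ∀ π V (p : d.primeFactors), p.1 ∈ S π V ↔ π p = V := by
    intro π V p
    simp only [hS, Finset.mem_map, mem_filter, mem_univ, true_and, Function.Embedding.subtype_apply]
    constructor
    · rintro ⟨q, hq, hqp⟩
      rwa [Subtype.ext hqp] at hq
    · intro h
      exact ⟨p, h, rfl⟩
  have hSsub : ∀ π V, S π V ⊆ d.primeFactors := by
    intro π V p hp
    simp only [hS, Finset.mem_map, mem_filter, mem_univ, true_and, Function.Embedding.subtype_apply] at hp
    obtain ⟨q, -, rfl⟩ := hp
    exact q.2
  have hpf : ∀ π V, (∏ p ∈ S π V, p).primeFactors = S π V := fun π V =>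
    Nat.primeFactors_prod (hSprime π V)
  have hfib : ∀ (π : d.primeFactors → ι) {M : Type} [CommMonoid M] (g : ℕ → ι → M),
      ∏ V, ∏ p ∈ S π V, g p V = ∏ p : d.primeFactors, g p (π p) := by
    intro π M _ g
    rw [← prod_fiberwise (univ : Finset d.primeFactors) π]
    refine prod_congr rfl fun V _ => ?_
    rw [hS, prod_map]
    refine prod_congr rfl fun p hp => ?_
    rw [(mem_filter.1 hp).2]
    rfl
  have hprodd : ∀ π, ∏ V, ∏ p ∈ S π V, p = d := by
    intro π
    rw [hfib π (fun p _ => p), prod_coe_sort d.primeFactors (fun p => p),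
      Nat.prod_primeFactors_of_squarefree hd]
  rw [← prod_coe_sort d.primeFactors (fun p => ∑ V, f p V), prod_univ_sum]
  refine sum_bij (fun π _ V => ∏ p ∈ S π V, p) ?_ ?_ ?_ ?_
  · intro π _
    rw [mem_filter, Fintype.mem_piFinset]
    refine ⟨fun V => ?_, hprodd π⟩
    rw [Nat.mem_divisors]
    refine ⟨?_, hd0⟩
    conv_rhs => rw [← hprodd π]
    exact dvd_prod_of_mem (fun V => ∏ p ∈ S π V, p) (mem_univ V)
  · intro π₁ _ π₂ _ h
    funext p
    have h1 := congrFun h (π₁ p)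
    have h2 : S π₁ (π₁ p) = S π₂ (π₁ p) := by
      rw [← hpf π₁, ← hpf π₂]
      exact congrArg _ h1
    have h3 : p.1 ∈ S π₂ (π₁ p) := by
      rw [← h2]
      exact (hmemS π₁ _ p).2 rfl
    exact ((hmemS π₂ _ p).1 h3).symm
  · intro U hU
    rw [mem_filter, Fintype.mem_piFinset] at hU
    obtain ⟨hU1, hU2⟩ := hU
    have hex : ∀ p : d.primeFactors, ∃ V, p.1 ∣ U V := by
      intro p
      have hp := Nat.prime_of_mem_primeFactors p.2
      have : p.1 ∣ ∏ V, U V := by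
        rw [hU2]
        exact Nat.dvd_of_mem_primeFactors p.2
      obtain ⟨V, -, hV⟩ := hp.prime.exists_mem_finset_dvd this
      exact ⟨V, hV⟩
    choose π hπ using hex
    refine ⟨π, by simp, ?_⟩
    funext V
    have hsqV : Squarefree (U V) := hd.squarefree_of_dvd (Nat.dvd_of_mem_divisors (hU1 V))
    have : S π V = (U V).primeFactors := by
      ext p
      constructor
      · intro hp
        have hpd := hSsub π V hp
        have := (hmemS π V ⟨p, hpd⟩).1 hp
        rw [Nat.mem_primeFactors]
        refine ⟨hSprime π V p hp, ?_, hsqV.ne_zero⟩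
        rw [← this]
        exact hπ ⟨p, hpd⟩
      · intro hp
        have hpp := Nat.prime_of_mem_primeFactors hp
        have hpV := Nat.dvd_of_mem_primeFactors hp
        have hpd : p ∈ d.primeFactors := by
          rw [Nat.mem_primeFactors]
          exact ⟨hpp, hpV.trans (Nat.dvd_of_mem_divisors (hU1 V)), hd0⟩
        refine (hmemS π V ⟨p, hpd⟩).2 ?_
        by_contra hne
        have h1 := hπ ⟨p, hpd⟩
        have h2 : U (π ⟨p, hpd⟩) * U V ∣ d := by
          refine Dvd.dvd.trans ?_ hU2.dvd
          rw [← mul_prod_erase univ U (mem_univ (π ⟨p, hpd⟩))]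
          exact mul_dvd_mul_left _ (dvd_prod_of_mem U
            (mem_erase.2 ⟨fun h => hne h.symm, mem_univ _⟩))
        have h3 := (mul_dvd_mul h1 hpV).trans h2
        exact hpp.one_lt.ne' (Nat.isUnit_iff.1 (hd p h3))
    rw [this, Nat.prod_primeFactors_of_squarefree hsqV]
  · intro π _
    rw [← hfib π f]
    refine prod_congr rfl fun V _ => ?_
    rw [hpf]

variable {k : ℕ}

/-- The modulus imposed on the `i`-th part by the tuple `U`. -/
def patternModulus (U : Finset (Fin k) → ℕ) (i : Fin k) : ℕ :=
  ∏ V with i ∈ V, U V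

theorem patternModulus_pos {U : Finset (Fin k) → ℕ} (hU : ∀ V, 0 < U V) (i : Fin k) :
    0 < patternModulus U i := prod_pos fun V _ => hU V

theorem pos_of_squarefree_prod {U : Finset (Fin k) → ℕ} (hU : Squarefree (∏ V, U V))
    (V : Finset (Fin k)) : 0 < U V := by
  have := hU.ne_zero
  rw [prod_ne_zero_iff] at this
  exact Nat.pos_of_ne_zero (this V (mem_univ V))

theorem coprime_of_squarefree_prod {ι : Type*} [Fintype ι] [DecidableEq ι] {U : ι → ℕ}
    (hU : Squarefree (∏ V, U V)) {V W : ι} (h : V ≠ W) : (U V).Coprime (U W) := by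
  have h2 : U V * U W ∣ ∏ V, U V := by
    rw [← mul_prod_erase univ U (mem_univ V)]
    exact mul_dvd_mul_left _ (dvd_prod_of_mem U (mem_erase.2 ⟨h.symm, mem_univ _⟩))
  exact (Nat.squarefree_mul_iff.1 (hU.squarefree_of_dvd h2)).1

theorem squarefree_of_squarefree_prod {ι : Type*} [Fintype ι] {U : ι → ℕ}
    (hU : Squarefree (∏ V, U V)) (V : ι) : Squarefree (U V) :=
  hU.squarefree_of_dvd (dvd_prod_of_mem U (mem_univ V))

theorem patternModulus_dvd_prod (U : Finset (Fin k) → ℕ) (i : Fin k) :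
    patternModulus U i ∣ ∏ V, U V :=
  prod_dvd_prod_of_subset _ _ _ (filter_subset _ _)

/-- The `U V` are pairwise coprime, so a prime of the gcd divides a unique `U V`, and this `V` must
contain every index of `S`. -/
theorem gcd_patternModulus {U : Finset (Fin k) → ℕ} (hU : Squarefree (∏ V, U V))
    {S : Finset (Fin k)} (hS : S.Nonempty) :
    S.gcd (patternModulus U) = ∏ V with S ⊆ V, U V := by
  apply Nat.dvd_antisymm
  · obtain ⟨i₀, hi₀⟩ := hS
    have hsq : Squarefree (S.gcd (patternModulus U)) :=
      hU.squarefree_of_dvd ((gcd_dvd hi₀).trans (patternModulus_dvd_prod U i₀))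
    rw [← Nat.prod_primeFactors_of_squarefree hsq]
    apply prod_primes_dvd
    · exact fun p hp => (Nat.prime_of_mem_primeFactors hp).prime
    · intro p hp
      have hpp := Nat.prime_of_mem_primeFactors hp
      have hpd := Nat.dvd_of_mem_primeFactors hp
      have hex : ∀ i ∈ S, ∃ V, i ∈ V ∧ p ∣ U V := by
        intro i hi
        have : p ∣ patternModulus U i := hpd.trans (gcd_dvd hi)
        obtain ⟨V, hV, hpV⟩ := hpp.prime.exists_mem_finset_dvd this
        exact ⟨V, by simpa using hV, hpV⟩
      obtain ⟨V, -, hpV⟩ := hex i₀ hi₀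
      refine hpV.trans (dvd_prod_of_mem U ?_)
      simp only [mem_filter, mem_univ, true_and]
      intro i hi
      obtain ⟨W, hiW, hpW⟩ := hex i hi
      by_cases h : V = W
      · rwa [h]
      · exact absurd (Nat.dvd_gcd hpV hpW) (by
          rw [(coprime_of_squarefree_prod hU h).gcd_eq_one]
          exact fun h => hpp.one_lt.ne' (Nat.dvd_one.1 h))
  · refine Finset.dvd_gcd fun i hi => prod_dvd_prod_of_subset _ _ _ ?_
    intro V
    simp only [mem_filter, mem_univ, true_and]
    exact fun h => h hi

theorem prod_patternModulus {U : Finset (Fin k) → ℕ} (S : Finset (Fin k)) :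
    ∏ i ∈ S, patternModulus U i = ∏ V, U V ^ (V ∩ S).card := by
  unfold patternModulus
  simp_rw [prod_filter]
  rw [Finset.prod_comm]
  refine prod_congr rfl fun V _ => ?_
  rw [prod_ite, prod_const_one, mul_one, prod_const]
  congr 2
  ext i
  simp [and_comm]

theorem patternModulus_dvd_iff {U : Finset (Fin k) → ℕ} (hU : Squarefree (∏ V, U V))
    (x : Fin k → ℕ) :
    (∀ i, patternModulus U i ∣ x i) ↔ ∀ V, ∀ p ∈ (U V).primeFactors, ∀ i ∈ V, p ∣ x i := by
  constructor
  · intro h V p hp i hi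
    refine (Nat.dvd_of_mem_primeFactors hp).trans (dvd_trans ?_ (h i))
    exact dvd_prod_of_mem U (by simpa using hi)
  · intro h i
    unfold patternModulus
    apply Finset.prod_dvd_of_isRelPrime
    · intro V _ W _ hVW
      exact Nat.coprime_iff_isRelPrime.1 (coprime_of_squarefree_prod hU hVW)
    · intro V hV
      have hV' : i ∈ V := by simpa using hV
      rw [← Nat.prod_primeFactors_of_squarefree (squarefree_of_squarefree_prod hU V)]
      exact prod_primes_dvd _ (fun p hp => (Nat.prime_of_mem_primeFactors hp).prime)
        (fun p hp => h V p hp i hV')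

/-- The density at `p` of compositions of `n` with the parts in `V` divisible by `p`. -/
noncomputable def localDensity (k n : ℕ) (p : ℕ) (V : Finset (Fin k)) : ℝ :=
  if V = univ then (if p ∣ n then ((p : ℝ) ^ (k - 1))⁻¹ else 0) else ((p : ℝ) ^ V.card)⁻¹

/-- The gcd of all moduli is `U univ`. It cancels one of the `k` factors `U univ` in the
denominator, and the condition that it divides `n` splits into conditions at its primes. -/
theorem latticeMain_patternModulus (hk : 1 ≤ k) {U : Finset (Fin k) → ℕ}
    (hU : Squarefree (∏ V, U V)) (n : ℕ) :
    latticeMain (patternModulus U) n =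
      (∏ V, ∏ p ∈ (U V).primeFactors, localDensity k n p V) *
        ((n : ℝ) ^ (k - 1) / ((k - 1).factorial : ℝ)) := by
  have hne : (univ : Finset (Fin k)).Nonempty := ⟨⟨0, hk⟩, mem_univ _⟩
  have hG : univ.gcd (patternModulus U) = U univ := by
    rw [gcd_patternModulus hU hne]
    have : (univ : Finset (Finset (Fin k))).filter (fun V => univ ⊆ V) = {univ} := by
      ext V
      simp [univ_subset_iff]
    rw [this, prod_singleton]
  have hP : ∏ i, (patternModulus U i : ℝ) = ∏ V, (U V : ℝ) ^ V.card := by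
    have := prod_patternModulus (U := U) univ
    simp only [inter_univ] at this
    exact_mod_cast this
  have hprod : ∀ V (m : ℕ), ∏ p ∈ (U V).primeFactors, ((p : ℝ) ^ m)⁻¹ = ((U V : ℝ) ^ m)⁻¹ := by
    intro V m
    rw [prod_inv_distrib, prod_pow, ← Nat.cast_prod,
      Nat.prod_primeFactors_of_squarefree (squarefree_of_squarefree_prod hU V)]
  have hdiv : U univ ∣ n ↔ ∀ p ∈ (U univ).primeFactors, p ∣ n := by
    constructor
    · exact fun h p hp => (Nat.dvd_of_mem_primeFactors hp).trans h
    · intro h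
      rw [← Nat.prod_primeFactors_of_squarefree (squarefree_of_squarefree_prod hU univ)]
      exact prod_primes_dvd _ (fun p hp => (Nat.prime_of_mem_primeFactors hp).prime) h
  have hUpos : (U univ : ℝ) ≠ 0 := by
    have := pos_of_squarefree_prod hU univ
    positivity
  unfold latticeMain
  rw [hG, hP]
  have hsplit : ∀ g : Finset (Fin k) → ℝ, ∏ V, g V = g univ * ∏ V ∈ univ.erase univ, g V :=
    fun g => (mul_prod_erase univ g (mem_univ _)).symm
  have hrest : ∏ V ∈ univ.erase univ, ∏ p ∈ (U V).primeFactors, localDensity k n p V =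
      ∏ V ∈ univ.erase univ, ((U V : ℝ) ^ V.card)⁻¹ := by
    refine prod_congr rfl fun V hV => ?_
    rw [← hprod]
    refine prod_congr rfl fun p _ => ?_
    rw [localDensity, if_neg (ne_of_mem_erase hV)]
  split_ifs with h
  · congr 1
    rw [hsplit (fun V => (U V : ℝ) ^ V.card),
      hsplit (fun V => ∏ p ∈ (U V).primeFactors, localDensity k n p V), hrest]
    have : ∏ p ∈ (U univ).primeFactors, localDensity k n p univ =
        ((U univ : ℝ) ^ (k - 1))⁻¹ := by
      rw [← hprod]
      refine prod_congr rfl fun p hp => ?_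
      rw [localDensity, if_pos rfl, if_pos (hdiv.1 h p hp)]
    rw [this, prod_inv_distrib, card_univ, Fintype.card_fin]
    have h2 : (U univ : ℝ) ^ k = (U univ : ℝ) ^ (k - 1) * U univ := by
      rw [← pow_succ]
      congr 1
      omega
    rw [h2]
    field_simp
  · rw [hsplit]
    have : ∏ p ∈ (U univ).primeFactors, localDensity k n p univ = 0 := by
      rw [hdiv] at h
      push Not at h
      obtain ⟨p, hp, hpn⟩ := h
      refine prod_eq_zero hp ?_
      rw [localDensity, if_pos rfl, if_neg hpn]
    rw [this]
    ring

/-- The tuples of positive integers at most `N` that are `1` outside `𝒲`. -/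
def patternBox (𝒲 : Finset (Finset (Fin k))) (N : ℕ) : Finset (Finset (Fin k) → ℕ) :=
  Fintype.piFinset fun V => if V ∈ 𝒲 then Icc 1 N else {1}

/-- The partial singular series up to `N`. -/
noncomputable def partialSeries (lam : ℕ → ℝ) (N : ℕ) : ℝ :=
  ∑ d ∈ (Icc 1 N).filter Squarefree, ∏ p ∈ d.primeFactors, (-lam p)

/-- Inclusion–exclusion reduces the count of coprime compositions to lattice point counts. -/
theorem abs_coprimeCompositions_sub_le (hk : 1 ≤ k) (s n N : ℕ) (hn : 1 ≤ n) (hN : n ^ k ≤ N)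
    (c : ℕ → Finset (Fin k) → ℝ) (𝒲 : Finset (Finset (Fin k)))
    (hc1 : ∀ p V, |c p V| ≤ 1) (hc0 : ∀ p V, V ∉ 𝒲 → c p V = 0)
    (hc : ∀ p, p.Prime → ∀ x : Fin k → ℕ, ∑ i, x i = n →
      (∑ V, if ∀ i ∈ V, p ∣ x i then c p V else 0) =
        if p ∣ Nat.gcd (∏ i : Fin k with i.val < s, x i) (∏ i : Fin k with s ≤ i.val, x i)
          then 1 else 0) :
    |(coprimeCompositions k s n : ℝ) - partialSeries (fun p => ∑ V, c p V * localDensity k n p V) N *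
        ((n : ℝ) ^ (k - 1) / ((k - 1).factorial : ℝ))| ≤
      ∑ U ∈ (patternBox 𝒲 N).filter (fun U => Squarefree (∏ V, U V)),
        latticeErr (patternModulus U) n := by
  classical
  set X := (univ.piAntidiag n : Finset (Fin k → ℕ)).filter (fun x => ∀ i, 1 ≤ x i) with hX
  set g : (Fin k → ℕ) → ℕ := fun x =>
    Nat.gcd (∏ i : Fin k with i.val < s, x i) (∏ i : Fin k with s ≤ i.val, x i) with hg
  set w : (Finset (Fin k) → ℕ) → ℝ := fun U => ∏ V, ∏ p ∈ (U V).primeFactors, (-c p V) with hw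
  set D := (Icc 1 N).filter Squarefree with hD
  set 𝒰 : ℕ → Finset (Finset (Fin k) → ℕ) := fun d =>
    (Fintype.piFinset fun _ => d.divisors).filter (fun U => ∏ V, U V = d) with h𝒰
  have hA : (coprimeCompositions k s n : ℝ) = ∑ x ∈ X, if g x = 1 then 1 else 0 := by
    unfold coprimeCompositions
    rw [← sum_filter, sum_const, nsmul_eq_mul, mul_one, hX, filter_filter]
  have hmob : ∀ x ∈ X, (if g x = 1 then (1 : ℝ) else 0) =
      ∑ d ∈ D, ∏ p ∈ d.primeFactors, -(if p ∣ g x then (1 : ℝ) else 0) := by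
    intro x hx
    simp only [hX, mem_filter, mem_piAntidiag] at hx
    obtain ⟨⟨hxs, -⟩, hx1⟩ := hx
    have hle : ∀ i, x i ≤ n := fun i => by
      rw [← hxs]
      exact single_le_sum (f := x) (fun _ _ => Nat.zero_le _) (mem_univ i)
    have hgpos : 0 < g x := Nat.gcd_pos_of_pos_left _ (prod_pos fun i _ => hx1 i)
    -- The gcd is at most the first product, hence at most `n^k`; no divisor is lost in cutting the
    -- Möbius sum at `N`.
    have hgle : g x ≤ N := by
      refine le_trans ?_ hN
      calc g x ≤ ∏ i : Fin k with i.val < s, x i :=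
            Nat.le_of_dvd (prod_pos fun i _ => hx1 i) (Nat.gcd_dvd_left _ _)
        _ ≤ ∏ i : Fin k with i.val < s, n := prod_le_prod' fun i _ => hle i
        _ = n ^ (univ.filter (fun i : Fin k => i.val < s)).card := by rw [prod_const]
        _ ≤ n ^ k := Nat.pow_le_pow_right hn (by
            refine (card_le_univ _).trans ?_
            simp)
    have h1 : ∀ d ∈ D, ∏ p ∈ d.primeFactors, -(if p ∣ g x then (1 : ℝ) else 0) =
        if d ∣ g x then ((ArithmeticFunction.moebius d : ℤ) : ℝ) else 0 := by
      intro d hd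
      have hsq : Squarefree d := (mem_filter.1 hd).2
      split_ifs with hdg
      · rw [ArithmeticFunction.moebius_apply_of_squarefree hsq]
        rw [prod_congr rfl (g := fun _ => (-1 : ℝ)) (fun p hp => by
          rw [if_pos ((Nat.dvd_of_mem_primeFactors hp).trans hdg)]), prod_const]
        push_cast
        congr 1
        rw [← ArithmeticFunction.cardDistinctFactors_eq_cardFactors_iff_squarefree hsq.ne_zero |>.2 hsq]
        rfl
      · have : ∃ p ∈ d.primeFactors, ¬ p ∣ g x := by
          by_contra hcon
          push Not at hcon
          apply hdg
          rw [← Nat.prod_primeFactors_of_squarefree hsq]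
          exact prod_primes_dvd _ (fun p hp => (Nat.prime_of_mem_primeFactors hp).prime) hcon
        obtain ⟨p, hp, hpg⟩ := this
        exact prod_eq_zero hp (by rw [if_neg hpg, neg_zero])
    rw [sum_congr rfl h1, ← sum_filter]
    have h2 : ∑ d ∈ D.filter (fun d => d ∣ g x), ((ArithmeticFunction.moebius d : ℤ) : ℝ) =
        ∑ d ∈ (g x).divisors, ((ArithmeticFunction.moebius d : ℤ) : ℝ) := by
      refine sum_subset ?_ ?_
      · intro d hd
        rw [Nat.mem_divisors]
        exact ⟨(mem_filter.1 hd).2, hgpos.ne'⟩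
      · intro d hd hd'
        rw [Nat.mem_divisors] at hd
        have : ¬ Squarefree d := by
          intro hsq
          apply hd'
          simp only [hD, mem_filter, mem_Icc]
          exact ⟨⟨⟨Nat.pos_of_ne_zero hsq.ne_zero, (Nat.le_of_dvd hgpos hd.1).trans hgle⟩, hsq⟩, hd.1⟩
        rw [ArithmeticFunction.moebius_eq_zero_of_not_squarefree this, Int.cast_zero]
    have h3 : ∑ d ∈ (g x).divisors, ArithmeticFunction.moebius d = if g x = 1 then 1 else 0 := by
      rw [← ArithmeticFunction.coe_zeta_mul_apply, ArithmeticFunction.coe_zeta_mul_moebius,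
        ArithmeticFunction.one_apply]
    rw [h2]
    have h4 := congrArg (fun z : ℤ => (z : ℝ)) h3
    push_cast at h4
    exact h4.symm
  have hexp : ∀ x ∈ X, ∀ d ∈ D, ∏ p ∈ d.primeFactors, -(if p ∣ g x then (1 : ℝ) else 0) =
      ∑ U ∈ 𝒰 d, w U * (if ∀ i, patternModulus U i ∣ x i then 1 else 0) := by
    intro x hx d hd
    have hsq : Squarefree d := (mem_filter.1 hd).2
    simp only [hX, mem_filter, mem_piAntidiag] at hx
    obtain ⟨⟨hxs, -⟩, hx1⟩ := hx
    have h1 : ∏ p ∈ d.primeFactors, -(if p ∣ g x then (1 : ℝ) else 0) =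
        ∏ p ∈ d.primeFactors, ∑ V, -c p V * (if ∀ i ∈ V, p ∣ x i then 1 else 0) := by
      refine prod_congr rfl fun p hp => ?_
      rw [← hc p (Nat.prime_of_mem_primeFactors hp) x hxs, ← sum_neg_distrib]
      refine sum_congr rfl fun V _ => ?_
      split_ifs <;> simp
    rw [h1, prod_primeFactors_sum hsq]
    refine sum_congr rfl fun U hU => ?_
    have hUd : ∏ V, U V = d := (mem_filter.1 hU).2
    have hUsq : Squarefree (∏ V, U V) := by rwa [hUd]
    simp_rw [prod_mul_distrib]
    rw [hw]
    congr 1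
    simp only [patternModulus_dvd_iff hUsq]
    split_ifs with h
    · exact prod_eq_one fun V _ => prod_eq_one fun p hp => if_pos (h V p hp)
    · push Not at h
      obtain ⟨V, p, hp, i, hi, hpi⟩ := h
      refine prod_eq_zero (mem_univ V) (prod_eq_zero hp (if_neg ?_))
      intro h
      exact hpi (h i hi)
  have hcount : (coprimeCompositions k s n : ℝ) =
      ∑ d ∈ D, ∑ U ∈ 𝒰 d, w U * (latticeCount (patternModulus U) n : ℝ) := by
    rw [hA, sum_congr rfl hmob, sum_congr rfl (fun x hx => sum_congr rfl (hexp x hx)), sum_comm]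
    refine sum_congr rfl fun d _ => ?_
    rw [sum_comm]
    refine sum_congr rfl fun U _ => ?_
    rw [← mul_sum, ← sum_filter, sum_const, nsmul_eq_mul, mul_one, hX, filter_filter]
    unfold latticeCount
    simp only [forall_and]
  have hmain : partialSeries (fun p => ∑ V, c p V * localDensity k n p V) N *
      ((n : ℝ) ^ (k - 1) / ((k - 1).factorial : ℝ)) =
      ∑ d ∈ D, ∑ U ∈ 𝒰 d, w U * latticeMain (patternModulus U) n := by
    unfold partialSeries
    rw [sum_mul]
    refine sum_congr rfl fun d hd => ?_
    have hsq : Squarefree d := (mem_filter.1 hd).2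
    have h1 : ∏ p ∈ d.primeFactors, -(∑ V, c p V * localDensity k n p V) =
        ∏ p ∈ d.primeFactors, ∑ V, -c p V * localDensity k n p V := by
      refine prod_congr rfl fun p _ => ?_
      rw [← sum_neg_distrib]
      exact sum_congr rfl fun V _ => by ring
    rw [h1, prod_primeFactors_sum hsq, sum_mul]
    refine sum_congr rfl fun U hU => ?_
    have hUd : ∏ V, U V = d := (mem_filter.1 hU).2
    have hUsq : Squarefree (∏ V, U V) := by rwa [hUd]
    rw [latticeMain_patternModulus hk hUsq]
    simp_rw [prod_mul_distrib]
    rw [hw]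
    ring
  -- With coefficients of size at most `1`, and equal to `0` for patterns nontrivial outside `𝒲`,
  -- the total error is at most the plain sum of lattice errors.
  have hw1 : ∀ U, |w U| ≤ 1 := by
    intro U
    rw [hw]
    simp only [abs_prod, abs_neg]
    exact prod_le_one (fun _ _ => prod_nonneg fun _ _ => abs_nonneg _)
      fun V _ => prod_le_one (fun _ _ => abs_nonneg _) fun p _ => hc1 p V
  have hw0 : ∀ U, (∃ V, V ∉ 𝒲 ∧ U V ≠ 1 ∧ U V ≠ 0) → w U = 0 := by
    rintro U ⟨V, hV, h1, h0⟩
    refine prod_eq_zero (mem_univ V) ?_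
    obtain ⟨p, hp⟩ : (U V).primeFactors.Nonempty := by
      rw [Nat.nonempty_primeFactors]
      omega
    exact prod_eq_zero hp (by rw [hc0 p V hV, neg_zero])
  rw [hcount, hmain, ← sum_sub_distrib]
  simp_rw [← sum_sub_distrib, ← mul_sub]
  calc |∑ d ∈ D, ∑ U ∈ 𝒰 d, w U * ((latticeCount (patternModulus U) n : ℝ) -
          latticeMain (patternModulus U) n)|
      ≤ ∑ d ∈ D, ∑ U ∈ 𝒰 d, |w U| * latticeErr (patternModulus U) n := by
        refine (abs_sum_le_sum_abs _ _).trans (sum_le_sum fun d _ => ?_)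
        refine (abs_sum_le_sum_abs _ _).trans (sum_le_sum fun U _ => ?_)
        rw [abs_mul]
        rfl
    _ ≤ ∑ d ∈ D, ∑ U ∈ ((patternBox 𝒲 N).filter (fun U => Squarefree (∏ V, U V))).filter
          (fun U => ∏ V, U V = d), latticeErr (patternModulus U) n := by
        refine sum_le_sum fun d hd => ?_
        have hsq : Squarefree d := (mem_filter.1 hd).2
        have hdN : d ≤ N := (mem_Icc.1 (mem_filter.1 hd).1).2
        rw [← sum_filter_add_sum_filter_not (𝒰 d) (fun U => ∀ V, V ∉ 𝒲 → U V = 1)]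
        have hz : ∑ U ∈ (𝒰 d).filter (fun U => ¬ ∀ V, V ∉ 𝒲 → U V = 1),
            |w U| * latticeErr (patternModulus U) n = 0 := by
          refine sum_eq_zero fun U hU => ?_
          rw [mem_filter] at hU
          obtain ⟨hU1, hU2⟩ := hU
          push Not at hU2
          obtain ⟨V, hV, hV1⟩ := hU2
          have : Squarefree (∏ V, U V) := by rwa [(mem_filter.1 hU1).2]
          rw [hw0 U ⟨V, hV, hV1, (pos_of_squarefree_prod this V).ne'⟩, abs_zero, zero_mul]
        rw [hz, add_zero]
        refine (sum_le_sum fun U _ => mul_le_of_le_one_left (latticeErr_nonneg _ _) (hw1 U)).trans ?_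
        refine sum_le_sum_of_subset_of_nonneg ?_ fun _ _ _ => latticeErr_nonneg _ _
        intro U hU
        simp only [h𝒰, mem_filter, Fintype.mem_piFinset, Nat.mem_divisors] at hU
        obtain ⟨⟨h1, h2⟩, h3⟩ := hU
        have hUsq : Squarefree (∏ V, U V) := by rwa [h2]
        simp only [mem_filter, patternBox, Fintype.mem_piFinset]
        refine ⟨⟨fun V => ?_, hUsq⟩, h2⟩
        split_ifs with hV
        · rw [mem_Icc]
          exact ⟨pos_of_squarefree_prod hUsq V,
            (Nat.le_of_dvd (Nat.pos_of_ne_zero hsq.ne_zero) (h1 V).1).trans hdN⟩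
        · rw [mem_singleton]
          exact h3 V hV
    _ ≤ _ := by
        rw [← sum_biUnion]
        · refine sum_le_sum_of_subset_of_nonneg ?_ fun _ _ _ => latticeErr_nonneg _ _
          intro U hU
          rw [mem_biUnion] at hU
          obtain ⟨d, -, hU⟩ := hU
          exact (mem_filter.1 hU).1
        · intro d _ d' _ hne
          rw [Function.onFun, disjoint_left]
          intro U h1 h2
          exact hne ((mem_filter.1 h1).2.symm.trans (mem_filter.1 h2).2)

end Patterns

/-! ### Local densities, the singular series and its Euler product. -/

section SingularSeries

open Finset

/-- From all subsets of `Z` remove those inside `A` and those disjoint from `A`; the empty set has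
then been removed twice. The four binomial sums factor. -/
theorem sum_powerset_pow_card {α : Type*} [DecidableEq α] (Z A : Finset α) (y : ℝ) :
    ∑ V ∈ Z.powerset, (if (V ∩ A).Nonempty ∧ (V \ A).Nonempty then y ^ V.card else 0) =
      ((1 + y) ^ (Z ∩ A).card - 1) * ((1 + y) ^ (Z \ A).card - 1) := by
  have hall : ∀ W : Finset α, ∑ V ∈ W.powerset, y ^ V.card = (1 + y) ^ W.card := by
    intro W
    have := sum_pow_mul_eq_add_pow y 1 W
    simpa [add_comm] using this
  have hind : ∀ V : Finset α, (if (V ∩ A).Nonempty ∧ (V \ A).Nonempty then y ^ V.card else 0) =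
      y ^ V.card - (if V ⊆ A then y ^ V.card else 0) - (if Disjoint V A then y ^ V.card else 0) +
        (if V = ∅ then 1 else 0) := by
    intro V
    have h1 : (V \ A).Nonempty ↔ ¬ V ⊆ A := by
      rw [nonempty_iff_ne_empty, ne_eq, sdiff_eq_empty_iff_subset]
    have h2 : (V ∩ A).Nonempty ↔ ¬ Disjoint V A := by
      rw [not_disjoint_iff_nonempty_inter]
    have h3 : V = ∅ ↔ V ⊆ A ∧ Disjoint V A := by
      constructor
      · rintro rfl
        simp
      · rintro ⟨h, h'⟩
        exact disjoint_self.1 (h'.mono_right h)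
    simp only [h1, h2]
    by_cases ha : V ⊆ A <;> by_cases hb : Disjoint V A
    · have : V = ∅ := h3.2 ⟨ha, hb⟩
      subst this
      simp
    · have : V ≠ ∅ := fun h => hb (h3.1 h).2
      simp [ha, hb, this]
    · have : V ≠ ∅ := fun h => ha (h3.1 h).1
      simp [ha, hb, this]
    · have : V ≠ ∅ := fun h => ha (h3.1 h).1
      simp [ha, hb, this]
  simp_rw [hind]
  rw [sum_add_distrib, sum_sub_distrib, sum_sub_distrib, hall, ← sum_filter, ← sum_filter]
  have e1 : Z.powerset.filter (fun V => V ⊆ A) = (Z ∩ A).powerset := by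
    ext V
    rw [mem_filter, mem_powerset, mem_powerset, subset_inter_iff]
  have e2 : Z.powerset.filter (fun V => Disjoint V A) = (Z \ A).powerset := by
    ext V
    simp [subset_sdiff]
  have e3 : ∑ V ∈ Z.powerset, (if V = ∅ then (1 : ℝ) else 0) = 1 := by
    rw [sum_ite_eq' Z.powerset ∅ (fun _ => (1 : ℝ)), if_pos (empty_mem_powerset Z)]
  rw [e1, e2, hall, hall, e3]
  have : Z.card = (Z ∩ A).card + (Z \ A).card := (card_inter_add_card_sdiff Z A).symm
  rw [this, pow_add]
  ring

/-- The indices of the first `s` parts. -/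
def firstParts (k s : ℕ) : Finset (Fin k) := univ.filter fun i => i.val < s

theorem card_firstParts {k s : ℕ} (h : s ≤ k) : (firstParts k s).card = s := by
  unfold firstParts
  rw [Fin.card_filter_val_lt]
  exact min_eq_right h

theorem card_compl_firstParts {k s : ℕ} (h : s ≤ k) :
    ((univ : Finset (Fin k)) \ firstParts k s).card = k - s := by
  rw [card_sdiff_of_subset (subset_univ _), card_firstParts h, card_univ, Fintype.card_fin]

/-- The index sets meeting both the first `s` and the remaining parts. -/
def crossingSets (k s : ℕ) : Finset (Finset (Fin k)) :=
  univ.filter fun V => (V ∩ firstParts k s).Nonempty ∧ (V \ firstParts k s).Nonempty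

theorem mem_crossingSets {k s : ℕ} {V : Finset (Fin k)} :
    V ∈ crossingSets k s ↔ (V ∩ firstParts k s).Nonempty ∧ (V \ firstParts k s).Nonempty := by
  simp [crossingSets]

theorem two_le_card_of_mem_crossingSets {k s : ℕ} {V : Finset (Fin k)}
    (hV : V ∈ crossingSets k s) : 2 ≤ V.card := by
  obtain ⟨h1, h2⟩ := mem_crossingSets.1 hV
  rw [← card_inter_add_card_sdiff V (firstParts k s)]
  have := h1.card_pos
  have := h2.card_pos
  omega

/-- The inclusion–exclusion coefficient of an index set. -/
noncomputable def crossingCoeff (k s : ℕ) (V : Finset (Fin k)) : ℝ :=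
  if V ∈ crossingSets k s then (-1) ^ V.card else 0

theorem abs_crossingCoeff_le (k s : ℕ) (V : Finset (Fin k)) : |crossingCoeff k s V| ≤ 1 := by
  unfold crossingCoeff
  split_ifs <;> simp

theorem prime_dvd_gcd_iff {k s p : ℕ} (hp : p.Prime) (x : Fin k → ℕ) :
    p ∣ Nat.gcd (∏ i : Fin k with i.val < s, x i) (∏ i : Fin k with s ≤ i.val, x i) ↔
      (∃ i ∈ firstParts k s, p ∣ x i) ∧ ∃ i ∉ firstParts k s, p ∣ x i := by
  rw [Nat.dvd_gcd_iff, Prime.dvd_finsetProd_iff hp.prime, Prime.dvd_finsetProd_iff hp.prime]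
  simp [firstParts]

/-- This is `sum_powerset_pow_card` at `y = -1`, with `Z` the indices of parts divisible by `p`:
each factor `0^m - 1` vanishes precisely when `m = 0`. -/
theorem sum_crossingCoeff {k s p : ℕ} (hp : p.Prime) (x : Fin k → ℕ) :
    (∑ V, if ∀ i ∈ V, p ∣ x i then crossingCoeff k s V else 0) =
      if p ∣ Nat.gcd (∏ i : Fin k with i.val < s, x i) (∏ i : Fin k with s ≤ i.val, x i)
        then 1 else 0 := by
  classical
  set Z := (univ : Finset (Fin k)).filter (fun i => p ∣ x i) with hZ
  have h1 : (univ : Finset (Finset (Fin k))).filter (fun V => ∀ i ∈ V, p ∣ x i) = Z.powerset := by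
    ext V
    simp [hZ, subset_iff]
  rw [← sum_filter, h1]
  have h2 := sum_powerset_pow_card Z (firstParts k s) (-1)
  simp only [← mem_crossingSets] at h2
  unfold crossingCoeff
  rw [h2]
  simp only [prime_dvd_gcd_iff hp, add_neg_cancel]
  have e1 : (∃ i ∈ firstParts k s, p ∣ x i) ↔ (Z ∩ firstParts k s).card ≠ 0 := by
    rw [card_ne_zero]
    simp [Finset.Nonempty, hZ, and_comm]
  have e2 : (∃ i ∉ firstParts k s, p ∣ x i) ↔ (Z \ firstParts k s).card ≠ 0 := by
    rw [card_ne_zero]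
    simp [Finset.Nonempty, hZ, and_comm]
  simp only [e1, e2]
  by_cases ha : (Z ∩ firstParts k s).card = 0 <;> by_cases hb : (Z \ firstParts k s).card = 0 <;>
    simp [ha, hb]

/-- The proportion of compositions of `n` modulo `p` violating coprimality at `p`. -/
noncomputable def localDefect (k s n p : ℕ) : ℝ :=
  polyF k s p / (p : ℝ) ^ (k - 1) + if p ∣ n then (-1) ^ k / (p : ℝ) ^ (k - 1) else 0

/-- The product is the crossing-set sum at `y = -1/x`; the last term removes the contribution that
the full index set would make if its density were `x^(-k)`. -/
theorem polyF_div_pow {k s : ℕ} (hs : 1 ≤ s) (hsk : s ≤ k - 1) {x : ℝ} (hx : x ≠ 0) :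
    polyF k s x / x ^ (k - 1) =
      ((1 + -1 / x) ^ s - 1) * ((1 + -1 / x) ^ (k - s) - 1) + (-1) ^ (k - 1) / x ^ k := by
  obtain ⟨r, rfl⟩ : ∃ r, k = s + r := ⟨k - s, by omega⟩
  have e : (1 + -1 / x : ℝ) = (x - 1) / x := by field_simp; ring
  have h1 : x ^ (s + r) = x ^ (s + r - 1) * x := by
    rw [← pow_succ]
    congr 1
    omega
  have h2 : x ^ (s + r) = x ^ s * x ^ r := pow_add _ _ _
  rw [e, div_pow, div_pow]
  simp only [Nat.add_sub_cancel_left]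
  unfold polyF
  rw [one_div, inv_mul_eq_div, div_div, mul_comm x, ← h1]
  simp only [Nat.add_sub_cancel_left]
  rw [h2, pow_add (x - 1)]
  have hs0 : x ^ s ≠ 0 := pow_ne_zero _ hx
  have hr0 : x ^ r ≠ 0 := pow_ne_zero _ hx
  field_simp
  ring

theorem sum_crossingCoeff_mul_localDensity {k s : ℕ} (hs : 1 ≤ s) (hsk : s ≤ k - 1) (n : ℕ)
    {p : ℕ} (hp : p.Prime) :
    ∑ V, crossingCoeff k s V * localDensity k n p V = localDefect k s n p := by
  classical
  have hp0 : (p : ℝ) ≠ 0 := by exact_mod_cast hp.ne_zero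
  have huniv : (univ : Finset (Fin k)) ∈ crossingSets k s := by
    rw [mem_crossingSets, univ_inter, ← card_pos, ← card_pos, card_firstParts (by omega),
      card_compl_firstParts (by omega)]
    omega
  have hcu : crossingCoeff k s univ = (-1) ^ k := by
    unfold crossingCoeff
    rw [if_pos huniv, card_univ, Fintype.card_fin]
  -- Only `V = univ` departs from density `p^(-|V|)`, since `p` dividing all parts forces `p ∣ n`;
  -- the second summand is the correction.
  have h1 : ∀ V, crossingCoeff k s V * localDensity k n p V =
      (if V ∈ crossingSets k s then (-1 / (p : ℝ)) ^ V.card else 0) +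
        (if V = univ then (-1) ^ k * ((if p ∣ n then ((p : ℝ) ^ (k - 1))⁻¹ else 0) -
          ((p : ℝ) ^ k)⁻¹) else 0) := by
    intro V
    by_cases hV : V = univ
    · subst hV
      rw [hcu, if_pos huniv, if_pos rfl, localDensity, if_pos rfl, card_univ, Fintype.card_fin,
        div_pow]
      ring
    · rw [if_neg hV, add_zero, localDensity, if_neg hV, crossingCoeff]
      split_ifs
      · rw [div_pow]
        rfl
      · ring
  simp_rw [h1]
  rw [sum_add_distrib, sum_ite_eq' univ univ, if_pos (mem_univ _)]
  have h2 := sum_powerset_pow_card univ (firstParts k s) (-1 / (p : ℝ))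
  simp only [← mem_crossingSets, powerset_univ, univ_inter] at h2
  rw [h2, card_firstParts (by omega), card_compl_firstParts (by omega)]
  unfold localDefect
  rw [polyF_div_pow hs hsk hp0]
  have h3 : ((-1 : ℝ)) ^ k = -(-1) ^ (k - 1) := by
    obtain ⟨j, rfl⟩ : ∃ j, k = j + 1 := ⟨k - 1, by omega⟩
    rw [Nat.add_sub_cancel, pow_succ]
    ring
  rw [h3]
  split_ifs <;> ring

/-- Crossing sets have at least two elements, and for the full set `k - 1 ≥ 2`. There are `2^k`
index sets; the larger constant is harmless. -/
theorem abs_localDefect_le {k s : ℕ} (hk : 3 ≤ k) (hs : 1 ≤ s) (hsk : s ≤ k - 1) (n : ℕ)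
    {p : ℕ} (hp : p.Prime) : |localDefect k s n p| ≤ 2 ^ 2 ^ k * ((p : ℝ) ^ 2)⁻¹ := by
  rw [← sum_crossingCoeff_mul_localDensity hs hsk n hp]
  have hp1 : (1 : ℝ) ≤ p := by exact_mod_cast hp.one_lt.le
  have hterm : ∀ V, |crossingCoeff k s V * localDensity k n p V| ≤ ((p : ℝ) ^ 2)⁻¹ := by
    intro V
    rw [abs_mul]
    by_cases hV : V ∈ crossingSets k s
    · refine (mul_le_of_le_one_left (abs_nonneg _) (abs_crossingCoeff_le k s V)).trans ?_
      unfold localDensity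
      split_ifs
      · rw [abs_of_nonneg (by positivity)]
        gcongr
        omega
      · rw [abs_zero]
        positivity
      · rw [abs_of_nonneg (by positivity)]
        gcongr
        exact two_le_card_of_mem_crossingSets hV
    · rw [crossingCoeff, if_neg hV, abs_zero, zero_mul]
      positivity
  refine (abs_sum_le_sum_abs _ _).trans ((sum_le_sum fun V _ => hterm V).trans ?_)
  rw [sum_const, nsmul_eq_mul, card_univ, Fintype.card_finset, Fintype.card_fin]
  gcongr
  exact_mod_cast Nat.lt_two_pow_self.le

/-- `K ^ ω(d)` is at most a constant times `√d`. -/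
theorem pow_card_primeFactors_le {K : ℕ} (hK : 1 ≤ K) {d : ℕ} (hd : d ≠ 0) :
    (K : ℝ) ^ d.primeFactors.card ≤ (K : ℝ) ^ K ^ 2 * (d : ℝ) ^ (1 / 2 : ℝ) := by
  have hK' : (1 : ℝ) ≤ K := by exact_mod_cast hK
  -- A prime `p ≥ K^2` has `K ≤ √p`; at most `K^2` smaller primes contribute a factor `K` each.
  have h1 : (K : ℝ) ^ d.primeFactors.card ≤
      ∏ p ∈ d.primeFactors, (if p < K ^ 2 then (K : ℝ) else 1) * (p : ℝ) ^ (1 / 2 : ℝ) := by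
    rw [← prod_const]
    refine prod_le_prod (fun _ _ => by positivity) fun p hp => ?_
    have hp1 : (1 : ℝ) ≤ p := by exact_mod_cast (Nat.prime_of_mem_primeFactors hp).one_lt.le
    split_ifs with h
    · exact le_mul_of_one_le_right (by positivity) (Real.one_le_rpow hp1 (by norm_num))
    · rw [one_mul, ← Real.sqrt_eq_rpow]
      apply Real.le_sqrt_of_sq_le
      push Not at h
      exact_mod_cast h
  refine h1.trans ?_
  rw [prod_mul_distrib]
  gcongr
  · rw [← prod_filter, prod_const]
    apply pow_le_pow_right₀ hK'
    calc _ ≤ (range (K ^ 2)).card := by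
          apply card_le_card
          intro p hp
          rw [mem_range]
          exact (mem_filter.1 hp).2
      _ = _ := card_range _
  · rw [Real.finsetProd_rpow _ _ (fun _ _ => by positivity)]
    apply Real.rpow_le_rpow (by positivity) _ (by norm_num)
    rw [← Nat.cast_prod]
    exact_mod_cast Nat.le_of_dvd (Nat.pos_of_ne_zero hd) (Nat.prod_primeFactors_dvd d)

/-- The terms of the singular series. -/
noncomputable def seriesTerm (k s n d : ℕ) : ℝ :=
  if Squarefree d then ∏ p ∈ d.primeFactors, (-localDefect k s n p) else 0

/-- The local bounds give `K^ω(d) / d^2`, and `K^ω(d)` costs at most a constant times `√d`. The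
constant is uniform in `n`. -/
theorem abs_seriesTerm_le {k s : ℕ} (hk : 3 ≤ k) (hs : 1 ≤ s) (hsk : s ≤ k - 1) :
    ∃ C : ℝ, 0 ≤ C ∧ ∀ n d : ℕ, |seriesTerm k s n d| ≤ C * (d : ℝ) ^ (-(3 / 2) : ℝ) := by
  refine ⟨((2 ^ 2 ^ k : ℕ) : ℝ) ^ (2 ^ 2 ^ k) ^ 2, by positivity, fun n d => ?_⟩
  unfold seriesTerm
  split_ifs with hd
  · have hd0 := hd.ne_zero
    have hdpos : (0 : ℝ) < d := by exact_mod_cast Nat.pos_of_ne_zero hd0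
    rw [abs_prod]
    calc ∏ p ∈ d.primeFactors, |-localDefect k s n p|
        ≤ ∏ p ∈ d.primeFactors, (((2 ^ 2 ^ k : ℕ) : ℝ) * ((p : ℝ) ^ 2)⁻¹) := by
          refine prod_le_prod (fun _ _ => abs_nonneg _) fun p hp => ?_
          rw [abs_neg]
          push_cast
          exact abs_localDefect_le hk hs hsk n (Nat.prime_of_mem_primeFactors hp)
      _ = ((2 ^ 2 ^ k : ℕ) : ℝ) ^ d.primeFactors.card * ((d : ℝ) ^ 2)⁻¹ := by
          rw [prod_mul_distrib, prod_const, prod_inv_distrib, prod_pow, ← Nat.cast_prod,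
            Nat.prod_primeFactors_of_squarefree hd]
      _ ≤ (((2 ^ 2 ^ k : ℕ) : ℝ) ^ (2 ^ 2 ^ k) ^ 2 * (d : ℝ) ^ (1 / 2 : ℝ)) * ((d : ℝ) ^ 2)⁻¹ := by
          gcongr
          exact pow_card_primeFactors_le Nat.one_le_two_pow hd0
      _ = _ := by
          rw [mul_assoc, ← Real.rpow_natCast (d : ℝ) 2, ← Real.rpow_neg hdpos.le,
            ← Real.rpow_add hdpos]
          norm_num
  · rw [abs_zero]
    positivity

theorem summable_abs_seriesTerm {k s : ℕ} (hk : 3 ≤ k) (hs : 1 ≤ s) (hsk : s ≤ k - 1) (n : ℕ) :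
    Summable fun d => |seriesTerm k s n d| := by
  obtain ⟨C, -, hC⟩ := abs_seriesTerm_le hk hs hsk
  refine Summable.of_nonneg_of_le (fun _ => abs_nonneg _) (hC n) ?_
  exact (Real.summable_nat_rpow.2 (by norm_num)).mul_left C

theorem hasProd_one_sub_localDefect {k s : ℕ} (hk : 3 ≤ k) (hs : 1 ≤ s) (hsk : s ≤ k - 1)
    (n : ℕ) :
    HasProd (fun p : Nat.Primes => 1 - localDefect k s n p) (∑' d, seriesTerm k s n d) := by
  have h := EulerProduct.eulerProduct_hasProd (f := seriesTerm k s n) (by simp [seriesTerm])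
    (fun {a b} hab => by
      unfold seriesTerm
      simp only [Nat.squarefree_mul hab]
      by_cases ha : Squarefree a <;> by_cases hb : Squarefree b <;> simp only [ha, hb, and_self,
        if_true, if_false, and_false, false_and, mul_zero, zero_mul]
      rw [hab.primeFactors_mul, prod_union hab.disjoint_primeFactors])
    (summable_abs_seriesTerm hk hs hsk n) (by simp [seriesTerm])
  have hterm : ∀ p : Nat.Primes,
      ∑' e : ℕ, seriesTerm k s n ((p : ℕ) ^ e) = 1 - localDefect k s n p := by
    intro p
    rw [tsum_eq_sum (s := range 2)]
    · rw [sum_range_succ, sum_range_one, pow_zero, pow_one]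
      have hp := p.2
      simp [seriesTerm, hp.prime.squarefree, hp.primeFactors]
      ring
    · intro e he
      rw [mem_range] at he
      unfold seriesTerm
      rw [if_neg]
      intro hsq
      have := hsq p (by
        rw [← sq]
        exact pow_dvd_pow _ (by omega))
      exact p.2.one_lt.ne' (Nat.isUnit_iff.1 this)
  simpa only [hterm] using h

theorem localDefect_one {k s : ℕ} (p : Nat.Primes) :
    1 - localDefect k s 1 p = eulerFactor k s p := by
  unfold localDefect eulerFactor
  rw [if_neg (fun h => p.2.one_lt.ne' (Nat.dvd_one.1 h)), add_zero]

/-- No prime divides `1`, so this is the Euler product of the singular series at `n = 1`. -/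
theorem hasProd_eulerFactor {k s : ℕ} (hk : 3 ≤ k) (hs : 1 ≤ s) (hsk : s ≤ k - 1) :
    HasProd (eulerFactor k s) (constC k s) := by
  have h := hasProd_one_sub_localDefect hk hs hsk 1
  simp only [localDefect_one] at h
  exact h.multipliable.hasProd

/-- After multiplication by `p`, with `r = k - s`, the expression is `p^s (p-1)^r + p^r (p-1)^s -
(p-1)^k - (-1)^(k-1)`. The first term dominates the third, and the second is at least `2`. -/
theorem pow_sub_polyF_pos {k s p : ℕ} (hs : 1 ≤ s) (hsk : s ≤ k - 1) (hp : p.Prime) :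
    0 < (p : ℝ) ^ (k - 1) - polyF k s p := by
  obtain ⟨r, rfl⟩ : ∃ r, k = s + r := ⟨k - s, by omega⟩
  have hr : 1 ≤ r := by omega
  have hp2 : (2 : ℝ) ≤ p := by exact_mod_cast hp.two_le
  have hp0 : (0 : ℝ) < p := by linarith
  have e : (p : ℝ) * ((p : ℝ) ^ (s + r - 1) - polyF (s + r) s p) =
      (p : ℝ) ^ s * ((p : ℝ) - 1) ^ r + (p : ℝ) ^ r * ((p : ℝ) - 1) ^ s -
        ((p : ℝ) - 1) ^ s * ((p : ℝ) - 1) ^ r - (-1) ^ (s + r - 1) := by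
    have h1 : (p : ℝ) * (p : ℝ) ^ (s + r - 1) = (p : ℝ) ^ s * (p : ℝ) ^ r := by
      rw [← pow_succ', ← pow_add]
      congr 1
      omega
    unfold polyF
    simp only [Nat.add_sub_cancel_left]
    rw [mul_sub, h1, ← mul_assoc, mul_one_div_cancel hp0.ne', pow_add, pow_add]
    ring
  have h1 : ((p : ℝ) - 1) ^ s ≤ (p : ℝ) ^ s := pow_le_pow_left₀ (by linarith) (by linarith) _
  have h2 : (2 : ℝ) ≤ (p : ℝ) ^ r := hp2.trans (le_self_pow₀ (by linarith) (by omega))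
  have h3 : (1 : ℝ) ≤ ((p : ℝ) - 1) ^ s := one_le_pow₀ (by linarith)
  have h4 : (0 : ℝ) ≤ ((p : ℝ) - 1) ^ r := pow_nonneg (by linarith) _
  have h5 : ((-1 : ℝ)) ^ (s + r - 1) ≤ 1 := by
    rcases neg_one_pow_eq_or ℝ (s + r - 1) with h | h <;> rw [h]
    norm_num
  have : 0 < (p : ℝ) * ((p : ℝ) ^ (s + r - 1) - polyF (s + r) s p) := by
    rw [e]
    nlinarith [mul_le_mul_of_nonneg_right h1 h4]
  exact pos_of_mul_pos_right this hp0.le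

theorem tsum_seriesTerm {k s : ℕ} (hk : 3 ≤ k) (hs : 1 ≤ s) (hsk : s ≤ k - 1) {n : ℕ}
    (hn : n ≠ 0) : ∑' d, seriesTerm k s n d = constC k s * arithF k s n := by
  set h : ℕ → ℝ := fun p => 1 + (-1) ^ (k - 1) / ((p : ℝ) ^ (k - 1) - polyF k s p) with hh
  set S : Finset Nat.Primes := n.primeFactors.subtype Nat.Prime with hS
  have h1 : HasProd (fun p : Nat.Primes => if (p : ℕ) ∣ n then h p else 1) (arithF k s n) := by
    have h2 : HasProd (fun p : Nat.Primes => if (p : ℕ) ∣ n then h p else 1)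
        (∏ p ∈ S, if (p : ℕ) ∣ n then h p else 1) :=
      hasProd_prod_of_ne_finset_one (fun p hp => by
        rw [if_neg]
        intro hpn
        apply hp
        exact mem_subtype.2 (Nat.mem_primeFactors.2 ⟨p.2, hpn, hn⟩))
    convert h2 using 1
    unfold arithF
    rw [prod_congr rfl (g := fun p : Nat.Primes => h p) (fun p hp => by
      rw [if_pos (Nat.dvd_of_mem_primeFactors (mem_subtype.1 hp))])]
    exact (prod_subtype_of_mem h (fun p hp => Nat.prime_of_mem_primeFactors hp)).symm
  have h3 := (hasProd_eulerFactor hk hs hsk).mul h1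
  refine (hasProd_one_sub_localDefect hk hs hsk n).unique ?_
  convert h3 using 2 with p
  have hpos := pow_sub_polyF_pos hs hsk p.2
  have hp0 : ((p : ℕ) : ℝ) ≠ 0 := by exact_mod_cast p.2.ne_zero
  have hpk : ((p : ℕ) : ℝ) ^ (k - 1) ≠ 0 := pow_ne_zero _ hp0
  unfold localDefect eulerFactor
  split_ifs
  · rw [hh]
    have h3 : ((-1 : ℝ)) ^ k = -(-1) ^ (k - 1) := by
      obtain ⟨j, rfl⟩ : ∃ j, k = j + 1 := ⟨k - 1, by omega⟩
      rw [Nat.add_sub_cancel, pow_succ]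
      ring
    rw [h3]
    simp only
    field_simp
    ring
  · ring

theorem partialSeries_eq (k s n N : ℕ) :
    partialSeries (localDefect k s n) N = ∑ d ∈ range (N + 1), seriesTerm k s n d := by
  unfold partialSeries seriesTerm
  rw [← sum_filter]
  refine sum_congr ?_ fun _ _ => rfl
  ext d
  simp only [mem_filter, mem_Icc, mem_range]
  constructor
  · rintro ⟨h1, h2⟩
    exact ⟨by omega, h2⟩
  · rintro ⟨h1, h2⟩
    have := h2.ne_zero
    exact ⟨by omega, h2⟩

theorem abs_sum_range_sub_tsum_le {f : ℕ → ℝ} {C : ℝ} (hC0 : 0 ≤ C)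
    (hC : ∀ d : ℕ, |f d| ≤ C * (d : ℝ) ^ (-(3 / 2) : ℝ)) {N : ℕ} (hN : 1 ≤ N) :
    |∑ d ∈ range (N + 1), f d - ∑' d, f d| ≤
      C * (∑' d : ℕ, (d : ℝ) ^ (-(5 / 4) : ℝ)) * (N : ℝ) ^ (-(1 / 4) : ℝ) := by
  have hsum : Summable fun d : ℕ => (d : ℝ) ^ (-(5 / 4) : ℝ) :=
    Real.summable_nat_rpow.2 (by norm_num)
  have hs1 : Summable fun d => |f d| := Summable.of_nonneg_of_le (fun _ => abs_nonneg _) hC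
    ((Real.summable_nat_rpow.2 (by norm_num)).mul_left C)
  have hs2 : Summable f := hs1.of_abs
  rw [← hs2.sum_add_tsum_nat_add (N + 1), sub_add_cancel_left, abs_neg]
  have hs3 : Summable fun d => |f (d + (N + 1))| :=
    (summable_nat_add_iff (f := fun d => |f d|) (N + 1)).2 hs1
  have hNpos : (0 : ℝ) < N := by exact_mod_cast hN
  have hs4 : Summable fun d : ℕ => ((d + (N + 1) : ℕ) : ℝ) ^ (-(5 / 4) : ℝ) :=
    (summable_nat_add_iff (f := fun d : ℕ => (d : ℝ) ^ (-(5 / 4) : ℝ)) (N + 1)).2 hsum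
  have hterm : ∀ d, |f (d + (N + 1))| ≤
      C * (N : ℝ) ^ (-(1 / 4) : ℝ) * ((d + (N + 1) : ℕ) : ℝ) ^ (-(5 / 4) : ℝ) := by
    intro d
    refine (hC _).trans ?_
    have hd : (0 : ℝ) < ((d + (N + 1) : ℕ) : ℝ) := by positivity
    have hle : (N : ℝ) ≤ ((d + (N + 1) : ℕ) : ℝ) := by
      have : N ≤ d + (N + 1) := by omega
      exact_mod_cast this
    -- The exponent `-1/4` yields the decay in `N`, and `-5/4` keeps the series convergent.
    rw [show (-(3 / 2) : ℝ) = -(1 / 4) + -(5 / 4) by norm_num, Real.rpow_add hd, ← mul_assoc]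
    exact mul_le_mul_of_nonneg_right (mul_le_mul_of_nonneg_left
      (Real.rpow_le_rpow_of_nonpos hNpos hle (by norm_num)) hC0) (Real.rpow_nonneg hd.le _)
  have htail : ∑' d : ℕ, ((d + (N + 1) : ℕ) : ℝ) ^ (-(5 / 4) : ℝ) ≤
      ∑' d : ℕ, (d : ℝ) ^ (-(5 / 4) : ℝ) := by
    rw [← hsum.sum_add_tsum_nat_add (N + 1)]
    have : 0 ≤ ∑ d ∈ range (N + 1), (d : ℝ) ^ (-(5 / 4) : ℝ) :=
      sum_nonneg fun _ _ => Real.rpow_nonneg (Nat.cast_nonneg _) _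
    linarith
  have h1 : |∑' d, f (d + (N + 1))| ≤ ∑' d, |f (d + (N + 1))| := by
    have := norm_tsum_le_tsum_norm (f := fun d => f (d + (N + 1)))
      (by simpa only [Real.norm_eq_abs] using hs3)
    simpa only [Real.norm_eq_abs] using this
  refine h1.trans ((hs3.tsum_le_tsum hterm (hs4.mul_left _)).trans ?_)
  rw [tsum_mul_left, mul_right_comm C]
  exact mul_le_mul_of_nonneg_right (mul_le_mul_of_nonneg_left htail hC0)
    (Real.rpow_nonneg hNpos.le _) |> fun h => by
      calc _ = C * (∑' d : ℕ, ((d + (N + 1) : ℕ) : ℝ) ^ (-(5 / 4) : ℝ)) *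
            (N : ℝ) ^ (-(1 / 4) : ℝ) := by ring
        _ ≤ _ := h
        _ = _ := by ring

theorem abs_partialSeries_sub_le {k s : ℕ} (hk : 3 ≤ k) (hs : 1 ≤ s) (hsk : s ≤ k - 1) :
    ∃ C : ℝ, 0 ≤ C ∧ ∀ n N : ℕ, n ≠ 0 → 1 ≤ N →
      |partialSeries (localDefect k s n) N - constC k s * arithF k s n| ≤
        C * (N : ℝ) ^ (-(1 / 4) : ℝ) := by
  obtain ⟨C, hC0, hC⟩ := abs_seriesTerm_le hk hs hsk
  refine ⟨C * ∑' d : ℕ, (d : ℝ) ^ (-(5 / 4) : ℝ), mul_nonneg hC0 (tsum_nonneg fun d =>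
    Real.rpow_nonneg (Nat.cast_nonneg d) _), fun n N hn hN => ?_⟩
  rw [partialSeries_eq, ← tsum_seriesTerm hk hs hsk hn]
  exact abs_sum_range_sub_tsum_le hC0 (hC n) hN

/-- The error term is controlled by lattice point errors. -/
theorem abs_errorTerm_le {k s : ℕ} (hk : 3 ≤ k) (hs : 1 ≤ s) (hsk : s ≤ k - 1) :
    ∃ C : ℝ, 0 ≤ C ∧ ∀ n : ℕ, 1 ≤ n →
      ∀ (c : ℕ → Finset (Fin k) → ℝ) (𝒲 : Finset (Finset (Fin k))),
      (∀ p V, |c p V| ≤ 1) → (∀ p V, V ∉ 𝒲 → c p V = 0) →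
      (∀ p, p.Prime → ∀ x : Fin k → ℕ, ∑ i, x i = n →
        (∑ V, if ∀ i ∈ V, p ∣ x i then c p V else 0) =
          if p ∣ Nat.gcd (∏ i : Fin k with i.val < s, x i) (∏ i : Fin k with s ≤ i.val, x i)
            then 1 else 0) →
      (∀ p, p.Prime → ∑ V, c p V * localDensity k n p V = localDefect k s n p) →
      |errorTerm k s n| ≤
        ∑ U ∈ (patternBox 𝒲 (n ^ (4 * k))).filter (fun U => Squarefree (∏ V, U V)),
          latticeErr (patternModulus U) n + C := by
  obtain ⟨C, hC0, hC⟩ := abs_partialSeries_sub_le hk hs hsk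
  refine ⟨C, hC0, fun n hn c 𝒲 hc1 hc0 hc hlam => ?_⟩
  -- The tail `N^(-1/4) = n^(-k)` absorbs the factor `n^(k-1)`, while `log N` remains of order `log
  -- n`.
  set N := n ^ (4 * k) with hN
  have hN1 : 1 ≤ N := Nat.one_le_pow _ _ hn
  have hnr : (1 : ℝ) ≤ n := by exact_mod_cast hn
  have h1 := abs_coprimeCompositions_sub_le (by omega : 1 ≤ k) s n N hn
    (Nat.pow_le_pow_right hn (by omega)) c 𝒲 hc1 hc0 hc
  have h2 : partialSeries (fun p => ∑ V, c p V * localDensity k n p V) N =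
      partialSeries (localDefect k s n) N := by
    unfold partialSeries
    refine sum_congr rfl fun d _ => prod_congr rfl fun p hp => ?_
    simp only [hlam p (Nat.prime_of_mem_primeFactors hp)]
  rw [h2] at h1
  have h3 := hC n N (by omega) hN1
  have h4 : (N : ℝ) ^ (-(1 / 4) : ℝ) = ((n : ℝ) ^ k)⁻¹ := by
    rw [hN, Nat.cast_pow, ← Real.rpow_natCast, ← Real.rpow_mul (by linarith),
      ← Real.rpow_natCast, ← Real.rpow_neg (by linarith)]
    congr 1
    push_cast
    ring
  set M : ℝ := (n : ℝ) ^ (k - 1) / ((k - 1).factorial : ℝ) with hM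
  have hM0 : 0 ≤ M := by positivity
  have hMle : M ≤ (n : ℝ) ^ k := by
    refine (div_le_self (by positivity) ?_).trans (pow_le_pow_right₀ hnr (by omega))
    exact_mod_cast Nat.one_le_iff_ne_zero.2 (Nat.factorial_ne_zero _)
  have e : errorTerm k s n = ((coprimeCompositions k s n : ℝ) -
      partialSeries (localDefect k s n) N * M) +
      (partialSeries (localDefect k s n) N - constC k s * arithF k s n) * M := by
    unfold errorTerm
    ring
  rw [e]
  refine (abs_add_le _ _).trans (add_le_add h1 ?_)
  rw [abs_mul, abs_of_nonneg hM0]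
  calc _ ≤ C * (N : ℝ) ^ (-(1 / 4) : ℝ) * M := by gcongr
    _ ≤ C * ((n : ℝ) ^ k)⁻¹ * (n : ℝ) ^ k := by rw [h4]; gcongr
    _ = C := by
      have : (n : ℝ) ^ k ≠ 0 := by positivity
      field_simp

end SingularSeries

/-! ### Box sums of powers, and the weights that decide the number of logarithms. -/

section BoxSums

open Finset

/-- Multiple sums of negative powers, each exponent being at least `1`. -/
theorem sum_box_prod_rpow_le {ι : Type*} [Fintype ι] [DecidableEq ι] (𝒲 : Finset ι) {a : ℝ}
    (ha : 1 < a) :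
    ∃ C : ℝ, 0 ≤ C ∧ ∀ (w : ι → ℝ) (m : ℕ), (∀ V ∈ 𝒲, 1 ≤ w V) →
      (𝒲.filter fun V => w V < a).card ≤ m → ∀ N : ℕ, 1 ≤ N →
      ∑ U ∈ Fintype.piFinset (fun V => if V ∈ 𝒲 then Icc 1 N else {1}),
        ∏ V, (U V : ℝ) ^ (-w V) ≤ C * (1 + Real.log N) ^ m := by
  have hsum : Summable fun u : ℕ => (u : ℝ) ^ (-a) := Real.summable_nat_rpow.2 (by linarith)
  set Z := ∑' u : ℕ, (u : ℝ) ^ (-a) with hZ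
  have hZ1 : 1 ≤ Z := by
    have := hsum.le_tsum 1 (fun _ _ => Real.rpow_nonneg (Nat.cast_nonneg _) _)
    simpa using this
  refine ⟨Z ^ Fintype.card ι, by positivity, fun w m hw hm N hN => ?_⟩
  set L := 1 + Real.log N with hL
  have hL1 : 1 ≤ L := by
    have : 0 ≤ Real.log N := Real.log_nonneg (by exact_mod_cast hN)
    linarith
  rw [← prod_univ_sum (fun V => if V ∈ 𝒲 then Icc 1 N else {1}) (fun V (u : ℕ) => (u : ℝ) ^ (-w V))]
  calc ∏ V, ∑ u ∈ (if V ∈ 𝒲 then Icc 1 N else {1}), (u : ℝ) ^ (-w V)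
      ≤ ∏ V, Z * (if V ∈ 𝒲.filter (fun V => w V < a) then L else 1) := by
        refine prod_le_prod (fun V _ => sum_nonneg fun _ _ =>
          Real.rpow_nonneg (Nat.cast_nonneg _) _) fun V _ => ?_
        by_cases hV : V ∈ 𝒲
        · rw [if_pos hV]
          by_cases hwa : w V < a
          · rw [if_pos (mem_filter.2 ⟨hV, hwa⟩)]
            calc ∑ u ∈ Icc 1 N, (u : ℝ) ^ (-w V) ≤ ∑ u ∈ Icc 1 N, (u : ℝ)⁻¹ := by
                  refine sum_le_sum fun u hu => ?_
                  rw [← Real.rpow_neg_one]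
                  have : (1 : ℝ) ≤ u := by exact_mod_cast (mem_Icc.1 hu).1
                  exact Real.rpow_le_rpow_of_exponent_le this (by linarith [hw V hV])
              _ ≤ L := by
                  have := harmonic_le_one_add_log N
                  rw [harmonic_eq_sum_Icc] at this
                  push_cast at this
                  exact this
              _ ≤ Z * L := le_mul_of_one_le_left (by linarith) hZ1
          · rw [if_neg (fun h : V ∈ 𝒲.filter (fun V => w V < a) => hwa (mem_filter.1 h).2), mul_one]
            push Not at hwa
            calc ∑ u ∈ Icc 1 N, (u : ℝ) ^ (-w V) ≤ ∑ u ∈ Icc 1 N, (u : ℝ) ^ (-a) := by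
                  refine sum_le_sum fun u hu => ?_
                  have : (1 : ℝ) ≤ u := by exact_mod_cast (mem_Icc.1 hu).1
                  exact Real.rpow_le_rpow_of_exponent_le this (by linarith)
              _ ≤ Z := hsum.sum_le_tsum _ (fun _ _ => Real.rpow_nonneg (Nat.cast_nonneg _) _)
        · rw [if_neg hV, if_neg (fun h => hV (mem_filter.1 h).1)]
          simpa using hZ1
    _ = Z ^ Fintype.card ι * L ^ (𝒲.filter (fun V => w V < a)).card := by
        have hf : univ.filter (fun V => V ∈ 𝒲.filter (fun V => w V < a)) =
            𝒲.filter (fun V => w V < a) := by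
          ext V
          simp
        rw [prod_mul_distrib, prod_const, card_univ, ← prod_filter, prod_const, hf]
    _ ≤ Z ^ Fintype.card ι * L ^ m := by
        gcongr

variable {k : ℕ}

theorem pos_of_mem_patternBox {𝒲 : Finset (Finset (Fin k))} {N : ℕ} {U : Finset (Fin k) → ℕ}
    (hU : U ∈ patternBox 𝒲 N) (V : Finset (Fin k)) : 0 < U V := by
  have := Fintype.mem_piFinset.1 hU V
  split_ifs at this
  · exact (mem_Icc.1 this).1
  · rw [mem_singleton.1 this]
    exact one_pos

theorem eq_one_of_mem_patternBox {𝒲 : Finset (Finset (Fin k))} {N : ℕ} {U : Finset (Fin k) → ℕ}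
    (hU : U ∈ patternBox 𝒲 N) {V : Finset (Fin k)} (hV : V ∉ 𝒲) : U V = 1 := by
  have := Fintype.mem_piFinset.1 hU V
  rwa [if_neg hV, mem_singleton] at this

/-- The exponent of `U V` in the reciprocal of `gcdTerm (patternModulus U) v S`. -/
def gcdWeight (v : Fin k) (S V : Finset (Fin k)) : ℝ :=
  (V.erase v).card - if S ⊆ V then 1 else 0

theorem gcdTerm_patternModulus {U : Finset (Fin k) → ℕ} (hU : Squarefree (∏ V, U V))
    (v : Fin k) {S : Finset (Fin k)} (hS : S.Nonempty) :
    gcdTerm (patternModulus U) v S = ∏ V, (U V : ℝ) ^ (-gcdWeight v S V) := by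
  unfold gcdTerm
  rw [gcd_patternModulus hU hS, ← Nat.cast_prod, prod_patternModulus]
  push_cast
  rw [prod_filter, ← prod_div_distrib]
  refine prod_congr rfl fun V _ => ?_
  have hpos : (0 : ℝ) < U V := by exact_mod_cast pos_of_squarefree_prod hU V
  have e : V ∩ univ.erase v = V.erase v := by
    ext i
    simp [and_comm]
  rw [e, gcdWeight]
  split_ifs
  · rw [neg_sub, Real.rpow_sub hpos, Real.rpow_one, Real.rpow_natCast]
  · rw [sub_zero, Real.rpow_neg hpos.le, Real.rpow_natCast, one_div]

theorem gcdTerm_comp_perm (e : Fin k → ℕ) (σ : Equiv.Perm (Fin k)) (v : Fin k)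
    (S : Finset (Fin k)) :
    gcdTerm (e ∘ σ) v S = gcdTerm e (σ v) (S.image σ) := by
  unfold gcdTerm
  rw [gcd_image]
  congr 1
  have : univ.erase (σ v) = (univ.erase v).map σ.toEmbedding := by
    ext i
    simp only [mem_erase, mem_univ, and_true, Finset.mem_map_equiv, ne_eq]
    rw [Equiv.symm_apply_eq]
  rw [this, prod_map]
  rfl

theorem one_le_card_erase {s : ℕ} {V : Finset (Fin k)} (hV : V ∈ crossingSets k s) (v : Fin k) :
    1 ≤ (V.erase v).card := by
  have h1 := two_le_card_of_mem_crossingSets hV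
  have h2 := pred_card_le_card_erase (a := v) (s := V)
  omega

/-- Weights are at least `1`, and at least `2` apart from the pairs joining `v` to the other
side. -/
theorem gcdWeight_of_crossing {s : ℕ} (hs : s ≤ k) {v : Fin k} {S : Finset (Fin k)}
    (hS : ∀ V ∈ crossingSets k s, S ⊆ V → 3 ≤ (V.erase v).card) :
    (∀ V ∈ crossingSets k s, 1 ≤ gcdWeight v S V) ∧
      ((crossingSets k s).filter fun V => gcdWeight v S V < 2).card ≤ max s (k - s) := by
  constructor
  · intro V hV
    unfold gcdWeight
    split_ifs with h
    · have : (3 : ℝ) ≤ (V.erase v).card := by exact_mod_cast hS V hV h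
      linarith
    · have : (1 : ℝ) ≤ (V.erase v).card := by exact_mod_cast one_le_card_erase hV v
      linarith
  · set T : Finset (Fin k) := if v ∈ firstParts k s then univ \ firstParts k s else firstParts k s
      with hT
    have hTcard : T.card ≤ max s (k - s) := by
      rw [hT]
      split_ifs
      · rw [card_compl_firstParts hs]
        exact le_max_right _ _
      · rw [card_firstParts hs]
        exact le_max_left _ _
    refine le_trans ?_ hTcard
    refine (card_le_card ?_).trans (card_image_le (s := T) (f := fun x => ({v, x} : Finset (Fin k))))
    intro V hV
    rw [mem_filter] at hV
    obtain ⟨hV, hw⟩ := hV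
    unfold gcdWeight at hw
    have hnS : ¬ S ⊆ V := by
      intro h
      rw [if_pos h] at hw
      have : (3 : ℝ) ≤ (V.erase v).card := by exact_mod_cast hS V hV h
      linarith
    rw [if_neg hnS, sub_zero] at hw
    have hlt : (V.erase v).card < 2 := by exact_mod_cast hw
    have h1 : (V.erase v).card = 1 := by
      have := one_le_card_erase hV v
      omega
    have hvV : v ∈ V := by
      by_contra h
      rw [erase_eq_of_notMem h] at h1
      have := two_le_card_of_mem_crossingSets hV
      omega
    obtain ⟨x, hx⟩ := card_eq_one.1 h1
    have hVx : V = {v, x} := by rw [← insert_erase hvV, hx]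
    obtain ⟨⟨a, ha⟩, ⟨b, hb⟩⟩ := mem_crossingSets.1 hV
    rw [mem_inter] at ha
    rw [Finset.mem_sdiff] at hb
    rw [mem_image]
    refine ⟨x, ?_, hVx.symm⟩
    rw [hVx] at ha hb
    simp only [mem_insert, mem_singleton] at ha hb
    rw [hT]
    split_ifs with hv
    · rw [Finset.mem_sdiff]
      refine ⟨mem_univ _, ?_⟩
      rcases hb.1 with h | h
      · exact absurd hv (h ▸ hb.2)
      · exact h ▸ hb.2
    · rcases ha.1 with h | h
      · exact absurd (h ▸ ha.2) hv
      · exact h ▸ ha.2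

/-- Every `V ∈ 𝒲` meets `A`, so `U V` occurs at least once among the moduli of `A`. For crossing
sets, `A` can be either group. -/
theorem prod_le_prod_patternModulus {𝒲 : Finset (Finset (Fin k))} {N : ℕ}
    {U : Finset (Fin k) → ℕ} (hU : U ∈ patternBox 𝒲 N) {A : Finset (Fin k)}
    (hA : ∀ V ∈ 𝒲, (V ∩ A).Nonempty) : ∏ V, U V ≤ ∏ i ∈ A, patternModulus U i := by
  rw [prod_patternModulus]
  refine prod_le_prod' fun V _ => ?_
  by_cases hV : V ∈ 𝒲
  · exact Nat.le_self_pow (hA V hV).card_pos.ne' _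
  · rw [eq_one_of_mem_patternBox hU hV, one_pow]

end BoxSums

/-! ### The case `k - s ≥ 3`, with `k = K + 1`. -/

section LargeSide

open Finset

variable {K s : ℕ}

theorem swap_mem_firstParts {k : ℕ} {b c : Fin k} (hb : b ∉ firstParts k s)
    (hc : c ∉ firstParts k s) (i : Fin k) :
    Equiv.swap b c i ∈ firstParts k s ↔ i ∈ firstParts k s := by
  rw [Equiv.swap_apply_def]
  split_ifs with h1 h2
  · rw [h1]
    tauto
  · rw [h2]
    tauto
  · rfl

/-- The gcd is the modulus in the last position and cancels. The denominator still contains all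
moduli of the first group, with product at least `d = ∏ U V`, and the largest modulus `e b` of the
second group, moved to position `c`. Since at most `K + 1` moduli, each at most `e b`, have product
at least `d`, one has `e b ≥ d^(1/(K+1))`, so every weight exceeds `1`. -/
theorem gcdTerm_penultimate_le {𝒲 : Finset (Finset (Fin (K + 1)))}
    (h𝒲 : 𝒲 = crossingSets (K + 1) s) {N : ℕ} {U : Finset (Fin (K + 1)) → ℕ}
    (hU : U ∈ patternBox 𝒲 N) {b c j : Fin (K + 1)} (hb : b ∉ firstParts (K + 1) s)
    (hbmax : ∀ i ∉ firstParts (K + 1) s, patternModulus U i ≤ patternModulus U b)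
    (hc : c ∉ firstParts (K + 1) s) (hj : j ∉ firstParts (K + 1) s)
    (hl : Fin.last K ∉ firstParts (K + 1) s) (hcj : c ≠ j) (hcl : c ≠ Fin.last K)
    (hjK : j.val + 1 = K) :
    gcdTerm (patternModulus U ∘ Equiv.swap b c) j (Ioi j) ≤
      ∏ V, (U V : ℝ) ^ (-(1 + 1 / (K + 1 : ℝ))) := by
  set e := patternModulus U with he
  set σ := Equiv.swap b c with hσ
  have hUpos := pos_of_mem_patternBox hU
  have hepos : ∀ i, 0 < e i := patternModulus_pos hUpos
  have hIoi : Ioi j = {Fin.last K} := by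
    ext i
    simp only [mem_Ioi, mem_singleton, Fin.lt_def, Fin.ext_iff, Fin.val_last]
    have := i.2
    omega
  set d := ∏ V, U V with hd
  have hdpos : 0 < d := prod_pos fun V _ => hUpos V
  have hA : d ≤ ∏ i ∈ firstParts (K + 1) s, e i :=
    prod_le_prod_patternModulus hU fun V hV => (mem_crossingSets.1 (h𝒲 ▸ hV)).1
  have hB : d ≤ e b ^ (K + 1) := by
    calc d ≤ ∏ i ∈ univ \ firstParts (K + 1) s, e i :=
          prod_le_prod_patternModulus hU fun V hV => by
            obtain ⟨i, hi⟩ := (mem_crossingSets.1 (h𝒲 ▸ hV)).2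
            rw [Finset.mem_sdiff] at hi
            exact ⟨i, by simp [hi]⟩
      _ ≤ ∏ i ∈ univ \ firstParts (K + 1) s, e b :=
          prod_le_prod' fun i hi => hbmax i (Finset.mem_sdiff.1 hi).2
      _ = e b ^ (univ \ firstParts (K + 1) s).card := prod_const _
      _ ≤ e b ^ (K + 1) := Nat.pow_le_pow_right (hepos b) (by
          refine (card_le_univ _).trans ?_
          simp)
  have hprod : (∏ i ∈ firstParts (K + 1) s, e i) * e b * e (σ (Fin.last K)) ≤
      ∏ i ∈ univ.erase j, e (σ i) := by
    have hsub : insert (Fin.last K) (insert c (firstParts (K + 1) s)) ⊆ univ.erase j := by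
      intro i hi
      rw [mem_erase]
      refine ⟨?_, mem_univ _⟩
      rintro rfl
      simp only [mem_insert] at hi
      rcases hi with h | h | h
      · rw [Fin.ext_iff, Fin.val_last] at h
        omega
      · exact hcj h.symm
      · exact hj h
    have hfix : ∏ i ∈ firstParts (K + 1) s, e (σ i) = ∏ i ∈ firstParts (K + 1) s, e i := by
      refine prod_congr rfl fun i hi => ?_
      rw [hσ, Equiv.swap_apply_of_ne_of_ne]
      · rintro rfl
        exact hb hi
      · rintro rfl
        exact hc hi
    calc _ = ∏ i ∈ insert (Fin.last K) (insert c (firstParts (K + 1) s)), e (σ i) := by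
          rw [prod_insert, prod_insert hc, hfix]
          · rw [hσ, Equiv.swap_apply_right]
            ring
          · simp only [mem_insert, not_or]
            exact ⟨hcl.symm, hl⟩
      _ ≤ _ := prod_le_prod_of_subset_of_one_le' hsub fun i _ _ => hepos _
  have hdr : (0 : ℝ) < d := by exact_mod_cast hdpos
  have hroot : (d : ℝ) ^ (1 / (K + 1 : ℝ)) ≤ e b := by
    have h1 : (d : ℝ) ≤ (e b : ℝ) ^ (K + 1) := by exact_mod_cast hB
    calc (d : ℝ) ^ (1 / (K + 1 : ℝ)) ≤ ((e b : ℝ) ^ (K + 1)) ^ (1 / (K + 1 : ℝ)) :=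
          Real.rpow_le_rpow hdr.le h1 (by positivity)
      _ = e b := by
          rw [← Real.rpow_natCast, ← Real.rpow_mul (by positivity)]
          push_cast
          rw [mul_one_div_cancel (by positivity), Real.rpow_one]
  have hrhs : ∏ V, (U V : ℝ) ^ (-(1 + 1 / (K + 1 : ℝ))) =
      ((d : ℝ) * (d : ℝ) ^ (1 / (K + 1 : ℝ)))⁻¹ := by
    rw [Real.finsetProd_rpow _ _ (fun V _ => Nat.cast_nonneg _), ← Nat.cast_prod, ← hd,
      Real.rpow_neg hdr.le, Real.rpow_add hdr, Real.rpow_one]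
  rw [hrhs, gcdTerm, hIoi, gcd_singleton]
  simp only [Function.comp_apply, normalize_eq]
  have hel : (0 : ℝ) < e (σ (Fin.last K)) := by exact_mod_cast hepos _
  have hprod' : (d : ℝ) * (d : ℝ) ^ (1 / (K + 1 : ℝ)) * e (σ (Fin.last K)) ≤
      ∏ i ∈ univ.erase j, (e (σ i) : ℝ) := by
    have h1 : ((∏ i ∈ firstParts (K + 1) s, e i : ℕ) : ℝ) * e b * e (σ (Fin.last K)) ≤
        ((∏ i ∈ univ.erase j, e (σ i) : ℕ) : ℝ) := by exact_mod_cast hprod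
    rw [Nat.cast_prod (fun i => e (σ i))] at h1
    refine le_trans ?_ h1
    have h2 : (d : ℝ) ≤ ((∏ i ∈ firstParts (K + 1) s, e i : ℕ) : ℝ) := by exact_mod_cast hA
    gcongr
  have hpos : 0 < (d : ℝ) * (d : ℝ) ^ (1 / (K + 1 : ℝ)) := by positivity
  rw [div_le_iff₀ (lt_of_lt_of_le (by positivity) hprod')]
  calc (e (σ (Fin.last K)) : ℝ) = ((d : ℝ) * (d : ℝ) ^ (1 / (K + 1 : ℝ)))⁻¹ *
        ((d : ℝ) * (d : ℝ) ^ (1 / (K + 1 : ℝ)) * e (σ (Fin.last K))) := by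
        field_simp
    _ ≤ _ := by gcongr

/-- The index `b` of the largest modulus depends on `U`; summing over all possible `b` leaves
weights independent of `U`. -/
theorem latticeErr_patternModulus_le (hsK : s + 2 ≤ K) {N : ℕ}
    {U : Finset (Fin (K + 1)) → ℕ} (hU : U ∈ patternBox (crossingSets (K + 1) s) N)
    (hsq : Squarefree (∏ V, U V)) {n : ℕ} (hn : 0 < n) (c : Fin (K + 1)) (hcK : c.val + 2 = K) :
    latticeErr (patternModulus U) n ≤ (n : ℝ) ^ (K - 1) *
      (∑ b ∈ univ \ firstParts (K + 1) s,
        ∑ j ∈ (univ : Finset (Fin (K + 1))).filter (fun j => j.val + 1 < K),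
          ∏ V, (U V : ℝ) ^ (-gcdWeight (Equiv.swap b c j) ((Ioi j).image (Equiv.swap b c)) V) +
        ∏ V, (U V : ℝ) ^ (-(1 + 1 / (K + 1 : ℝ)))) := by
  have hlast : Fin.last K ∈ univ \ firstParts (K + 1) s := by
    simp only [firstParts, Finset.mem_sdiff, mem_univ, true_and, mem_filter, Fin.val_last]
    omega
  obtain ⟨b, hb, hbmax⟩ := exists_max_image (univ \ firstParts (K + 1) s) (patternModulus U)
    ⟨_, hlast⟩
  rw [Finset.mem_sdiff] at hb hlast
  have hmem : ∀ i : Fin (K + 1), s ≤ i.val → i ∉ firstParts (K + 1) s := by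
    intro i hi
    simp only [firstParts, mem_filter, mem_univ, true_and, not_lt]
    exact hi
  rw [← latticeErr_comp_perm _ n (Equiv.swap b c)]
  refine (latticeErr_le _ (fun i => patternModulus_pos (pos_of_mem_patternBox hU) _) hn).trans ?_
  gcongr
  set j₀ : Fin (K + 1) := ⟨K - 1, by omega⟩ with hj₀
  have hsplit : (univ : Finset (Fin (K + 1))).filter (fun j => j.val < K) =
      insert j₀ ((univ : Finset (Fin (K + 1))).filter (fun j => j.val + 1 < K)) := by
    ext j
    simp only [mem_filter, mem_univ, true_and, mem_insert, hj₀, Fin.ext_iff]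
    omega
  rw [hsplit, sum_insert (by simp [hj₀]; omega), add_comm]
  refine add_le_add ?_ ?_
  · refine le_trans (le_of_eq ?_) (single_le_sum (f := fun b =>
      ∑ j ∈ (univ : Finset (Fin (K + 1))).filter (fun j => j.val + 1 < K),
          ∏ V, (U V : ℝ) ^ (-gcdWeight (Equiv.swap b c j) ((Ioi j).image (Equiv.swap b c)) V))
      (fun b _ => sum_nonneg fun j _ => prod_nonneg fun V _ =>
        Real.rpow_nonneg (Nat.cast_nonneg _) _) (Finset.mem_sdiff.2 hb))
    refine sum_congr rfl fun j hj => ?_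
    refine (gcdTerm_comp_perm (patternModulus U) (Equiv.swap b c) j (Ioi j)).trans ?_
    rw [gcdTerm_patternModulus hsq]
    refine Finset.Nonempty.image ⟨Fin.last K, ?_⟩ _
    rw [mem_Ioi, Fin.lt_def, Fin.val_last]
    have := (mem_filter.1 hj).2
    omega
  · refine gcdTerm_penultimate_le rfl hU hb.2 (fun i hi => hbmax i (Finset.mem_sdiff.2 ⟨mem_univ _, hi⟩))
      (hmem c (by omega)) (hmem j₀ (by simp only [hj₀]; omega)) hlast.2 ?_ ?_ ?_
    · simp only [hj₀, ne_eq, Fin.ext_iff]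
      omega
    · simp only [ne_eq, Fin.ext_iff, Fin.val_last]
      omega
    · simp only [hj₀]
      omega

/-- Before position `c` at least three later indices lie in `V`. At `c` there are only two, both
from the second group, and a crossing `V` adds an index of the first. -/
theorem three_le_card_erase (hsK : s + 2 ≤ K) {b c j : Fin (K + 1)}
    (hb : b ∉ firstParts (K + 1) s) (hcK : c.val + 2 = K) (hj : j.val + 1 < K)
    {V : Finset (Fin (K + 1))} (hV : V ∈ crossingSets (K + 1) s)
    (hSV : (Ioi j).image (Equiv.swap b c) ⊆ V) :
    3 ≤ (V.erase (Equiv.swap b c j)).card := by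
  set σ := Equiv.swap b c with hσ
  have hmem : ∀ i : Fin (K + 1), s ≤ i.val → i ∉ firstParts (K + 1) s := by
    intro i hi
    simp only [firstParts, mem_filter, mem_univ, true_and, not_lt]
    exact hi
  have hc : c ∉ firstParts (K + 1) s := hmem c (by omega)
  have hσm : ∀ i, σ i ∈ firstParts (K + 1) s ↔ i ∈ firstParts (K + 1) s :=
    swap_mem_firstParts hb hc
  have hsub : (Ioi j).image σ ⊆ V.erase (σ j) := by
    intro i hi
    rw [mem_erase]
    refine ⟨?_, hSV hi⟩
    rintro rfl
    rw [mem_image] at hi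
    obtain ⟨i', hi', h⟩ := hi
    rw [σ.injective h] at hi'
    simp at hi'
  have hcard : ((Ioi j).image σ).card = K - j := by
    rw [card_image_of_injective _ σ.injective, Fin.card_Ioi]
    omega
  rcases lt_or_ge (j.val + 2) K with h | h
  · have := card_le_card hsub
    omega
  · have hjc : j = c := by
      rw [Fin.ext_iff]
      omega
    obtain ⟨a, ha⟩ := (mem_crossingSets.1 hV).1
    rw [mem_inter] at ha
    have ha1 : a ∉ (Ioi j).image σ := by
      intro h
      rw [mem_image] at h
      obtain ⟨i, hi, rfl⟩ := h
      rw [mem_Ioi, Fin.lt_def] at hi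
      exact hmem i (by omega) ((hσm i).1 ha.2)
    have ha2 : a ≠ σ j := by
      rintro rfl
      rw [hjc] at ha
      exact hc ((hσm c).1 ha.2)
    have hsub2 : insert a ((Ioi j).image σ) ⊆ V.erase (σ j) := by
      intro i hi
      rw [mem_insert] at hi
      rcases hi with rfl | hi
      · exact mem_erase.2 ⟨ha2, ha.1⟩
      · exact hsub hi
    have := card_le_card hsub2
    rw [card_insert_of_notMem ha1, hcard] at this
    omega

/-- The total lattice point error when the second group has at least three parts. -/
theorem sum_latticeErr_le_of_add_two_le (hsK : s + 2 ≤ K) :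
    ∃ C : ℝ, 0 ≤ C ∧ ∀ n N : ℕ, 1 ≤ n → 1 ≤ N →
      ∑ U ∈ (patternBox (crossingSets (K + 1) s) N).filter (fun U => Squarefree (∏ V, U V)),
        latticeErr (patternModulus U) n ≤
      C * (n : ℝ) ^ (K - 1) * (1 + Real.log N) ^ max s (K + 1 - s) := by
  obtain ⟨C₁, hC₁, h₁⟩ := sum_box_prod_rpow_le (crossingSets (K + 1) s) (a := 2) (by norm_num)
  obtain ⟨C₂, hC₂, h₂⟩ := sum_box_prod_rpow_le (crossingSets (K + 1) s)
    (a := 1 + 1 / (K + 1 : ℝ)) (by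
      have : (0 : ℝ) < 1 / (K + 1 : ℝ) := by positivity
      linarith)
  set B := univ \ firstParts (K + 1) s with hB
  set J := (univ : Finset (Fin (K + 1))).filter (fun j => j.val + 1 < K) with hJ
  refine ⟨B.card * (J.card * C₁) + C₂, by positivity, fun n N hn hN => ?_⟩
  set c : Fin (K + 1) := ⟨K - 2, by omega⟩ with hc
  have hcK : c.val + 2 = K := by
    simp only [hc]
    omega
  set L := 1 + Real.log N with hL
  have hL1 : 1 ≤ L := by
    have : 0 ≤ Real.log N := Real.log_nonneg (by exact_mod_cast hN)
    linarith
  set m := max s (K + 1 - s) with hm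
  calc _ ≤ ∑ U ∈ (patternBox (crossingSets (K + 1) s) N).filter (fun U => Squarefree (∏ V, U V)),
        (n : ℝ) ^ (K - 1) * (∑ b ∈ B, ∑ j ∈ J,
          ∏ V, (U V : ℝ) ^ (-gcdWeight (Equiv.swap b c j) ((Ioi j).image (Equiv.swap b c)) V) +
        ∏ V, (U V : ℝ) ^ (-(1 + 1 / (K + 1 : ℝ)))) := by
        refine sum_le_sum fun U hU => ?_
        rw [mem_filter] at hU
        exact latticeErr_patternModulus_le hsK hU.1 hU.2 hn c hcK
    _ ≤ ∑ U ∈ patternBox (crossingSets (K + 1) s) N,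
        (n : ℝ) ^ (K - 1) * (∑ b ∈ B, ∑ j ∈ J,
          ∏ V, (U V : ℝ) ^ (-gcdWeight (Equiv.swap b c j) ((Ioi j).image (Equiv.swap b c)) V) +
        ∏ V, (U V : ℝ) ^ (-(1 + 1 / (K + 1 : ℝ)))) := by
        refine sum_le_sum_of_subset_of_nonneg (filter_subset _ _) fun U _ _ => ?_
        refine mul_nonneg (by positivity) (add_nonneg (sum_nonneg fun b _ => sum_nonneg fun j _ =>
          prod_nonneg fun V _ => Real.rpow_nonneg (Nat.cast_nonneg _) _)
          (prod_nonneg fun V _ => Real.rpow_nonneg (Nat.cast_nonneg _) _))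
    _ = (n : ℝ) ^ (K - 1) * (∑ b ∈ B, ∑ j ∈ J, ∑ U ∈ patternBox (crossingSets (K + 1) s) N,
          ∏ V, (U V : ℝ) ^ (-gcdWeight (Equiv.swap b c j) ((Ioi j).image (Equiv.swap b c)) V) +
        ∑ U ∈ patternBox (crossingSets (K + 1) s) N,
          ∏ V, (U V : ℝ) ^ (-(1 + 1 / (K + 1 : ℝ)))) := by
        rw [← mul_sum, sum_add_distrib]
        congr 2
        rw [Finset.sum_comm]
        exact sum_congr rfl fun b _ => Finset.sum_comm
    _ ≤ (n : ℝ) ^ (K - 1) * (∑ b ∈ B, ∑ j ∈ J, C₁ * L ^ m + C₂ * L ^ m) := by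
        gcongr with b hb j hj
        · have hb' := (Finset.mem_sdiff.1 hb).2
          obtain ⟨hw1, hw2⟩ := gcdWeight_of_crossing (k := K + 1) (s := s) (by omega)
            (v := Equiv.swap b c j) (S := (Ioi j).image (Equiv.swap b c))
            (fun V hV hSV => three_le_card_erase hsK hb' hcK (mem_filter.1 hj).2 hV hSV)
          exact h₁ _ m hw1 hw2 N hN
        · refine h₂ (fun _ => 1 + 1 / (K + 1 : ℝ)) m (fun V _ => ?_) ?_ N hN
          · have : (0 : ℝ) < 1 / (K + 1 : ℝ) := by positivity
            linarith
          · simp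
    _ = _ := by
        simp only [sum_const, nsmul_eq_mul]
        ring

end LargeSide

/-! ### The case `k = 3`, `s = 1`. -/

section ThreeParts

open Finset

/-- For three parts, the condition at a prime dividing the sum needs only one index set. -/
noncomputable def threeCoeff (n p : ℕ) (V : Finset (Fin 3)) : ℝ :=
  (if V = {0, 1} then 1 else 0) + if V = {0, 2} then (if p ∣ n then 0 else 1) else 0

theorem sum_threeCoeff_mul (n p : ℕ) (g : Finset (Fin 3) → ℝ) :
    ∑ V, threeCoeff n p V * g V = g {0, 1} + if p ∣ n then 0 else g {0, 2} := by
  unfold threeCoeff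
  simp only [add_mul, ite_mul, one_mul, zero_mul, sum_add_distrib]
  rw [sum_ite_eq' univ ({0, 1} : Finset (Fin 3)) g, if_pos (mem_univ _),
    sum_ite_eq' univ ({0, 2} : Finset (Fin 3)) (fun V => if p ∣ n then 0 else g V),
    if_pos (mem_univ _)]

theorem abs_threeCoeff_le (n p : ℕ) (V : Finset (Fin 3)) : |threeCoeff n p V| ≤ 1 := by
  unfold threeCoeff
  by_cases h1 : V = {0, 1}
  · have h2 : V ≠ {0, 2} := by
      rw [h1]
      decide
    rw [if_pos h1, if_neg h2]
    simp
  · rw [if_neg h1]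
    split_ifs <;> simp

theorem threeCoeff_eq_zero (n p : ℕ) {V : Finset (Fin 3)}
    (hV : V ∉ ({{0, 1}, {0, 2}} : Finset (Finset (Fin 3)))) : threeCoeff n p V = 0 := by
  simp only [mem_insert, mem_singleton, not_or] at hV
  unfold threeCoeff
  rw [if_neg hV.1, if_neg hV.2, add_zero]

/-- Suppose `p ∣ x 0`. If `p ∣ n`, then `p ∣ x 1` and `p ∣ x 2` are equivalent, so one pair detects
both; if `p ∤ n`, they exclude each other and no triple intersection has to be subtracted. -/
theorem sum_threeCoeff {n p : ℕ} (hp : p.Prime) (x : Fin 3 → ℕ) (hx : ∑ i, x i = n) :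
    (∑ V, if ∀ i ∈ V, p ∣ x i then threeCoeff n p V else 0) =
      if p ∣ Nat.gcd (∏ i : Fin 3 with i.val < 1, x i) (∏ i : Fin 3 with 1 ≤ i.val, x i)
        then 1 else 0 := by
  have h1 := sum_threeCoeff_mul n p (fun V => if ∀ i ∈ V, p ∣ x i then 1 else 0)
  simp only [mul_ite, mul_one, mul_zero] at h1
  rw [h1]
  simp only [prime_dvd_gcd_iff hp]
  rw [Fin.sum_univ_three] at hx
  have e1 : (∃ i ∈ firstParts 3 1, p ∣ x i) ↔ p ∣ x 0 := by
    simp [firstParts]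
  have e2 : (∃ i ∉ firstParts 3 1, p ∣ x i) ↔ p ∣ x 1 ∨ p ∣ x 2 := by
    simp [firstParts, Fin.exists_fin_succ]
  have e3 : ∀ a b : Fin 3, (∀ i ∈ ({a, b} : Finset (Fin 3)), p ∣ x i) ↔ p ∣ x a ∧ p ∣ x b := by
    intro a b
    simp
  simp only [e1, e2, e3]
  by_cases h0 : p ∣ x 0
  · by_cases hpn : p ∣ n
    · have h12 : p ∣ x 1 ↔ p ∣ x 2 := by
        rw [← hx] at hpn
        constructor
        · intro h
          exact (Nat.dvd_add_right (Dvd.dvd.add h0 h)).1 hpn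
        · intro h
          exact (Nat.dvd_add_right h0).1 ((Nat.dvd_add_left h).1 hpn)
      simp [h0, hpn, h12]
    · have h12 : ¬ (p ∣ x 1 ∧ p ∣ x 2) := by
        rintro ⟨h, h'⟩
        apply hpn
        rw [← hx]
        exact Dvd.dvd.add (Dvd.dvd.add h0 h) h'
      by_cases ha : p ∣ x 1 <;> by_cases hb : p ∣ x 2 <;> simp_all
  · simp [h0]

theorem polyF_three_one {x : ℝ} (hx : x ≠ 0) : polyF 3 1 x = 2 := by
  unfold polyF
  field_simp
  norm_num
  ring

theorem sum_threeCoeff_mul_localDensity (n : ℕ) {p : ℕ} (hp : p.Prime) :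
    ∑ V, threeCoeff n p V * localDensity 3 n p V = localDefect 3 1 n p := by
  have hp0 : (p : ℝ) ≠ 0 := by exact_mod_cast hp.ne_zero
  rw [sum_threeCoeff_mul]
  unfold localDefect localDensity
  rw [polyF_three_one hp0, if_neg (by decide : ({0, 1} : Finset (Fin 3)) ≠ univ),
    if_neg (by decide : ({0, 2} : Finset (Fin 3)) ≠ univ)]
  have c1 : ({0, 1} : Finset (Fin 3)).card = 2 := by decide
  have c2 : ({0, 2} : Finset (Fin 3)).card = 2 := by decide
  rw [c1, c2]
  split_ifs <;> norm_num <;> ring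

theorem one_le_gcdWeight_three {j : Fin 3} (hj : j.val < 2) {V : Finset (Fin 3)}
    (hV : V ∈ ({{0, 1}, {0, 2}} : Finset (Finset (Fin 3)))) : 1 ≤ gcdWeight j (Ioi j) V := by
  have h : ∀ j : Fin 3, j.val < 2 → ∀ V ∈ ({{0, 1}, {0, 2}} : Finset (Finset (Fin 3))),
      1 + (if Ioi j ⊆ V then 1 else 0) ≤ (V.erase j).card := by decide
  have h1 := h j hj V hV
  have h2 : ((1 + (if Ioi j ⊆ V then 1 else 0) : ℕ) : ℝ) ≤ (V.erase j).card := by exact_mod_cast h1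
  unfold gcdWeight
  push_cast at h2
  linarith

/-- Only two sets enter, so weights of at least `1` already give two logarithms. The full index set,
absent here, would also have weight `1` at position `1`. -/
theorem sum_latticeErr_three_le :
    ∃ C : ℝ, 0 ≤ C ∧ ∀ n N : ℕ, 1 ≤ n → 1 ≤ N →
      ∑ U ∈ (patternBox ({{0, 1}, {0, 2}} : Finset (Finset (Fin 3))) N).filter
        (fun U => Squarefree (∏ V, U V)), latticeErr (patternModulus U) n ≤
      C * (n : ℝ) * (1 + Real.log N) ^ 2 := by
  set 𝒲 : Finset (Finset (Fin 3)) := {{0, 1}, {0, 2}} with h𝒲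
  obtain ⟨C, hC, h⟩ := sum_box_prod_rpow_le 𝒲 (a := 2) (by norm_num)
  refine ⟨2 * C, by positivity, fun n N hn hN => ?_⟩
  set J := (univ : Finset (Fin 3)).filter (fun j => j.val < 2) with hJ
  have hJcard : J.card = 2 := by decide
  calc _ ≤ ∑ U ∈ (patternBox 𝒲 N).filter (fun U => Squarefree (∏ V, U V)),
        (n : ℝ) * ∑ j ∈ J, ∏ V, (U V : ℝ) ^ (-gcdWeight j (Ioi j) V) := by
        refine sum_le_sum fun U hU => ?_
        rw [mem_filter] at hU
        have h1 := latticeErr_le (patternModulus U)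
          (fun i => patternModulus_pos (pos_of_mem_patternBox hU.1) i) hn
        rw [pow_one] at h1
        refine h1.trans (le_of_eq ?_)
        congr 1
        refine sum_congr rfl fun j hj => ?_
        rw [gcdTerm_patternModulus hU.2]
        have := (mem_filter.1 hj).2
        refine ⟨Fin.last 2, ?_⟩
        rw [mem_Ioi, Fin.lt_def, Fin.val_last]
        exact this
    _ ≤ ∑ U ∈ patternBox 𝒲 N,
        (n : ℝ) * ∑ j ∈ J, ∏ V, (U V : ℝ) ^ (-gcdWeight j (Ioi j) V) := by
        refine sum_le_sum_of_subset_of_nonneg (filter_subset _ _) fun U _ _ => ?_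
        exact mul_nonneg (by positivity) (sum_nonneg fun j _ =>
          prod_nonneg fun V _ => Real.rpow_nonneg (Nat.cast_nonneg _) _)
    _ = (n : ℝ) * ∑ j ∈ J, ∑ U ∈ patternBox 𝒲 N, ∏ V, (U V : ℝ) ^ (-gcdWeight j (Ioi j) V) := by
        rw [← mul_sum, Finset.sum_comm]
    _ ≤ (n : ℝ) * ∑ j ∈ J, C * (1 + Real.log N) ^ 2 := by
        gcongr with j hj
        refine h _ 2 (fun V hV => one_le_gcdWeight_three (mem_filter.1 hj).2 hV) ?_ N hN
        exact (card_filter_le _ _).trans card_le_two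
    _ = _ := by
        rw [sum_const, hJcard, nsmul_eq_mul]
        push_cast
        ring

end ThreeParts

/-! ### A direct count in place of the penultimate error term for four parts. -/

section Counting

open Finset

/-- Points of a residue class that are divisible by a coprime number. -/
theorem card_filter_dvd_sub_dvd_le {a c : ℕ} (ha : 0 < a) (hc : 0 < c) (h : Nat.Coprime a c)
    (n : ℕ) :
    (((Ico 1 n).filter fun y => a ∣ n - y ∧ c ∣ y).card : ℝ) ≤
      if a ≤ n then (n : ℝ) / (a * c) + 1 else 0 := by
  split_ifs with han
  · obtain ⟨b, hb1, hb2⟩ := Nat.chineseRemainder h n 0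
    have hsub : (Ico 1 n).filter (fun y => a ∣ n - y ∧ c ∣ y) ⊆
        (Ico 1 n).filter (fun y => y ≡ b [MOD a * c]) := by
      intro y hy
      rw [mem_filter] at hy ⊢
      refine ⟨hy.1, ?_⟩
      rw [← Nat.modEq_and_modEq_iff_modEq_mul h]
      exact ⟨((dvd_sub_iff_modEq (mem_Ico.1 hy.1).2.le).1 hy.2.1).trans hb1.symm,
        ((Nat.modEq_zero_iff_dvd).2 hy.2.2).trans hb2.symm⟩
    have h1 := (abs_le.1 (abs_sum_pow_modEq_sub_le (l := a * c) 0 b n (by positivity))).2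
    simp only [pow_zero, sum_const, nsmul_eq_mul, mul_one, zero_add, pow_one, Nat.cast_zero,
      one_mul, Nat.cast_mul] at h1
    have h2 : (((Ico 1 n).filter fun y => a ∣ n - y ∧ c ∣ y).card : ℝ) ≤
        ((Ico 1 n).filter (fun y => y ≡ b [MOD a * c])).card := by
      exact_mod_cast card_le_card hsub
    linarith
  · rw [filter_false_of_mem]
    · simp
    · rintro y hy ⟨h1, -⟩
      have hy' := mem_Ico.1 hy
      have := Nat.le_of_dvd (by omega) h1
      omega

/-- One-part errors vanish and the remaining ratio of gcd to product is `1`. If the gcd does not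
divide `n`, both count and main term are `0`. -/
theorem latticeErr_two_le (e : Fin 2 → ℕ) (he : ∀ i, 0 < e i) (n : ℕ) :
    latticeErr e n ≤ if univ.gcd e ∣ n then 1 else 0 := by
  split_ifs with h
  · refine (latticeErr_succ_le le_rfl e he n).trans (le_of_eq ?_)
    rw [sum_eq_zero]
    · have h1 : univ.gcd (Fin.tail e) = e 1 := by
        simp [Fin.tail, univ_unique]
      have h2 : (e 1 : ℝ) ≠ 0 := by exact_mod_cast (he 1).ne'
      rw [h1]
      simp [Fin.tail, h2]
    · intro y hy
      exact latticeErr_one _ (he 1) (mem_Ico.1 (mem_filter.1 hy).1).1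
  · have h0 : latticeCount e n = 0 := by
      unfold latticeCount
      rw [card_eq_zero, filter_eq_empty_iff]
      intro x hx hd
      apply h
      rw [← (mem_piAntidiag.1 hx).1]
      exact dvd_sum fun i _ => (gcd_dvd (mem_univ i)).trans (hd i).2
    unfold latticeErr latticeMain
    rw [if_neg h, h0]
    simp

/-- The two-part error is at most `1` and lives on remainders divisible by `gcd(e 2, e 3)`, hence by
`c` and `d`. The last term therefore counts choices of the first two parts: `c` divides the
remainder after the first, `d` the remainder after the second. Coprimality lets each condition gain
its full factor, up to rounding. -/
theorem latticeErr_four_le (e : Fin 4 → ℕ) (he : ∀ i, 0 < e i) (n : ℕ) {c d : ℕ}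
    (hc : 0 < c) (hd : 0 < d) (hc1 : c ∣ e 1) (hc2 : c ∣ e 2) (hc3 : c ∣ e 3) (hd2 : d ∣ e 2)
    (hd3 : d ∣ e 3) (h0 : Nat.Coprime (e 0) c) (h1 : Nat.Coprime (e 1) d) :
    latticeErr e n ≤ (n : ℝ) ^ 2 * gcdTerm e 0 (Ioi 0) + (n : ℝ) ^ 2 * gcdTerm e 1 (Ioi 1) +
      (if e 0 ≤ n then (n : ℝ) / (e 0 * c) + 1 else 0) *
        (if e 1 ≤ n then (n : ℝ) / (e 1 * d) + 1 else 0) := by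
  have hinner : ∀ y ∈ (Ico 1 n).filter (fun y => e 0 ∣ n - y),
      latticeErr (Fin.tail e) y ≤ (n : ℝ) * gcdTerm (Fin.tail e) 0 (Ioi 0) +
        if c ∣ y then (if e 1 ≤ n then (n : ℝ) / (e 1 * d) + 1 else 0) else 0 := by
    intro y hy
    rw [mem_filter, mem_Ico] at hy
    have hyn : (y : ℝ) ≤ n := by exact_mod_cast hy.1.2.le
    have hpos : ∀ i, 0 < Fin.tail e i := fun i => he _
    have key := latticeErr_succ_le (by norm_num : 1 ≤ 2) (Fin.tail e) hpos y
    rw [← gcdTerm_zero] at key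
    refine (key.trans (le_of_eq (add_comm _ _))).trans (add_le_add ?_ ?_)
    · rw [show 2 - 1 = 1 from rfl, pow_one]
      exact mul_le_mul_of_nonneg_right hyn (gcdTerm_nonneg _ _ _)
    · have hz : ∑ z ∈ (Ico 1 y).filter (fun z => Fin.tail e 0 ∣ y - z),
          latticeErr (Fin.tail (Fin.tail e)) z ≤
          (((Ico 1 y).filter fun z => e 1 ∣ y - z ∧ c ∣ z ∧ d ∣ z).card : ℝ) := by
        rw [← filter_filter, card_filter _ (filter _ _), Nat.cast_sum]
        refine sum_le_sum fun z hz => ?_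
        rw [mem_filter, mem_Ico] at hz
        refine (latticeErr_two_le _ (fun i => he _) z).trans ?_
        split_ifs with h2 h3
        · simp
        · refine absurd ⟨?_, ?_⟩ h3
          · refine (Finset.dvd_gcd fun i _ => ?_).trans h2
            fin_cases i
            · exact hc2
            · exact hc3
          · refine (Finset.dvd_gcd fun i _ => ?_).trans h2
            fin_cases i
            · exact hd2
            · exact hd3
        · simp
        · simp
      refine hz.trans ?_
      split_ifs with hcy hen
      · have h2 : (((Ico 1 y).filter fun z => e 1 ∣ y - z ∧ c ∣ z ∧ d ∣ z).card : ℝ) ≤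
            ((Ico 1 y).filter fun z => e 1 ∣ y - z ∧ d ∣ z).card := by
          exact_mod_cast card_le_card fun z hz => by
            rw [mem_filter] at hz ⊢
            exact ⟨hz.1, hz.2.1, hz.2.2.2⟩
        refine h2.trans ((card_filter_dvd_sub_dvd_le (he 1) hd h1 y).trans ?_)
        split_ifs
        · gcongr
        · positivity
      · rw [filter_false_of_mem]
        · simp
        · rintro z hz ⟨h, -⟩
          have hz' := mem_Ico.1 hz
          have := Nat.le_of_dvd (by omega) h
          omega
      -- As `c` divides both `e 1` and `z`, it divides `y`; otherwise no `z` exists.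
      all_goals
        rw [filter_false_of_mem]
        · simp
        · rintro z hz ⟨h, h', -⟩
          have hz' := mem_Ico.1 hz
          apply hcy
          have := (Nat.dvd_add_right h').2 (hc1.trans h)
          rwa [Nat.add_sub_cancel' hz'.2.le] at this
  have key := latticeErr_succ_le (by norm_num : 1 ≤ 3) e he n
  rw [← gcdTerm_zero] at key
  refine (key.trans (le_of_eq (add_comm _ _))).trans ?_
  rw [add_assoc]
  refine add_le_add le_rfl ?_
  refine (sum_le_sum hinner).trans ?_
  rw [sum_add_distrib, sum_const, nsmul_eq_mul, ← sum_filter, filter_filter, sum_const, nsmul_eq_mul]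
  refine add_le_add ?_ ?_
  · have e1 : gcdTerm e 1 (Ioi 1) = gcdTerm (Fin.tail e) 0 (Ioi 0) / e 0 := gcdTerm_succ e 0
    have hcard : (((Ico 1 n).filter (fun y => e 0 ∣ n - y)).card : ℝ) ≤ n / e 0 := by
      refine le_trans ?_ (card_filter_dvd_sub_le n (e 0))
      exact_mod_cast card_le_card (filter_subset_filter _ fun y hy => by
        rw [mem_Ico] at hy
        exact mem_range.2 hy.2)
    rw [e1]
    calc _ ≤ (n / e 0 : ℝ) * ((n : ℝ) * gcdTerm (Fin.tail e) 0 (Ioi 0)) :=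
          mul_le_mul_of_nonneg_right hcard
            (mul_nonneg (Nat.cast_nonneg _) (gcdTerm_nonneg _ _ _))
      _ = _ := by ring
  · refine mul_le_mul_of_nonneg_right (card_filter_dvd_sub_dvd_le (he 0) hc h0 n) ?_
    split_ifs <;> positivity

end Counting

/-! ### Summing out one coordinate of a box, and folding a sum by an involution. -/

section BoxOperations

open Finset

variable {ι : Type*} [Fintype ι] [DecidableEq ι]

/-- Tuples with entries in `[1, N]` at the indices in `𝒲` and entries `1` elsewhere. -/
def tupleBox (𝒲 : Finset ι) (N : ℕ) : Finset (ι → ℕ) :=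
  Fintype.piFinset fun i => if i ∈ 𝒲 then Icc 1 N else {1}

/-- A sum over a box, bounded by summing over one coordinate first. -/
theorem sum_tupleBox_le_erase {𝒲 : Finset ι} {i : ι} (hi : i ∈ 𝒲) {N : ℕ}
    {F G : (ι → ℕ) → ℝ}
    (h : ∀ x ∈ tupleBox (𝒲.erase i) N, ∑ y ∈ Icc 1 N, F (Function.update x i y) ≤ G x) :
    ∑ x ∈ tupleBox 𝒲 N, F x ≤ ∑ x ∈ tupleBox (𝒲.erase i) N, G x := by
  refine le_trans (le_of_eq ?_) (sum_le_sum h)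
  rw [← sum_product']
  refine sum_nbij' (fun x => (Function.update x i 1, x i)) (fun q => Function.update q.1 i q.2)
    ?_ ?_ ?_ ?_ ?_
  · intro x hx
    simp only [tupleBox, Fintype.mem_piFinset] at hx
    simp only [tupleBox, mem_product, Fintype.mem_piFinset]
    refine ⟨fun j => ?_, ?_⟩
    · by_cases hj : j = i
      · subst hj
        simp
      · simpa [Function.update_of_ne hj, hj] using hx j
    · simpa [hi] using hx i
  · intro q hq
    simp only [tupleBox, mem_product, Fintype.mem_piFinset] at hq
    simp only [tupleBox, Fintype.mem_piFinset]
    intro j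
    by_cases hj : j = i
    · subst hj
      simpa [hi] using hq.2
    · simpa [Function.update_of_ne hj, hj] using hq.1 j
  · intro x _
    simp
  · intro q hq
    simp only [tupleBox, mem_product, Fintype.mem_piFinset] at hq
    have h1 := hq.1 i
    simp only [mem_erase, ne_eq, not_true_eq_false, false_and, if_false, mem_singleton] at h1
    ext j
    · by_cases hj : j = i
      · subst hj
        simp [h1]
      · simp [Function.update_of_ne hj]
    · simp
  · intro x _
    simp

/-- A nonnegative sum over a set with an involution is at most twice its part over a set of
representatives. -/
theorem sum_le_two_mul_sum_filter {α : Type*} {A : Finset α} {f : α → ℝ} {g : α → α}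
    {P : α → Prop} [DecidablePred P] (hf : ∀ a ∈ A, 0 ≤ f a) (hg : ∀ a ∈ A, g a ∈ A)
    (hgg : ∀ a ∈ A, g (g a) = a) (hfg : ∀ a ∈ A, f (g a) = f a)
    (hP : ∀ a ∈ A, P a ∨ P (g a)) :
    ∑ a ∈ A, f a ≤ 2 * ∑ a ∈ A.filter P, f a := by
  have h1 : ∑ a ∈ A.filter (fun a => P (g a)), f a = ∑ a ∈ A.filter P, f a := by
    refine sum_nbij' g g ?_ ?_ ?_ ?_ ?_
    · intro a ha
      rw [mem_filter] at ha ⊢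
      exact ⟨hg a ha.1, ha.2⟩
    · intro a ha
      rw [mem_filter] at ha ⊢
      refine ⟨hg a ha.1, ?_⟩
      rw [hgg a ha.1]
      exact ha.2
    · intro a ha
      exact hgg a (mem_filter.1 ha).1
    · intro a ha
      exact hgg a (mem_filter.1 ha).1
    · intro a ha
      exact (hfg a (mem_filter.1 ha).1).symm
  rw [two_mul]
  nth_rewrite 2 [← h1]
  rw [sum_filter, sum_filter, ← sum_add_distrib]
  refine sum_le_sum fun a ha => ?_
  have h0 := hf a ha
  rcases hP a ha with h | h <;> rw [if_pos h] <;> split_ifs <;> linarith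

end BoxOperations

/-! ### The sum of the direct counts over the nine crossing sets for `k = 4`, `s = 2`. -/

section NineVariables

open Finset

theorem prod_univ_fin_nine {M : Type*} [CommMonoid M] (f : Fin 9 → M) :
    ∏ i, f i = f 0 * f 1 * f 2 * f 3 * f 4 * f 5 * f 6 * f 7 * f 8 := by
  rw [Fin.prod_univ_castSucc, Fin.prod_univ_eight]
  rfl

theorem sum_ite_const_le {P : ℕ → Prop} [DecidablePred P] {K Y : ℝ} (hK : 0 ≤ K) (hY : 0 ≤ Y)
    (N : ℕ) (h : ∀ y, P y → (y : ℝ) ≤ Y) : ∑ y ∈ Icc 1 N, (if P y then K else 0) ≤ K * Y := by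
  rw [← sum_filter, sum_const, nsmul_eq_mul, mul_comm]
  gcongr
  have hsub : (Icc 1 N).filter P ⊆ Icc 1 ⌊Y⌋₊ := by
    intro y hy
    rw [mem_filter, mem_Icc] at hy
    exact mem_Icc.2 ⟨hy.1.1, Nat.le_floor (h y hy.2)⟩
  calc (((Icc 1 N).filter P).card : ℝ) ≤ (Icc 1 ⌊Y⌋₊).card := by exact_mod_cast card_le_card hsub
    _ = ⌊Y⌋₊ := by simp
    _ ≤ Y := Nat.floor_le hY

/-- A product of reciprocals, with exponent `1` for the indices in `S` and `5/4` elsewhere. -/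
noncomputable def reciprocalWeight (S : Finset (Fin 9)) (x : Fin 9 → ℕ) : ℝ :=
  ∏ i, (x i : ℝ) ^ (-(if i ∈ S then 1 else 5 / 4 : ℝ))

theorem sum_reciprocalWeight_le :
    ∃ C : ℝ, 0 ≤ C ∧ ∀ (𝒲 S : Finset (Fin 9)) (N : ℕ), (𝒲 ∩ S).card ≤ 2 → 1 ≤ N →
      ∑ x ∈ tupleBox 𝒲 N, reciprocalWeight S x ≤ C * (1 + Real.log N) ^ 2 := by
  choose C hC h using fun 𝒲 : Finset (Fin 9) =>
    sum_box_prod_rpow_le 𝒲 (a := 5 / 4) (by norm_num)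
  refine ⟨∑ 𝒲, C 𝒲, sum_nonneg fun _ _ => hC _, fun 𝒲 S N hcard hN => ?_⟩
  refine (h 𝒲 (fun i => if i ∈ S then 1 else 5 / 4) 2 ?_ ?_ N hN).trans ?_
  · intro i _
    split_ifs <;> norm_num
  · refine le_trans (card_le_card fun i hi => ?_) hcard
    rw [mem_filter] at hi
    refine Finset.mem_inter.2 ⟨hi.1, ?_⟩
    by_contra hS
    simp [hS] at hi
  · gcongr
    exact single_le_sum (f := C) (fun _ _ => hC _) (mem_univ 𝒲)

/-- In fourth roots the exponents `1` and `5/4` become `4` and `5`, and the square roots of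
`balancedBound` become squares; the estimates below are then inequalities between monomials. -/
theorem exists_fourthRoots {x : Fin 9 → ℕ} (hx : ∀ i, 0 < x i) :
    ∃ r : Fin 9 → ℝ, (∀ i, 1 ≤ r i) ∧ (∀ i, (x i : ℝ) = r i ^ 4) ∧ (∀ i, x i = 1 → r i = 1) ∧
      ∀ S, reciprocalWeight S x = (∏ i, r i ^ (if i ∈ S then 4 else 5))⁻¹ := by
  refine ⟨fun i => (x i : ℝ) ^ (1 / 4 : ℝ), fun i => ?_, fun i => ?_, fun i h => ?_, fun S => ?_⟩
  · exact Real.one_le_rpow (by exact_mod_cast hx i) (by norm_num)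
  · rw [← Real.rpow_natCast, ← Real.rpow_mul (Nat.cast_nonneg _)]
    norm_num
  · simp [h]
  · unfold reciprocalWeight
    rw [← prod_inv_distrib]
    refine prod_congr rfl fun i _ => ?_
    rw [Real.rpow_neg (Nat.cast_nonneg _), ← Real.rpow_natCast,
      ← Real.rpow_mul (Nat.cast_nonneg _)]
    split_ifs <;> norm_num

theorem pos_of_mem_tupleBox {ι : Type*} [Fintype ι] [DecidableEq ι] {𝒲 : Finset ι} {N : ℕ}
    {x : ι → ℕ} (hx : x ∈ tupleBox 𝒲 N) (i : ι) : 0 < x i := by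
  have := Fintype.mem_piFinset.1 hx i
  split_ifs at this
  · exact (mem_Icc.1 this).1
  · rw [mem_singleton.1 this]
    exact one_pos

theorem eq_one_of_mem_tupleBox {ι : Type*} [Fintype ι] [DecidableEq ι] {𝒲 : Finset ι} {N : ℕ}
    {x : ι → ℕ} (hx : x ∈ tupleBox 𝒲 N) {i : ι} (hi : i ∉ 𝒲) : x i = 1 := by
  have := Fintype.mem_piFinset.1 hx i
  rwa [if_neg hi, mem_singleton] at this

/-- With `x i` attached to the `i`-th index set meeting both `{0, 1}` and `{2, 3}`, the modulus at
the part `0` is `x 2 * cofactorZero x`. -/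
def cofactorZero (x : Fin 9 → ℕ) : ℕ := x 0 * x 4 * x 5 * x 6 * x 8

/-- The modulus at the part `2` is `x 3 * cofactorTwo x`. -/
def cofactorTwo (x : Fin 9 → ℕ) : ℕ := x 0 * x 4 * x 5 * x 7 * x 8

/-- The product of the moduli at `1` and `3` does not exceed the product of those at `0` and `2`. -/
def IsBalanced (x : Fin 9 → ℕ) : Prop := x 1 ^ 2 * (x 6 * x 7) ≤ x 0 ^ 2 * (x 4 * x 5)

instance : DecidablePred IsBalanced := fun _ => inferInstanceAs (Decidable (_ ≤ _))

theorem IsBalanced.roots_le {x : Fin 9 → ℕ} (h : IsBalanced x) {r : Fin 9 → ℝ}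
    (hr : ∀ i, 1 ≤ r i) (hxr : ∀ i, (x i : ℝ) = r i ^ 4) :
    r 1 ^ 2 * (r 6 * r 7) ≤ r 0 ^ 2 * (r 4 * r 5) := by
  have hpos : ∀ i, 0 < r i := fun i => one_pos.trans_le (hr i)
  have h1 : ((x 1 ^ 2 * (x 6 * x 7) : ℕ) : ℝ) ≤ ((x 0 ^ 2 * (x 4 * x 5) : ℕ) : ℝ) := by
    exact_mod_cast h
  push_cast at h1
  simp only [hxr] at h1
  have := hpos 0
  have := hpos 4
  have := hpos 5
  refine le_of_pow_le_pow_left₀ (n := 4) (by norm_num) (by positivity) ?_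
  calc _ = (r 1 ^ 4) ^ 2 * (r 6 ^ 4 * r 7 ^ 4) := by ring
    _ ≤ _ := h1
    _ = _ := by ring

/-- The largest value of `x 1` for which `x` is balanced, the other entries being fixed. -/
noncomputable def balancedBound (x : Fin 9 → ℕ) : ℝ :=
  x 0 * √(x 4 * x 5) / √(x 6 * x 7)

theorem IsBalanced.le_balancedBound {x : Fin 9 → ℕ} (hx : ∀ i, 0 < x i) {y : ℕ}
    (h : IsBalanced (Function.update x 1 y)) : (y : ℝ) ≤ balancedBound x := by
  have h1 : y ^ 2 * (x 6 * x 7) ≤ x 0 ^ 2 * (x 4 * x 5) := h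
  have h2 : (y : ℝ) ^ 2 * (x 6 * x 7) ≤ (x 0 : ℝ) ^ 2 * (x 4 * x 5) := by exact_mod_cast h1
  have h6 : (0 : ℝ) < x 6 := by exact_mod_cast hx 6
  have h7 : (0 : ℝ) < x 7 := by exact_mod_cast hx 7
  unfold balancedBound
  rw [le_div_iff₀ (by positivity)]
  refine le_of_sq_le_sq ?_ (by positivity)
  rw [mul_pow, mul_pow, Real.sq_sqrt (by positivity), Real.sq_sqrt (by positivity)]
  exact h2

theorem balancedBound_eq {x : Fin 9 → ℕ} {r : Fin 9 → ℝ} (hxr : ∀ i, (x i : ℝ) = r i ^ 4) :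
    balancedBound x = r 0 ^ 4 * (r 4 ^ 2 * r 5 ^ 2) / (r 6 ^ 2 * r 7 ^ 2) := by
  unfold balancedBound
  simp only [hxr]
  have h (i j : Fin 9) : √(r i ^ 4 * r j ^ 4) = r i ^ 2 * r j ^ 2 := by
    rw [show r i ^ 4 * r j ^ 4 = (r i ^ 2 * r j ^ 2) ^ 2 by ring]
    exact Real.sqrt_sq (by positivity)
  rw [h, h]

/-- The letters `u, v, w, z, p, q, b, c, s` are the roots `r 0, …, r 8`. Only `v` lacks the fifth
power among those requiring it; balance gives `v ≤ u p q`, and `u`, `p`, `q` have powers to spare.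
-/
theorem modulusZero_modulusTwo_recip_le {u v w z p q b c s t : ℝ} (hu : 1 ≤ u) (hv : 1 ≤ v) (hw : 1 ≤ w)
    (hz : 1 ≤ z) (hp : 1 ≤ p) (hq : 1 ≤ q) (hb : 1 ≤ b) (hc : 1 ≤ c) (hs : 1 ≤ s)
    (h : v ^ 2 * (b * c) ≤ u ^ 2 * (p * q)) :
    t / (w ^ 4 * (u ^ 4 * p ^ 4 * q ^ 4 * b ^ 4 * s ^ 4) * c ^ 4) *
      (t / (z ^ 4 * (u ^ 4 * p ^ 4 * q ^ 4 * c ^ 4 * s ^ 4) * (v ^ 4 * b ^ 4))) ≤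
      t ^ 2 * (u ^ 5 * v ^ 5 * w ^ 4 * z ^ 4 * p ^ 5 * q ^ 5 * b ^ 5 * c ^ 5 * s ^ 5)⁻¹ := by
  have hvle : v ≤ u * p * q := by
    refine le_of_sq_le_sq ?_ (by positivity)
    calc v ^ 2 ≤ v ^ 2 * (b * c) :=
          le_mul_of_one_le_right (by positivity) (one_le_mul_of_one_le_of_one_le hb hc)
      _ ≤ u ^ 2 * (p * q) := h
      _ ≤ u ^ 2 * (p ^ 2 * q ^ 2) := by
        gcongr
        · exact le_self_pow₀ hp (by norm_num)
        · exact le_self_pow₀ hq (by norm_num)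
      _ = _ := by ring
  rw [div_mul_div_comm, ← sq, div_eq_mul_inv]
  refine mul_le_mul_of_nonneg_left (inv_anti₀ (by positivity) ?_) (by positivity)
  calc u ^ 5 * v ^ 5 * w ^ 4 * z ^ 4 * p ^ 5 * q ^ 5 * b ^ 5 * c ^ 5 * s ^ 5
      = v * (u ^ 5 * v ^ 4 * w ^ 4 * z ^ 4 * p ^ 5 * q ^ 5 * b ^ 5 * c ^ 5 * s ^ 5) := by ring
    _ ≤ (u * p * q) *
        (u ^ 5 * v ^ 4 * w ^ 4 * z ^ 4 * p ^ 5 * q ^ 5 * b ^ 5 * c ^ 5 * s ^ 5) := by gcongr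
    _ = u ^ 6 * v ^ 4 * w ^ 4 * z ^ 4 * p ^ 6 * q ^ 6 * b ^ 5 * c ^ 5 * s ^ 5 := by ring
    _ ≤ u ^ 8 * v ^ 4 * w ^ 4 * z ^ 4 * p ^ 8 * q ^ 8 * b ^ 8 * c ^ 8 * s ^ 8 := by
        gcongr <;> first | assumption | norm_num
    _ = _ := by ring

theorem modulusZero_cofactorTwo_recip_le {u w p q b c s t : ℝ} (hu : 1 ≤ u) (hw : 1 ≤ w)
    (hp : 1 ≤ p) (hq : 1 ≤ q) (hb : 1 ≤ b) (hc : 1 ≤ c) (hs : 1 ≤ s) :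
    t / (w ^ 4 * (u ^ 4 * p ^ 4 * q ^ 4 * b ^ 4 * s ^ 4) * c ^ 4) *
      (t / (u ^ 4 * p ^ 4 * q ^ 4 * c ^ 4 * s ^ 4)) *
      (u ^ 4 * (p ^ 2 * q ^ 2) / (b ^ 2 * c ^ 2)) ≤
      t ^ 2 * (u ^ 4 * w ^ 4 * p ^ 5 * q ^ 5 * b ^ 5 * c ^ 5 * s ^ 5)⁻¹ := by
  calc _ = t ^ 2 * (u ^ 4 * w ^ 4 * p ^ 6 * q ^ 6 * b ^ 6 * c ^ 10 * s ^ 8)⁻¹ := by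
        field_simp
    _ ≤ _ := by
        gcongr <;> first | assumption | norm_num

theorem modulusTwo_cofactorZero_recip_le {u v z p q b c s t : ℝ} (hu : 1 ≤ u) (hv : 1 ≤ v)
    (hz : 1 ≤ z) (hp : 1 ≤ p) (hq : 1 ≤ q) (hb : 1 ≤ b) (hc : 1 ≤ c) (hs : 1 ≤ s)
    (h : v ^ 2 * (b * c) ≤ u ^ 2 * (p * q)) :
    t / (z ^ 4 * (u ^ 4 * p ^ 4 * q ^ 4 * c ^ 4 * s ^ 4) * (v ^ 4 * b ^ 4)) *
      (t / (u ^ 4 * p ^ 4 * q ^ 4 * b ^ 4 * s ^ 4)) ≤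
      t ^ 2 * (u ^ 5 * v ^ 5 * z ^ 4 * p ^ 5 * q ^ 5 * b ^ 5 * c ^ 5 * s ^ 5)⁻¹ := by
  have hvle : v * c ≤ u ^ 2 * (p * q) := by
    refine le_trans ?_ h
    calc v * c = v * (1 * c) := by ring
      _ ≤ v ^ 2 * (b * c) := by
        gcongr
        exact le_self_pow₀ hv (by norm_num)
  rw [div_mul_div_comm, ← sq, div_eq_mul_inv]
  refine mul_le_mul_of_nonneg_left (inv_anti₀ (by positivity) ?_) (by positivity)
  calc u ^ 5 * v ^ 5 * z ^ 4 * p ^ 5 * q ^ 5 * b ^ 5 * c ^ 5 * s ^ 5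
      = (v * c) * (u ^ 5 * v ^ 4 * z ^ 4 * p ^ 5 * q ^ 5 * b ^ 5 * c ^ 4 * s ^ 5) := by ring
    _ ≤ (u ^ 2 * (p * q)) *
        (u ^ 5 * v ^ 4 * z ^ 4 * p ^ 5 * q ^ 5 * b ^ 5 * c ^ 4 * s ^ 5) := by gcongr
    _ = u ^ 7 * v ^ 4 * z ^ 4 * p ^ 6 * q ^ 6 * b ^ 5 * c ^ 4 * s ^ 5 := by ring
    _ ≤ u ^ 8 * v ^ 4 * z ^ 4 * p ^ 8 * q ^ 8 * b ^ 8 * c ^ 4 * s ^ 8 := by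
        gcongr <;> first | assumption | norm_num
    _ = _ := by ring

theorem cofactorZero_cofactorTwo_recip_le {u p q b c s t : ℝ} (hu : 1 ≤ u)
    (hp : 1 ≤ p) (hq : 1 ≤ q) (hb : 1 ≤ b) (hc : 1 ≤ c) (hs : 1 ≤ s) :
    t / (u ^ 4 * p ^ 4 * q ^ 4 * c ^ 4 * s ^ 4) * (t / (u ^ 4 * p ^ 4 * q ^ 4 * b ^ 4 * s ^ 4)) *
      (u ^ 4 * (p ^ 2 * q ^ 2) / (b ^ 2 * c ^ 2)) ≤
      t ^ 2 * (u ^ 4 * p ^ 5 * q ^ 5 * b ^ 5 * c ^ 5 * s ^ 5)⁻¹ := by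
  calc _ = t ^ 2 * (u ^ 4 * p ^ 6 * q ^ 6 * b ^ 6 * c ^ 6 * s ^ 8)⁻¹ := by
        field_simp
    _ ≤ _ := by
        gcongr <;> first | assumption | norm_num

theorem div_mul_div_le_reciprocalWeight {x : Fin 9 → ℕ} (hx : ∀ i, 0 < x i) (hb : IsBalanced x)
    (t : ℝ) :
    t / ((x 2 * cofactorZero x : ℕ) * x 7) * (t / ((x 3 * cofactorTwo x : ℕ) * (x 1 * x 6))) ≤
      t ^ 2 * reciprocalWeight {2, 3} x := by
  obtain ⟨r, hr1, hr, -, hw⟩ := exists_fourthRoots hx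
  have hB := hb.roots_le hr1 hr
  rw [hw, prod_univ_fin_nine]
  simp only [cofactorZero, cofactorTwo, Nat.cast_mul, hr, mem_insert, mem_singleton, Fin.reduceEq,
    or_false, or_true, if_true, if_false]
  exact modulusZero_modulusTwo_recip_le (hr1 _) (hr1 _) (hr1 _) (hr1 _) (hr1 _) (hr1 _) (hr1 _) (hr1 _) (hr1 _) hB

/-- A bound for the number of pairs of multiples of the moduli at `0` and `2` that leave a remainder
divisible by both other moduli. -/
noncomputable def roundedBound (n : ℕ) (x : Fin 9 → ℕ) : ℝ :=
  (if x 2 * cofactorZero x ≤ n then (n : ℝ) / ((x 2 * cofactorZero x : ℕ) * x 7) + 1 else 0) *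
    (if x 3 * cofactorTwo x ≤ n then
      (n : ℝ) / ((x 3 * cofactorTwo x : ℕ) * (x 1 * x 6 : ℕ)) + 1 else 0)

theorem cofactorZero_pos {x : Fin 9 → ℕ} (hx : ∀ i, 0 < x i) : 0 < cofactorZero x := by
  have := hx 0
  have := hx 4
  have := hx 5
  have := hx 6
  have := hx 8
  unfold cofactorZero
  positivity

theorem cofactorTwo_pos {x : Fin 9 → ℕ} (hx : ∀ i, 0 < x i) : 0 < cofactorTwo x := by
  have := hx 0
  have := hx 4
  have := hx 5
  have := hx 7
  have := hx 8
  unfold cofactorTwo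
  positivity

theorem natCast_le_div_of_mul_le {y m n : ℕ} (hm : 0 < m) (h : y * m ≤ n) :
    (y : ℝ) ≤ n / m := by
  rw [le_div_iff₀ (by exact_mod_cast hm)]
  exact_mod_cast h

/-- The variable `x 3` occurs only in the cutoff, so it takes at most `n / cofactorTwo x` values.
Afterwards `x 1` occurs only in the balance condition and takes at most `balancedBound x` values. -/
theorem sum_balanced_div_modulusZero_le (n N : ℕ) :
    ∑ x ∈ tupleBox univ N, (if IsBalanced x ∧ x 3 * cofactorTwo x ≤ n then
        (n : ℝ) / ((x 2 * cofactorZero x : ℕ) * x 7) else 0) ≤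
      ∑ x ∈ tupleBox ((univ.erase 3).erase 1) N, (n : ℝ) ^ 2 * reciprocalWeight {0, 1, 2, 3} x := by
  refine (sum_tupleBox_le_erase (i := 3) (mem_univ _) (G := fun x => if IsBalanced x then
      (n : ℝ) / ((x 2 * cofactorZero x : ℕ) * x 7) * (n / cofactorTwo x) else 0)
      fun x hx => ?_).trans
    (sum_tupleBox_le_erase (i := 1) (by decide) fun x hx => ?_)
  · have hpos := pos_of_mem_tupleBox hx
    simp only [IsBalanced, cofactorZero, cofactorTwo, Function.update_apply, Fin.reduceEq,
      if_true, if_false]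
    by_cases hb : x 1 ^ 2 * (x 6 * x 7) ≤ x 0 ^ 2 * (x 4 * x 5)
    · simp only [hb, true_and, if_true]
      exact sum_ite_const_le (by positivity) (by positivity) N fun y hy =>
        natCast_le_div_of_mul_le (cofactorTwo_pos hpos) hy
    · simp only [hb, false_and, if_false, sum_const_zero, le_refl]
  · have hpos := pos_of_mem_tupleBox hx
    obtain ⟨r, hr1, hr, hone, hw⟩ := exists_fourthRoots hpos
    refine (sum_ite_const_le (P := fun y => IsBalanced (Function.update x 1 y))
      (K := n / ((x 2 * cofactorZero x : ℕ) * x 7) * (n / cofactorTwo x))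
      (Y := balancedBound x) (by positivity) (by unfold balancedBound; positivity) N
      fun y hy => hy.le_balancedBound hpos).trans ?_
    rw [hw, prod_univ_fin_nine, balancedBound_eq hr,
      hone 1 (eq_one_of_mem_tupleBox hx (by decide)), hone 3 (eq_one_of_mem_tupleBox hx (by decide))]
    simp only [cofactorZero, cofactorTwo, Nat.cast_mul, hr, mem_insert, mem_singleton,
      Fin.reduceEq, or_false, or_true, if_true, if_false, one_pow, mul_one]
    exact modulusZero_cofactorTwo_recip_le (hr1 _) (hr1 _) (hr1 _) (hr1 _) (hr1 _) (hr1 _) (hr1 _)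

/-- Here `x 2` occurs only in the cutoff and is summed out; `x 1` is kept, since it occurs in the
summand, and balance controls its exponent. -/
theorem sum_balanced_div_modulusTwo_le (n N : ℕ) :
    ∑ x ∈ tupleBox univ N, (if IsBalanced x ∧ x 2 * cofactorZero x ≤ n then
        (n : ℝ) / ((x 3 * cofactorTwo x : ℕ) * (x 1 * x 6 : ℕ)) else 0) ≤
      ∑ x ∈ tupleBox (univ.erase 2) N, (n : ℝ) ^ 2 * reciprocalWeight {2, 3} x := by
  refine sum_tupleBox_le_erase (i := 2) (mem_univ _) fun x hx => ?_
  have hpos := pos_of_mem_tupleBox hx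
  obtain ⟨r, hr1, hr, hone, hw⟩ := exists_fourthRoots hpos
  by_cases hb : IsBalanced x
  · have hB := hb.roots_le hr1 hr
    refine (sum_ite_const_le (P := fun y => IsBalanced (Function.update x 2 y) ∧
        y * cofactorZero x ≤ n) (K := n / ((x 3 * cofactorTwo x : ℕ) * (x 1 * x 6 : ℕ)))
      (Y := n / cofactorZero x) (by positivity) (by positivity) N fun y hy =>
        natCast_le_div_of_mul_le (cofactorZero_pos hpos) hy.2).trans ?_
    rw [hw, prod_univ_fin_nine, hone 2 (eq_one_of_mem_tupleBox hx (by decide))]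
    simp only [cofactorZero, cofactorTwo, Nat.cast_mul, hr, mem_insert, mem_singleton,
      Fin.reduceEq, or_false, or_true, if_true, if_false, one_pow, mul_one]
    exact modulusTwo_cofactorZero_recip_le (hr1 _) (hr1 _) (hr1 _) (hr1 _) (hr1 _) (hr1 _) (hr1 _) (hr1 _) hB
  · have hb' : ∀ y, ¬ IsBalanced (Function.update x 2 y) := fun y => hb
    simp only [hb', false_and, if_false, sum_const_zero]
    rw [hw]
    exact mul_nonneg (by positivity) (inv_nonneg.2 (prod_nonneg fun i _ =>
      pow_nonneg (zero_le_one.trans (hr1 i)) _))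

theorem sum_balanced_indicator_le (n N : ℕ) :
    ∑ x ∈ tupleBox univ N, (if (IsBalanced x ∧ x 2 * cofactorZero x ≤ n) ∧
        x 3 * cofactorTwo x ≤ n then (1 : ℝ) else 0) ≤
      ∑ x ∈ tupleBox (((univ.erase 3).erase 2).erase 1) N,
        (n : ℝ) ^ 2 * reciprocalWeight {0, 1, 2, 3} x := by
  refine ((sum_tupleBox_le_erase (i := 3) (mem_univ _) (G := fun x =>
      if IsBalanced x ∧ x 2 * cofactorZero x ≤ n then (n / cofactorTwo x : ℝ) else 0)
      fun x hx => ?_).trans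
    (sum_tupleBox_le_erase (i := 2) (by decide) (G := fun x => if IsBalanced x then
      (n / cofactorTwo x * (n / cofactorZero x) : ℝ) else 0) fun x hx => ?_)).trans
    (sum_tupleBox_le_erase (i := 1) (by decide) fun x hx => ?_)
  · have hpos := pos_of_mem_tupleBox hx
    by_cases hb : IsBalanced x ∧ x 2 * cofactorZero x ≤ n
    · rw [if_pos hb, ← one_mul (n / cofactorTwo x : ℝ)]
      exact sum_ite_const_le zero_le_one (by positivity) N fun y hy =>
        natCast_le_div_of_mul_le (cofactorTwo_pos hpos) hy.2
    · rw [if_neg hb]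
      refine (sum_eq_zero fun y _ => if_neg fun h => hb h.1).le
  · have hpos := pos_of_mem_tupleBox hx
    by_cases hb : IsBalanced x
    · rw [if_pos hb]
      exact sum_ite_const_le (P := fun y => IsBalanced (Function.update x 2 y) ∧
        y * cofactorZero x ≤ n) (K := n / cofactorTwo x) (by positivity) (by positivity) N fun y hy =>
        natCast_le_div_of_mul_le (cofactorZero_pos hpos) hy.2
    · rw [if_neg hb]
      refine (sum_eq_zero fun y _ => if_neg fun h => hb h.1).le
  · have hpos := pos_of_mem_tupleBox hx
    obtain ⟨r, hr1, hr, hone, hw⟩ := exists_fourthRoots hpos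
    refine (sum_ite_const_le (P := fun y => IsBalanced (Function.update x 1 y))
      (K := n / cofactorTwo x * (n / cofactorZero x))
      (Y := balancedBound x) (by positivity) (by unfold balancedBound; positivity) N
      fun y hy => hy.le_balancedBound hpos).trans ?_
    rw [hw, prod_univ_fin_nine, balancedBound_eq hr,
      hone 1 (eq_one_of_mem_tupleBox hx (by decide)),
      hone 2 (eq_one_of_mem_tupleBox hx (by decide)), hone 3 (eq_one_of_mem_tupleBox hx (by decide))]
    simp only [cofactorZero, cofactorTwo, Nat.cast_mul, hr, mem_insert, mem_singleton,
      Fin.reduceEq, or_false, or_true, if_true, if_false, one_pow, mul_one]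
    exact cofactorZero_cofactorTwo_recip_le (hr1 _) (hr1 _) (hr1 _) (hr1 _) (hr1 _) (hr1 _)

/-- Expanding the product of the two rounded counts gives four sums. In each, at most two variables
of exponent exactly `1` remain, hence at most two logarithms. -/
theorem sum_roundedBound_le :
    ∃ C : ℝ, 0 ≤ C ∧ ∀ n N : ℕ, 1 ≤ N →
      ∑ x ∈ (tupleBox univ N).filter IsBalanced, roundedBound n x ≤
        C * (n : ℝ) ^ 2 * (1 + Real.log N) ^ 2 := by
  obtain ⟨C, hC, h⟩ := sum_reciprocalWeight_le
  refine ⟨4 * C, by positivity, fun n N hN => ?_⟩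
  have hbound (𝒲 S : Finset (Fin 9)) (hcard : (𝒲 ∩ S).card ≤ 2) :
      ∑ x ∈ tupleBox 𝒲 N, (n : ℝ) ^ 2 * reciprocalWeight S x ≤
        (n : ℝ) ^ 2 * (C * (1 + Real.log N) ^ 2) := by
    rw [← mul_sum]
    exact mul_le_mul_of_nonneg_left (h 𝒲 S N hcard hN) (by positivity)
  have hrw (S : Finset (Fin 9)) (x : Fin 9 → ℕ) : 0 ≤ reciprocalWeight S x :=
    prod_nonneg fun i _ => Real.rpow_nonneg (Nat.cast_nonneg _) _
  rw [sum_filter]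
  calc _ ≤ ∑ x ∈ tupleBox univ N, ((n : ℝ) ^ 2 * reciprocalWeight {2, 3} x +
        (if IsBalanced x ∧ x 3 * cofactorTwo x ≤ n then
          (n : ℝ) / ((x 2 * cofactorZero x : ℕ) * x 7) else 0) +
        (if IsBalanced x ∧ x 2 * cofactorZero x ≤ n then
          (n : ℝ) / ((x 3 * cofactorTwo x : ℕ) * (x 1 * x 6 : ℕ)) else 0) +
        (if (IsBalanced x ∧ x 2 * cofactorZero x ≤ n) ∧
          x 3 * cofactorTwo x ≤ n then (1 : ℝ) else 0)) := by
        refine sum_le_sum fun x hx => ?_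
        have hrx := hrw {2, 3} x
        by_cases hb : IsBalanced x
        · have h1 := div_mul_div_le_reciprocalWeight (pos_of_mem_tupleBox hx) hb n
          have hX : 0 ≤ (n : ℝ) / ((x 2 * cofactorZero x : ℕ) * x 7) := by positivity
          have hY : 0 ≤ (n : ℝ) / ((x 3 * cofactorTwo x : ℕ) * (x 1 * x 6 : ℕ)) := by positivity
          have h0 : 0 ≤ (n : ℝ) ^ 2 * reciprocalWeight {2, 3} x := by positivity
          rw [← Nat.cast_mul (x 1)] at h1
          simp only [hb, true_and, if_true, roundedBound]
          generalize (n : ℝ) / ((x 2 * cofactorZero x : ℕ) * x 7) = X at *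
          generalize (n : ℝ) / ((x 3 * cofactorTwo x : ℕ) * (x 1 * x 6 : ℕ)) = Y at *
          by_cases ha : x 2 * cofactorZero x ≤ n <;> by_cases hc : x 3 * cofactorTwo x ≤ n <;>
            simp only [ha, hc, if_true, if_false, and_true, and_false] <;> nlinarith
        · simp only [hb, false_and, if_false, add_zero]
          positivity
    _ ≤ (n : ℝ) ^ 2 * (C * (1 + Real.log N) ^ 2) + (n : ℝ) ^ 2 * (C * (1 + Real.log N) ^ 2) +
        (n : ℝ) ^ 2 * (C * (1 + Real.log N) ^ 2) + (n : ℝ) ^ 2 * (C * (1 + Real.log N) ^ 2) := by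
        simp only [sum_add_distrib]
        refine add_le_add (add_le_add (add_le_add (hbound _ _ (by decide)) ?_) ?_) ?_
        · exact (sum_balanced_div_modulusZero_le n N).trans (hbound _ _ (by decide))
        · exact (sum_balanced_div_modulusTwo_le n N).trans (hbound _ _ (by decide))
        · exact (sum_balanced_indicator_le n N).trans (hbound _ _ (by decide))
    _ = _ := by ring

end NineVariables

/-! ### The action of permutations of the parts on patterns. -/

section RelabelledPatterns

open Finset

variable {k : ℕ}

/-- The family obtained by relabelling the parts. -/
def relabel (ρ : Equiv.Perm (Fin k)) (U : Finset (Fin k) → ℕ) : Finset (Fin k) → ℕ :=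
  U ∘ ρ.finsetCongr

theorem patternModulus_relabel (ρ : Equiv.Perm (Fin k)) (U : Finset (Fin k) → ℕ) :
    patternModulus (relabel ρ U) = patternModulus U ∘ ρ := by
  ext i
  unfold patternModulus relabel
  simp only [Function.comp_apply, prod_filter]
  rw [← Equiv.prod_comp ρ.finsetCongr (fun V => if ρ i ∈ V then U V else 1)]
  refine prod_congr rfl fun V _ => ?_
  simp

theorem latticeErr_relabel (ρ : Equiv.Perm (Fin k)) (U : Finset (Fin k) → ℕ) (n : ℕ) :
    latticeErr (patternModulus (relabel ρ U)) n = latticeErr (patternModulus U) n := by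
  rw [patternModulus_relabel, latticeErr_comp_perm]

theorem relabel_relabel {ρ : Equiv.Perm (Fin k)} (hρ : ∀ i, ρ (ρ i) = i)
    (U : Finset (Fin k) → ℕ) : relabel ρ (relabel ρ U) = U := by
  ext V
  unfold relabel
  simp only [Function.comp_apply]
  congr 1
  ext i
  simp only [Equiv.finsetCongr_apply, Finset.mem_map_equiv]
  have h : ∀ i, ρ.symm i = ρ i := fun i => by rw [Equiv.symm_apply_eq, hρ]
  rw [h, h, hρ]

theorem relabel_mem {ρ : Equiv.Perm (Fin k)} {𝒲 : Finset (Finset (Fin k))}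
    (hρ : ∀ V, ρ.finsetCongr V ∈ 𝒲 ↔ V ∈ 𝒲) {N : ℕ} {U : Finset (Fin k) → ℕ}
    (hU : U ∈ (patternBox 𝒲 N).filter fun U => Squarefree (∏ V, U V)) :
    relabel ρ U ∈ (patternBox 𝒲 N).filter fun U => Squarefree (∏ V, U V) := by
  rw [mem_filter] at hU ⊢
  refine ⟨Fintype.mem_piFinset.2 fun V => ?_, ?_⟩
  · have := Fintype.mem_piFinset.1 hU.1 (ρ.finsetCongr V)
    simp only [hρ] at this
    exact this
  · have : ∏ V, relabel ρ U V = ∏ V, U V := Equiv.prod_comp ρ.finsetCongr U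
    rw [this]
    exact hU.2

end RelabelledPatterns

/-! ### The case `k = 4`, `s = 2`. -/

section TwoAndTwo

open Finset

/-- The index sets that meet both `{0, 1}` and `{2, 3}`. -/
def fourPattern : Fin 9 → Finset (Fin 4) :=
  ![{0, 2}, {1, 3}, {0, 3}, {1, 2}, {0, 1, 2}, {0, 2, 3}, {0, 1, 3}, {1, 2, 3}, {0, 1, 2, 3}]

theorem crossingSets_four : crossingSets 4 2 = univ.image fourPattern := by decide

theorem fourPattern_injective : Function.Injective fourPattern := by decide

variable {N : ℕ} {U : Finset (Fin 4) → ℕ}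

theorem patternModulus_four (hU : U ∈ patternBox (crossingSets 4 2) N) (i : Fin 4) :
    patternModulus U i = ∏ j, if i ∈ fourPattern j then U (fourPattern j) else 1 := by
  unfold patternModulus
  rw [prod_filter, ← prod_subset (subset_univ (crossingSets 4 2)) fun V _ hV => by
    rw [eq_one_of_mem_patternBox hU hV, ite_self], crossingSets_four,
    prod_image fourPattern_injective.injOn]

theorem patternModulus_four_zero (hU : U ∈ patternBox (crossingSets 4 2) N) :
    patternModulus U 0 = (U ∘ fourPattern) 2 * cofactorZero (U ∘ fourPattern) := by
  rw [patternModulus_four hU, prod_univ_fin_nine, if_pos (by decide), if_neg (by decide),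
    if_pos (by decide), if_neg (by decide), if_pos (by decide), if_pos (by decide),
    if_pos (by decide), if_neg (by decide), if_pos (by decide)]
  simp only [cofactorZero, Function.comp_apply]
  ring

theorem patternModulus_four_one (hU : U ∈ patternBox (crossingSets 4 2) N) :
    patternModulus U 1 = (U ∘ fourPattern) 7 * ((U ∘ fourPattern) 1 * (U ∘ fourPattern) 6) *
      ((U ∘ fourPattern) 3 * (U ∘ fourPattern) 4 * (U ∘ fourPattern) 8) := by
  rw [patternModulus_four hU, prod_univ_fin_nine, if_neg (by decide), if_pos (by decide),
    if_neg (by decide), if_pos (by decide), if_pos (by decide), if_neg (by decide),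
    if_pos (by decide), if_pos (by decide), if_pos (by decide)]
  simp only [Function.comp_apply]
  ring

theorem patternModulus_four_two (hU : U ∈ patternBox (crossingSets 4 2) N) :
    patternModulus U 2 = (U ∘ fourPattern) 3 * cofactorTwo (U ∘ fourPattern) := by
  rw [patternModulus_four hU, prod_univ_fin_nine, if_pos (by decide), if_neg (by decide),
    if_neg (by decide), if_pos (by decide), if_pos (by decide), if_pos (by decide),
    if_neg (by decide), if_pos (by decide), if_pos (by decide)]
  simp only [cofactorTwo, Function.comp_apply]
  ring

theorem patternModulus_four_three (hU : U ∈ patternBox (crossingSets 4 2) N) :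
    patternModulus U 3 = (U ∘ fourPattern) 7 * ((U ∘ fourPattern) 1 * (U ∘ fourPattern) 6) *
      ((U ∘ fourPattern) 2 * (U ∘ fourPattern) 5 * (U ∘ fourPattern) 8) := by
  rw [patternModulus_four hU, prod_univ_fin_nine, if_neg (by decide), if_pos (by decide),
    if_pos (by decide), if_neg (by decide), if_neg (by decide), if_pos (by decide),
    if_pos (by decide), if_pos (by decide), if_pos (by decide)]
  simp only [Function.comp_apply]
  ring

/-- For fixed `S` the term is proportional to the omitted modulus. -/
theorem gcdTerm_le_of_le {k : ℕ} {e : Fin k → ℕ} (he : ∀ i, 0 < e i) {u v : Fin k}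
    (huv : e u ≤ e v) (S : Finset (Fin k)) : gcdTerm e u S ≤ gcdTerm e v S := by
  have h (w : Fin k) : gcdTerm e w S = (S.gcd e : ℕ) / (∏ i, (e i : ℝ)) * e w := by
    have hw : (e w : ℝ) ≠ 0 := by exact_mod_cast (he w).ne'
    unfold gcdTerm
    rw [← mul_prod_erase univ (fun i => (e i : ℝ)) (mem_univ w)]
    field_simp
  rw [h, h]
  gcongr

/-- The mean of the weights at `0` and `2`. -/
noncomputable def meanWeight (V : Finset (Fin 4)) : ℝ :=
  (gcdWeight 0 {1, 3} V + gcdWeight 2 {1, 3} V) / 2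

/-- The term at `2` is at most its geometric mean with the term at `0`. On its own it has weight `1`
at four sets, `{0,2}`, `{1,2}`, `{1,3}` and `{1,2,3}`; in the mean only `{0,2}` and `{1,3}` keep
weight `1`. -/
theorem gcdTerm_two_le (hsq : Squarefree (∏ V, U V))
    (h : patternModulus U 2 ≤ patternModulus U 0) :
    gcdTerm (patternModulus U) 2 {1, 3} ≤ ∏ V, (U V : ℝ) ^ (-meanWeight V) := by
  have hpos : ∀ V, 0 < U V := pos_of_squarefree_prod hsq
  have hle := gcdTerm_le_of_le (patternModulus_pos hpos) h {1, 3}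
  have h0 := gcdTerm_nonneg (patternModulus U) 2 {1, 3}
  refine le_of_sq_le_sq ?_ (prod_nonneg fun V _ => Real.rpow_nonneg (Nat.cast_nonneg _) _)
  calc gcdTerm (patternModulus U) 2 {1, 3} ^ 2
      ≤ gcdTerm (patternModulus U) 0 {1, 3} * gcdTerm (patternModulus U) 2 {1, 3} := by
        rw [sq]
        gcongr
    _ = _ := by
        rw [gcdTerm_patternModulus hsq _ ⟨1, by decide⟩, gcdTerm_patternModulus hsq _ ⟨1, by decide⟩,
          ← prod_mul_distrib, ← prod_pow]
        refine prod_congr rfl fun V _ => ?_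
        have hV : (0 : ℝ) < U V := by exact_mod_cast hpos V
        rw [← Real.rpow_add hV, ← Real.rpow_natCast, ← Real.rpow_mul hV.le, meanWeight]
        congr 1
        push_cast
        ring

theorem meanWeight_eq (V : Finset (Fin 4)) : meanWeight V =
    (((V.erase 0).card + (V.erase 2).card : ℕ) - (if {1, 3} ⊆ V then 2 else 0 : ℕ) : ℝ) / 2 := by
  unfold meanWeight gcdWeight
  push_cast
  split_ifs <;> ring

theorem one_le_meanWeight {V : Finset (Fin 4)} (hV : V ∈ crossingSets 4 2) : 1 ≤ meanWeight V := by
  have h : ∀ V ∈ crossingSets 4 2,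
      2 + (if {1, 3} ⊆ V then 2 else 0) ≤ (V.erase 0).card + (V.erase 2).card := by decide
  have h1 : ((2 + (if {1, 3} ⊆ V then 2 else 0) : ℕ) : ℝ) ≤
    ((V.erase 0).card + (V.erase 2).card : ℕ) := by exact_mod_cast h V hV
  rw [Nat.cast_add] at h1
  rw [meanWeight_eq]
  push_cast at h1 ⊢
  linarith

theorem card_meanWeight_lt : ((crossingSets 4 2).filter fun V => meanWeight V < 3 / 2).card ≤ 2 := by
  have h : ∀ V ∈ crossingSets 4 2, V ∉ ({{0, 2}, {1, 3}} : Finset (Finset (Fin 4))) →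
      3 + (if {1, 3} ⊆ V then 2 else 0) ≤ (V.erase 0).card + (V.erase 2).card := by decide
  refine (card_le_card fun V hV => ?_).trans
    (card_le_two (a := ({0, 2} : Finset (Fin 4))) (b := {1, 3}))
  rw [mem_filter] at hV
  by_contra hn
  have h1 : ((3 + (if {1, 3} ⊆ V then 2 else 0) : ℕ) : ℝ) ≤
    ((V.erase 0).card + (V.erase 2).card : ℕ) := by exact_mod_cast h V hV.1 hn
  rw [Nat.cast_add] at h1
  have h2 := hV.2
  rw [meanWeight_eq] at h2
  push_cast at h1 h2
  linarith

/-- The parts are taken in the order `0, 2, 1, 3`, so the final two come from different groups. The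
divisors passed to `latticeErr_four_le` are the factors belonging to `{1,2,3}`, and to `{1,3}` and
`{0,1,3}`: the sets containing all later parts and not the current one. -/
theorem latticeErr_four_two_le (hU : U ∈ patternBox (crossingSets 4 2) N)
    (hsq : Squarefree (∏ V, U V)) (h : patternModulus U 2 ≤ patternModulus U 0) (n : ℕ) :
    latticeErr (patternModulus U) n ≤
      (n : ℝ) ^ 2 * ∏ V, (U V : ℝ) ^ (-gcdWeight 0 {1, 2, 3} V) +
        (n : ℝ) ^ 2 * ∏ V, (U V : ℝ) ^ (-meanWeight V) + roundedBound n (U ∘ fourPattern) := by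
  have hpos : ∀ V, 0 < U V := pos_of_squarefree_prod hsq
  have hx : ∀ i, 0 < (U ∘ fourPattern) i := fun i => hpos _
  have hcop : ∀ i j, i ≠ j → Nat.Coprime ((U ∘ fourPattern) i) ((U ∘ fourPattern) j) :=
    fun i j hij => coprime_of_squarefree_prod hsq (fourPattern_injective.ne hij)
  have m0 : (patternModulus U ∘ Equiv.swap 1 2) 0 = _ := patternModulus_four_zero hU
  have m1 : (patternModulus U ∘ Equiv.swap 1 2) 1 = _ := patternModulus_four_two hU
  have m2 : (patternModulus U ∘ Equiv.swap 1 2) 2 = _ := patternModulus_four_one hU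
  have m3 : (patternModulus U ∘ Equiv.swap 1 2) 3 = _ := patternModulus_four_three hU
  have t0 : gcdTerm (patternModulus U ∘ Equiv.swap 1 2) 0 (Ioi 0) =
      ∏ V, (U V : ℝ) ^ (-gcdWeight 0 {1, 2, 3} V) := by
    rw [gcdTerm_comp_perm, show Equiv.swap (1 : Fin 4) 2 0 = 0 by decide,
      show (Ioi (0 : Fin 4)).image (Equiv.swap 1 2) = {1, 2, 3} by decide,
      gcdTerm_patternModulus hsq _ ⟨1, by decide⟩]
  have t1 : gcdTerm (patternModulus U ∘ Equiv.swap 1 2) 1 (Ioi 1) ≤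
      ∏ V, (U V : ℝ) ^ (-meanWeight V) := by
    rw [gcdTerm_comp_perm, show Equiv.swap (1 : Fin 4) 2 1 = 2 by decide,
      show (Ioi (1 : Fin 4)).image (Equiv.swap 1 2) = {1, 3} by decide]
    exact gcdTerm_two_le hsq h
  rw [← latticeErr_comp_perm _ n (Equiv.swap 1 2)]
  have key := latticeErr_four_le (patternModulus U ∘ Equiv.swap 1 2)
    (fun i => patternModulus_pos hpos _) n (hx 7) (Nat.mul_pos (hx 1) (hx 6))
    (m1 ▸ (Dvd.dvd.mul_right (Dvd.intro_left _ rfl) _).mul_left _)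
    (m2 ▸ Dvd.dvd.mul_right (Dvd.intro _ rfl) _)
    (m3 ▸ Dvd.dvd.mul_right (Dvd.intro _ rfl) _)
    (m2 ▸ Dvd.dvd.mul_right (Dvd.intro_left _ rfl) _)
    (m3 ▸ Dvd.dvd.mul_right (Dvd.intro_left _ rfl) _)
    (by
      rw [m0, cofactorZero]
      simp only [Nat.coprime_mul_iff_left]
      refine ⟨?_, ⟨⟨⟨?_, ?_⟩, ?_⟩, ?_⟩, ?_⟩ <;> exact hcop _ _ (by decide))
    (by
      rw [m1, cofactorTwo]
      simp only [Nat.coprime_mul_iff_left, Nat.coprime_mul_iff_right]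
      refine ⟨⟨?_, ⟨⟨⟨?_, ?_⟩, ?_⟩, ?_⟩, ?_⟩, ⟨?_, ⟨⟨⟨?_, ?_⟩, ?_⟩, ?_⟩, ?_⟩⟩ <;>
        exact hcop _ _ (by decide))
  rw [m0, m1, t0] at key
  refine key.trans (add_le_add (add_le_add le_rfl ?_) le_rfl)
  exact mul_le_mul_of_nonneg_left t1 (by positivity)

theorem sum_latticeErr_four_two_le :
    ∃ C : ℝ, 0 ≤ C ∧ ∀ n N : ℕ, 1 ≤ N →
      ∑ U ∈ (patternBox (crossingSets 4 2) N).filter (fun U => Squarefree (∏ V, U V)),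
        latticeErr (patternModulus U) n ≤ C * (n : ℝ) ^ 2 * (1 + Real.log N) ^ 2 := by
  obtain ⟨C₁, hC₁, h₁⟩ := sum_box_prod_rpow_le (crossingSets 4 2) (a := 2) (by norm_num)
  obtain ⟨C₂, hC₂, h₂⟩ := sum_box_prod_rpow_le (crossingSets 4 2) (a := 3 / 2) (by norm_num)
  obtain ⟨C₃, hC₃, h₃⟩ := sum_roundedBound_le
  refine ⟨4 * (C₁ + C₂ + C₃), by positivity, fun n N hN => ?_⟩
  set A := (patternBox (crossingSets 4 2) N).filter fun U => Squarefree (∏ V, U V) with hA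
  -- `σ` exchanges the two sides of the balance inequality; `τ` preserves balance and exchanges the
  -- moduli at `0` and `2`. Each reduction costs a factor `2`, whence the `4` in the constant.
  set σ : Equiv.Perm (Fin 4) := Equiv.swap 0 1 * Equiv.swap 2 3 with hσ
  set τ : Equiv.Perm (Fin 4) := Equiv.swap 0 2 * Equiv.swap 1 3 with hτ
  have hσbal (U : Finset (Fin 4) → ℕ) :
      IsBalanced (U ∘ fourPattern) ∨ IsBalanced (relabel σ U ∘ fourPattern) := by
    have hcomp : relabel σ U ∘ fourPattern =
        (U ∘ fourPattern) ∘ (![1, 0, 3, 2, 6, 7, 4, 5, 8] : Fin 9 → Fin 9) := by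
      have : ∀ j, σ.finsetCongr (fourPattern j) =
        fourPattern ((![1, 0, 3, 2, 6, 7, 4, 5, 8] : Fin 9 → Fin 9) j) := by decide
      ext j
      exact congrArg U (this j)
    rw [hcomp]
    exact le_total _ _
  have hτbal (U : Finset (Fin 4) → ℕ) (hU : IsBalanced (U ∘ fourPattern)) :
      IsBalanced (relabel τ U ∘ fourPattern) := by
    have hcomp : relabel τ U ∘ fourPattern =
        (U ∘ fourPattern) ∘ (![0, 1, 3, 2, 5, 4, 7, 6, 8] : Fin 9 → Fin 9) := by
      have : ∀ j, τ.finsetCongr (fourPattern j) =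
        fourPattern ((![0, 1, 3, 2, 5, 4, 7, 6, 8] : Fin 9 → Fin 9) j) := by decide
      ext j
      exact congrArg U (this j)
    rw [hcomp]
    generalize U ∘ fourPattern = x at hU
    change x 1 ^ 2 * (x 7 * x 6) ≤ x 0 ^ 2 * (x 5 * x 4)
    rw [mul_comm (x 7), mul_comm (x 5)]
    exact hU
  have hfirst := sum_le_two_mul_sum_filter (A := A) (f := fun U => latticeErr (patternModulus U) n)
    (g := relabel σ) (P := fun U => IsBalanced (U ∘ fourPattern)) (fun U _ => latticeErr_nonneg _ _)
    (fun U hU => relabel_mem (by decide) hU) (fun U _ => relabel_relabel (by decide) U)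
    (fun U _ => latticeErr_relabel σ U n) (fun U _ => hσbal U)
  have hsecond := sum_le_two_mul_sum_filter
    (A := A.filter fun U => IsBalanced (U ∘ fourPattern))
    (f := fun U => latticeErr (patternModulus U) n)
    (g := relabel τ) (P := fun U => patternModulus U 2 ≤ patternModulus U 0)
    (fun U _ => latticeErr_nonneg _ _)
    (fun U hU => mem_filter.2 ⟨relabel_mem (by decide) (mem_filter.1 hU).1,
      hτbal U (mem_filter.1 hU).2⟩)
    (fun U _ => relabel_relabel (by decide) U)
    (fun U _ => latticeErr_relabel τ U n)
    (fun U _ => by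
      rw [patternModulus_relabel]
      exact le_total _ _)
  have hnn (w : Finset (Fin 4) → ℝ) (U : Finset (Fin 4) → ℕ) :
      0 ≤ ∏ V, (U V : ℝ) ^ (-w V) :=
    prod_nonneg fun V _ => Real.rpow_nonneg (Nat.cast_nonneg _) _
  have hrb (x : Fin 9 → ℕ) : 0 ≤ roundedBound n x := by
    unfold roundedBound
    refine mul_nonneg ?_ ?_ <;> split_ifs <;> positivity
  -- A pattern in the box is determined by its nine entries at crossing sets.
  have hbox : ∑ U ∈ (patternBox (crossingSets 4 2) N).filter
        (fun U => IsBalanced (U ∘ fourPattern)), roundedBound n (U ∘ fourPattern) ≤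
      ∑ x ∈ (tupleBox univ N).filter IsBalanced, roundedBound n x := by
    rw [← sum_image (f := roundedBound n) (g := fun U => U ∘ fourPattern)]
    · refine sum_le_sum_of_subset_of_nonneg (fun x hx => ?_) fun x _ _ => hrb x
      obtain ⟨U, hU, rfl⟩ := mem_image.1 hx
      rw [mem_filter] at hU ⊢
      refine ⟨Fintype.mem_piFinset.2 fun i => ?_, hU.2⟩
      have := Fintype.mem_piFinset.1 hU.1 (fourPattern i)
      rw [crossingSets_four, if_pos (mem_image_of_mem _ (mem_univ i))] at this
      rw [if_pos (mem_univ i)]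
      exact this
    · intro U hU U' hU' heq
      ext V
      by_cases hV : V ∈ crossingSets 4 2
      · rw [crossingSets_four] at hV
        obtain ⟨i, -, rfl⟩ := mem_image.1 hV
        exact congrFun heq i
      · rw [eq_one_of_mem_patternBox (mem_filter.1 hU).1 hV,
          eq_one_of_mem_patternBox (mem_filter.1 hU').1 hV]
  have hgood : ∑ U ∈ (A.filter fun U => IsBalanced (U ∘ fourPattern)).filter
        (fun U => patternModulus U 2 ≤ patternModulus U 0), latticeErr (patternModulus U) n ≤
      (C₁ + C₂ + C₃) * (n : ℝ) ^ 2 * (1 + Real.log N) ^ 2 := by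
    calc _ ≤ ∑ U ∈ (A.filter fun U => IsBalanced (U ∘ fourPattern)).filter
          (fun U => patternModulus U 2 ≤ patternModulus U 0),
          ((n : ℝ) ^ 2 * ∏ V, (U V : ℝ) ^ (-gcdWeight 0 {1, 2, 3} V) +
            (n : ℝ) ^ 2 * ∏ V, (U V : ℝ) ^ (-meanWeight V) + roundedBound n (U ∘ fourPattern)) := by
          refine sum_le_sum fun U hU => ?_
          rw [mem_filter, mem_filter, hA, mem_filter] at hU
          exact latticeErr_four_two_le hU.1.1.1 hU.1.1.2 hU.2 n
      _ ≤ ∑ U ∈ (patternBox (crossingSets 4 2) N).filter (fun U => IsBalanced (U ∘ fourPattern)),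
          ((n : ℝ) ^ 2 * ∏ V, (U V : ℝ) ^ (-gcdWeight 0 {1, 2, 3} V) +
            (n : ℝ) ^ 2 * ∏ V, (U V : ℝ) ^ (-meanWeight V) + roundedBound n (U ∘ fourPattern)) := by
          refine sum_le_sum_of_subset_of_nonneg ((filter_subset _ _).trans
            (filter_subset_filter _ (filter_subset _ _))) fun U _ _ => ?_
          have := hnn (gcdWeight 0 {1, 2, 3}) U
          have := hnn meanWeight U
          have := hrb (U ∘ fourPattern)
          positivity
      _ ≤ (n : ℝ) ^ 2 * (C₁ * (1 + Real.log N) ^ 2) + (n : ℝ) ^ 2 * (C₂ * (1 + Real.log N) ^ 2) +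
          C₃ * (n : ℝ) ^ 2 * (1 + Real.log N) ^ 2 := by
          rw [sum_add_distrib, sum_add_distrib, ← mul_sum, ← mul_sum]
          refine add_le_add (add_le_add ?_ ?_) (hbox.trans (h₃ n N hN))
          · refine mul_le_mul_of_nonneg_left ((sum_le_sum_of_subset_of_nonneg (filter_subset _ _)
              fun U _ _ => hnn _ U).trans ?_) (by positivity)
            obtain ⟨hw1, hw2⟩ := gcdWeight_of_crossing (k := 4) (s := 2) (by norm_num) (v := 0)
              (S := {1, 2, 3}) (by decide)
            exact h₁ _ 2 hw1 hw2 N hN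
          · refine mul_le_mul_of_nonneg_left ((sum_le_sum_of_subset_of_nonneg (filter_subset _ _)
              fun U _ _ => hnn _ U).trans ?_) (by positivity)
            exact h₂ _ 2 (fun V hV => one_le_meanWeight hV) card_meanWeight_lt N hN
      _ = _ := by ring
  linarith

end TwoAndTwo

/-! ### Exchange of the two groups and assembly of the cases. -/

section ErrorBound

open Finset

/-- Reversing the order of the parts exchanges the two groups. -/
theorem coprimeCompositions_sub {k s : ℕ} (hs : s ≤ k) (n : ℕ) :
    coprimeCompositions k (k - s) n = coprimeCompositions k s n := by
  have hprod (P : Fin k → Prop) [DecidablePred P] (x : Fin k → ℕ) :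
      ∏ i with P i, (x ∘ Fin.rev) i = ∏ i with P (Fin.rev i), x i := by
    rw [prod_filter, prod_filter, ← Equiv.prod_comp Fin.revPerm]
    refine prod_congr rfl fun i _ => ?_
    simp
  have hlt (x : Fin k → ℕ) : ∏ i : Fin k with i.val < s, (x ∘ Fin.rev) i =
      ∏ i : Fin k with k - s ≤ i.val, x i := by
    rw [hprod]
    congr 1
    ext i
    simp only [mem_filter, mem_univ, true_and, Fin.val_rev]
    omega
  have hge (x : Fin k → ℕ) : ∏ i : Fin k with s ≤ i.val, (x ∘ Fin.rev) i =
      ∏ i : Fin k with i.val < k - s, x i := by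
    rw [hprod]
    congr 1
    ext i
    simp only [mem_filter, mem_univ, true_and, Fin.val_rev]
    omega
  have hrr (x : Fin k → ℕ) : (x ∘ Fin.rev) ∘ Fin.rev = x := by
    ext i
    simp
  have hmem (x : Fin k → ℕ) (hx : x ∈ (univ.piAntidiag n : Finset (Fin k → ℕ))) :
      x ∘ Fin.rev ∈ (univ.piAntidiag n : Finset (Fin k → ℕ)) := by
    rw [mem_piAntidiag] at hx ⊢
    refine ⟨?_, by simp⟩
    rw [← hx.1]
    exact Equiv.sum_comp Fin.revPerm x
  unfold coprimeCompositions
  refine card_nbij' (fun x => x ∘ Fin.rev) (fun x => x ∘ Fin.rev) ?_ ?_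
    (fun x _ => hrr x) (fun x _ => hrr x)
  · intro x hx
    simp only [coe_filter, Set.mem_ofPred_eq] at hx ⊢
    exact ⟨hmem x hx.1, fun i => hx.2.1 _, by rw [hlt, hge, Nat.gcd_comm]; exact hx.2.2⟩
  · intro x hx
    simp only [coe_filter, Set.mem_ofPred_eq] at hx ⊢
    refine ⟨hmem x hx.1, fun i => hx.2.1 _, ?_⟩
    rw [← hlt, ← hge, hrr, Nat.gcd_comm]
    exact hx.2.2

theorem polyF_sub {k s : ℕ} (hs : s ≤ k) (x : ℝ) : polyF k (k - s) x = polyF k s x := by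
  unfold polyF
  rw [Nat.sub_sub_self hs]
  ring

theorem errorTerm_sub {k s : ℕ} (hs : s ≤ k) (n : ℕ) : errorTerm k (k - s) n = errorTerm k s n := by
  unfold errorTerm constC arithF eulerFactor
  simp only [polyF_sub hs, coprimeCompositions_sub hs]

/-- A bound for the sum of lattice errors yields a bound for the error term. -/
theorem abs_errorTerm_le_of_sum_le {k s m : ℕ} (hk : 3 ≤ k) (hs : 1 ≤ s) (hsk : s ≤ k - 1)
    (c : ℕ → ℕ → Finset (Fin k) → ℝ) (𝒲 : Finset (Finset (Fin k)))
    (hc1 : ∀ n p V, |c n p V| ≤ 1) (hc0 : ∀ n p V, V ∉ 𝒲 → c n p V = 0)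
    (hc : ∀ n p, p.Prime → ∀ x : Fin k → ℕ, ∑ i, x i = n →
      (∑ V, if ∀ i ∈ V, p ∣ x i then c n p V else 0) =
        if p ∣ Nat.gcd (∏ i : Fin k with i.val < s, x i) (∏ i : Fin k with s ≤ i.val, x i)
          then 1 else 0)
    (hlam : ∀ n p, p.Prime → ∑ V, c n p V * localDensity k n p V = localDefect k s n p)
    (hsum : ∃ C : ℝ, 0 ≤ C ∧ ∀ n N : ℕ, 1 ≤ n → 1 ≤ N →
      ∑ U ∈ (patternBox 𝒲 N).filter (fun U => Squarefree (∏ V, U V)),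
        latticeErr (patternModulus U) n ≤ C * (n : ℝ) ^ (k - 2) * (1 + Real.log N) ^ m) :
    ∃ C : ℝ, 0 ≤ C ∧ ∀ n : ℕ, 1 ≤ n →
      |errorTerm k s n| ≤ C * (n : ℝ) ^ (k - 2) * (1 + Real.log n) ^ m := by
  obtain ⟨C₁, hC₁, h₁⟩ := abs_errorTerm_le hk hs hsk
  obtain ⟨C₂, hC₂, h₂⟩ := hsum
  -- The factor `1 + 4k` comes from `log n^(4k) = 4k log n`.
  refine ⟨C₂ * (1 + 4 * k) ^ m + C₁, by positivity, fun n hn => ?_⟩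
  have hn1 : (1 : ℝ) ≤ n := by exact_mod_cast hn
  have hlog : 0 ≤ Real.log n := Real.log_nonneg hn1
  have hlogN : 1 + Real.log ((n ^ (4 * k) : ℕ) : ℝ) ≤ (1 + 4 * k) * (1 + Real.log n) := by
    push_cast
    rw [Real.log_pow]
    push_cast
    have : (0 : ℝ) ≤ k := Nat.cast_nonneg _
    nlinarith
  have hlogN0 : 0 ≤ 1 + Real.log ((n ^ (4 * k) : ℕ) : ℝ) := by
    push_cast
    rw [Real.log_pow]
    positivity
  have hone : 1 ≤ (n : ℝ) ^ (k - 2) * (1 + Real.log n) ^ m :=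
    one_le_mul_of_one_le_of_one_le (one_le_pow₀ hn1) (one_le_pow₀ (by linarith))
  calc |errorTerm k s n| ≤ C₂ * (n : ℝ) ^ (k - 2) *
        (1 + Real.log ((n ^ (4 * k) : ℕ) : ℝ)) ^ m + C₁ :=
        (h₁ n hn (c n) 𝒲 (hc1 n) (hc0 n) (hc n) (hlam n)).trans
          (add_le_add_left (h₂ n _ hn (Nat.one_le_pow _ _ hn)) _)
    _ ≤ C₂ * (n : ℝ) ^ (k - 2) * ((1 + 4 * k) * (1 + Real.log n)) ^ m +
        C₁ * ((n : ℝ) ^ (k - 2) * (1 + Real.log n) ^ m) := by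
        gcongr
        exact le_mul_of_one_le_right hC₁ hone
    _ = _ := by
        rw [mul_pow]
        ring

theorem abs_errorTerm_le_of_le_sub {k s : ℕ} (hk : 3 ≤ k) (hs : 1 ≤ s) (h : s ≤ k - s) :
    ∃ C : ℝ, 0 ≤ C ∧ ∀ n : ℕ, 1 ≤ n →
      |errorTerm k s n| ≤ C * (n : ℝ) ^ (k - 2) * (1 + Real.log n) ^ max s (k - s) := by
  have hsk : s ≤ k - 1 := by omega
  have hcross (hsum) := abs_errorTerm_le_of_sum_le (m := max s (k - s)) hk hs hsk
    (fun _ _ => crossingCoeff k s) (crossingSets k s) (fun _ _ => abs_crossingCoeff_le k s)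
    (fun _ _ V hV => by unfold crossingCoeff; exact if_neg hV)
    (fun _ _ hp x _ => sum_crossingCoeff hp x)
    (fun n _ hp => sum_crossingCoeff_mul_localDensity hs hsk n hp) hsum
  by_cases h3 : 3 ≤ k - s
  · apply hcross
    obtain ⟨K, rfl⟩ : ∃ K, k = K + 1 := ⟨k - 1, by omega⟩
    exact sum_latticeErr_le_of_add_two_le (by omega)
  -- With `s ≤ k - s ≤ 2` and `k ≥ 3` only these two pairs remain.
  · obtain ⟨rfl, rfl⟩ | ⟨rfl, rfl⟩ : (k = 3 ∧ s = 1) ∨ (k = 4 ∧ s = 2) := by omega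
    · refine abs_errorTerm_le_of_sum_le hk hs hsk threeCoeff {{0, 1}, {0, 2}} abs_threeCoeff_le
        (fun n p V hV => threeCoeff_eq_zero n p hV) (fun n p hp => sum_threeCoeff hp)
        (fun n p hp => sum_threeCoeff_mul_localDensity n hp) ?_
      simpa using sum_latticeErr_three_le
    · apply hcross
      obtain ⟨C, hC, hb⟩ := sum_latticeErr_four_two_le
      exact ⟨C, hC, fun n N _ hN => hb n N hN⟩

theorem exists_abs_errorTerm_le {k s : ℕ} (hk : 3 ≤ k) (hs : 1 ≤ s) (hsk : s ≤ k - 1) :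
    ∃ C : ℝ, 0 ≤ C ∧ ∀ n : ℕ, 1 ≤ n →
      |errorTerm k s n| ≤ C * (n : ℝ) ^ (k - 2) * (1 + Real.log n) ^ max s (k - s) := by
  rcases le_total s (k - s) with h | h
  · exact abs_errorTerm_le_of_le_sub hk hs h
  · have h' : k - s ≤ k - (k - s) := by omega
    obtain ⟨C, hC, hb⟩ := abs_errorTerm_le_of_le_sub hk (by omega : 1 ≤ k - s) h'
    refine ⟨C, hC, fun n hn => ?_⟩
    have := hb n hn
    rwa [errorTerm_sub (by omega), Nat.sub_sub_self (by omega), max_comm] at this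

theorem isBigO_errorTerm {k s : ℕ} (hk : 3 ≤ k) (hs : 1 ≤ s) (hsk : s ≤ k - 1) :
    (fun n : ℕ => errorTerm k s n) =O[atTop]
      fun n : ℕ => (n : ℝ) ^ (k - 2) * Real.log n ^ max s (k - s) := by
  obtain ⟨C, hC, h⟩ := exists_abs_errorTerm_le hk hs hsk
  refine IsBigO.of_bound (C * 2 ^ max s (k - s)) ?_
  have hlog : ∀ᶠ n : ℕ in atTop, 1 ≤ Real.log n :=
    (Real.tendsto_log_atTop.comp tendsto_natCast_atTop_atTop).eventually_ge_atTop 1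
  filter_upwards [eventually_ge_atTop 1, hlog] with n hn hl
  rw [Real.norm_eq_abs, Real.norm_of_nonneg (by positivity)]
  calc |errorTerm k s n| ≤ C * (n : ℝ) ^ (k - 2) * (1 + Real.log n) ^ max s (k - s) := h n hn
    _ ≤ C * (n : ℝ) ^ (k - 2) * (2 * Real.log n) ^ max s (k - s) := by
        gcongr
        linarith
    _ = _ := by
        rw [mul_pow]
        ring

end ErrorBound

theorem theorem1 (k s : ℕ) (hk : 3 ≤ k) (hs : 1 ≤ s) (hsk : s ≤ k - 1) :
    (∀ p : ℕ, p.Prime → (p : ℝ) ^ (k - 1) - polyF k s p ≠ 0) ∧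
    Multipliable (eulerFactor k s) ∧
    (4 ≤ k → (fun n : ℕ => errorTerm k s n) =O[atTop]
      fun n : ℕ => (n : ℝ) ^ (k - 2) * Real.log n ^ max s (k - s)) ∧
    (k = 3 → (fun n : ℕ => errorTerm k s n) =O[atTop]
      fun n : ℕ => (n : ℝ) * Real.log n ^ 2 * Real.log (Real.log n)) := by
  refine ⟨fun p hp => (pow_sub_polyF_pos hs hsk hp).ne', (hasProd_eulerFactor hk hs hsk).multipliable,
    fun _ => isBigO_errorTerm hk hs hsk, ?_⟩
  rintro rfl
  -- The bound `n (log n)^2` is already available; eventually `log log n ≥ 1`.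
  refine (isBigO_errorTerm hk hs hsk).trans (IsBigO.of_bound 1 ?_)
  have hmax : max s (3 - s) = 2 := by omega
  have hloglog : ∀ᶠ n : ℕ in atTop, 1 ≤ Real.log (Real.log n) :=
    (Real.tendsto_log_atTop.comp (Real.tendsto_log_atTop.comp
      tendsto_natCast_atTop_atTop)).eventually_ge_atTop 1
  filter_upwards [hloglog] with n hl
  rw [hmax, one_mul, Real.norm_of_nonneg (by positivity), Real.norm_of_nonneg (by positivity),
    show 3 - 2 = 1 from rfl, pow_one]
  exact le_mul_of_one_le_right (by positivity) hl
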